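/- **Conventions.** All spaces are compactly generated Hausdorff, products are taken in that category, and permutations are multiplied from left to right, $(\sigma\tau)(i)=\tau(\sigma(i))$. An *operad* $\mathscr C$ is a sequence $\{\mathscr C(n)\}_{n\ge 0}$ with $\mathscr C(0)=*$, a unit $1\in\mathscr C(1)$ and compositions $\gamma:\mathscr C(k)\times\mathscr C(m_1)\times\cdots\times\mathscr C(m_k)\to\mathscr C(m_1+\cdots+m_k)$ that are associative and unital; no symmetric group actions are required. $\mathscr S=\{S_n\}$ is the symmetric groups operad. A *group operad* $\mathscr G=\{G_n\}$ is a (discrete) operad of groups with unit $1\in G_1$, together with an operad morphism $\pi:\mathscr G\to\mathscr S$ consisting of homomorphisms, such that $\gamma(aa';b_1b_1',\dots,b_kb_k')=\gamma(a;b_1,\dots,b_k)\,\gamma(a';b'_{a^{-1}(1)},\dots,b'_{a^{-1}(k)})$, where $a^{-1}(i)$ means $\pi(a)^{-1}(i)$. A *$\mathscr G$-operad* is a topological operad with left actions of $G_n$ on $\mathscr C(n)$ by homeomorphisms such that $\gamma(\sigma a;\tau_1b_1,\dots,\tau_kb_k)=\gamma(\sigma;\tau_1,\dots,\tau_k)\,\gamma(a;b_{\sigma^{-1}(1)},\dots,b_{\sigma^{-1}(k)})$;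 it is *covering* if each of these actions is a covering action (every point has an open neighbourhood disjoint from all its nontrivial translates). Morphisms are equivariant continuous maps preserving $1$ and $\gamma$. Let $\mathscr I(k)$ be the space of $k$-tuples of nondegenerate closed subintervals of $[0,1]$ with disjoint interiors, ordered from left to right; this is the operad $(\mathscr C_1)_0$ of ordered little intervals. Let $c_k=([0,\frac1k],\dots,[\frac{k-1}k,1])$. A *well-pointed* $\mathscr G$-operad (a $\mathscr G$-operad *with a good basepoint*) is a $\mathscr G$-operad $\mathscr C$ with a morphism of nonsymmetric topological operads $\eta:\mathscr I\to\mathscr C$; put $e_k=\eta(c_k)$. A *morphism of well-pointed* $\mathscr G$-operads is a morphism $\psi$ with $\eta'=\psi\circ\eta$. A morphism $\psi:\mathscr C\to\mathscr C'$ is an *equivalence* if either every $\psi_k$ is a $G_k$-equivariant homotopy equivalence, or every $\psi_k$ is a homotopy equivalence and both operads are covering. Two well-pointed $\mathscr G$-operads are *equivalent* if they are joined by a finite chain of equivalences (in either direction) of well-pointed $\mathscr G$-operads that are morphisms of well-pointed $\mathscr G$-operads. For a path-connected well-pointed covering $\mathscr G$-operad, the *fundamental groups operad* $\pi_1(\mathscr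 C/\mathscr G)=\{\pi_1(\mathscr C(k)/G_k)\}_k$ is described as follows: identify $\pi_1(\mathscr C(k)/G_k)$ with the set of homotopy classes rel endpoints of paths $f$ in $\mathscr C(k)$ from $e_k$ to a point $g\,e_k$, $g=:p(f)\in G_k$, with product $[f]*[f']=[f\cdot p(f)f']$ and projection $p:\pi_1(\mathscr C(k)/G_k)\to G_k$. The composition $\gamma([f];[g_1],\dots,[g_k])$ is the class of the path $$e_m\to\gamma(e_k;e_{m_1},\dots,e_{m_k})\xrightarrow{\ \gamma(f;g_1,\dots,g_k)\ }\rho\,\gamma(e_k;e_{m_{\sigma^{-1}(1)}},\dots,e_{m_{\sigma^{-1}(k)}})\to\rho\,e_m,$$ where $m=m_1+\cdots+m_k$, $\sigma=p(f)$, $\rho=\gamma(\sigma;p(g_1),\dots,p(g_k))$, and the unlabelled arrows are (the translate by $\rho$, in the last case, of) images under $\eta$ of straight-line paths in $\mathscr I(m)$. An isomorphism of fundamental groups operads *over $\mathscr G$* is a family of group isomorphisms, one in each arity, commuting with $\gamma$ and with the projections $p$ to $\mathscr G$ (hence also with the projections to $\mathscr S$). A space is a *$K(\pi,1)$* if it is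 path-connected, has the homotopy type of a CW complex, and has a contractible covering space. **Theorem.** Let $\mathscr G$ be a group operad and let $\mathscr C,\mathscr C'$ be two well-pointed covering $\mathscr G$-operads such that, for every $k$, the spaces $\mathscr C(k)$ and $\mathscr C'(k)$ are path-connected, locally path-connected, semilocally simply-connected and $K(\pi,1)$ ($\pi$ may depend on $k$ and on the operad). Then $\mathscr C$ and $\mathscr C'$ are equivalent as well-pointed $\mathscr G$-operads if and only if $\pi_1(\mathscr C/\mathscr G)$ and $\pi_1(\mathscr C'/\mathscr G)$ are isomorphic over $\mathscr G$. -/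

import Mathlib

universe u v

noncomputable section

namespace KPiOneOperads

/-! ## Blocks of indices -/

/-- The ordered concatenation of blocks of sizes `m 0, m 1, …` identified with `Fin n`. -/
def block {k n : ℕ} (m : Fin k → ℕ) (h : ∑ i, m i = n) : ((i : Fin k) × Fin (m i)) ≃ Fin n :=
  finSigmaFinEquiv.trans (finCongr h)

theorem block_apply_val {k n : ℕ} (m : Fin k → ℕ) (h : ∑ i, m i = n)
    (p : (i : Fin k) × Fin (m i)) :
    (block m h p : ℕ) = ∑ i : Fin p.1, m (Fin.castLE p.1.2.le i) + p.2 := by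
  simp only [block, Equiv.trans_apply, finCongr_apply, Fin.val_cast]
  exact finSigmaFinEquiv_apply p

theorem block_lt_of_fst_lt {k n : ℕ} (m : Fin k → ℕ) (h : ∑ i, m i = n)
    (p q : (i : Fin k) × Fin (m i)) (hpq : p.1 < q.1) : block m h p < block m h q := by
  rw [Fin.lt_def, block_apply_val, block_apply_val]
  have key : ∀ i : Fin k, ∑ j : Fin i, m (Fin.castLE i.2.le j)
      = ∑ j ∈ Finset.range i, (if hj : j < k then m ⟨j, hj⟩ else 0) := by
    intro i
    rw [← Fin.sum_univ_eq_sum_range (fun j => if hj : j < k then m ⟨j, hj⟩ else 0) (i : ℕ)]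
    refine Finset.sum_congr rfl fun j _ => ?_
    have hj : (j : ℕ) < k := j.2.trans i.2
    rw [dif_pos hj]
    rfl
  rw [key, key]
  have h1 : ∑ j ∈ Finset.range (p.1 + 1), (if hj : j < k then m ⟨j, hj⟩ else 0)
      ≤ ∑ j ∈ Finset.range q.1, (if hj : j < k then m ⟨j, hj⟩ else 0) :=
    Finset.sum_le_sum_of_subset (Finset.range_subset_range.2 hpq)
  rw [Finset.sum_range_succ] at h1
  have h2 := p.2.2
  rw [dif_pos p.1.2] at h1
  have h3 : m ⟨(p.1 : ℕ), p.1.2⟩ = m p.1 := rfl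
  omega

theorem block_symm_lt {k n : ℕ} (m : Fin k → ℕ) (h : ∑ i, m i = n) {a b : Fin n} (hab : a < b) :
    ((block m h).symm a).1 < ((block m h).symm b).1 ∨
      ∃ e : ((block m h).symm a).1 = ((block m h).symm b).1,
        Fin.cast (congrArg m e) ((block m h).symm a).2 < ((block m h).symm b).2 := by
  obtain ⟨p, rfl⟩ := (block m h).surjective a
  obtain ⟨q, rfl⟩ := (block m h).surjective b
  simp only [Equiv.symm_apply_apply]
  rcases lt_trichotomy p.1 q.1 with h1 | h1 | h1
  · exact Or.inl h1
  · refine Or.inr ⟨h1, ?_⟩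
    obtain ⟨i, x⟩ := p
    obtain ⟨j, y⟩ := q
    obtain rfl : i = j := h1
    rw [Fin.lt_def, block_apply_val, block_apply_val] at hab
    have hxy : (x : ℕ) < y := Nat.lt_of_add_lt_add_left (n := ∑ l : Fin i, m (Fin.castLE i.2.le l)) hab
    have hc : ∀ p q : (i : Fin k) × Fin (m i), p = ⟨i, x⟩ → q = ⟨i, y⟩ → ∀ e : p.1 = q.1,
        Fin.cast (congrArg m e) p.2 < q.2 := by
      rintro p q rfl rfl e
      exact hxy
    exact hc _ _ ((block m h).symm_apply_apply _) ((block m h).symm_apply_apply _)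
      (by simp only [Equiv.symm_apply_apply])
  · exact absurd hab (not_lt.2 (block_lt_of_fst_lt m h q p h1).le)

theorem sum_reindex {k n : ℕ} (σ : Equiv.Perm (Fin k)) (m : Fin k → ℕ) (h : ∑ i, m i = n) :
    ∑ i, m (σ i) = n := by
  rw [Equiv.sum_comp σ m, h]

theorem sum_block {k M N : ℕ} (m : Fin k → ℕ) (h : ∑ i, m i = M) (q : Fin M → ℕ)
    (hq : ∑ j, q j = N) : ∑ i, ∑ l, q (block m h ⟨i, l⟩) = N := by
  rw [← Fintype.sum_sigma' (f := fun i l => q (block m h ⟨i, l⟩)), ← hq]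
  exact Equiv.sum_comp (block m h) q

/-! ## Operads and group operads -/

/-- The structure of a nonsymmetric operad on a sequence `C 0, C 1, …` of sets with `C 0` a point.
The composition `γ(a; b₁, …, b_k) ∈ C(m₁ + ⋯ + m_k)` is written `comp m h a b`, where `h` is the
identification of `m₁ + ⋯ + m_k` with the arity `n` of the result. -/
structure OperadStr (C : ℕ → Type u) where
  subsingleton_zero : Subsingleton (C 0)
  nonempty_zero : Nonempty (C 0)
  one : C 1
  comp : ∀ {k n : ℕ} (m : Fin k → ℕ), ∑ i, m i = n → C k → (∀ i, C (m i)) → C n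
  one_comp : ∀ {n : ℕ} (h : ∑ _ : Fin 1, n = n) (a : C n), comp (fun _ => n) h one (fun _ => a) = a
  comp_one : ∀ {n : ℕ} (h : ∑ _ : Fin n, 1 = n) (a : C n), comp (fun _ => 1) h a (fun _ => one) = a
  assoc : ∀ {k M N : ℕ} (m : Fin k → ℕ) (h : ∑ i, m i = M) (q : Fin M → ℕ) (hq : ∑ j, q j = N)
    (a : C k) (b : ∀ i, C (m i)) (c : ∀ j, C (q j)),
    comp q hq (comp m h a b) c =
      comp (fun i => ∑ l, q (block m h ⟨i, l⟩)) (sum_block m h q hq) a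
        (fun i => comp (fun l => q (block m h ⟨i, l⟩)) rfl (b i) (fun l => c (block m h ⟨i, l⟩)))

/-- The symmetric group `S_n`, with permutations multiplied from left to right:
`(σ τ)(i) = τ (σ i)`. With this convention the equivariance and crossed homomorphism formulas
involving `σ⁻¹(i)` below are consistent. -/
abbrev SymGrp (n : ℕ) : Type := (Equiv.Perm (Fin n))ᵐᵒᵖ

/-- The composition `γ(σ; τ₁, …, τ_k)` of the symmetric groups operad: the `i`-th block, of size
`m i`, is permuted by `τ i` and becomes the `σ(i)`-th block of the target. -/
def symComp {k n : ℕ} (m : Fin k → ℕ) (h : ∑ i, m i = n) (σ : SymGrp k) (τ : ∀ i, SymGrp (m i)) :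
    SymGrp n :=
  MulOpposite.op <|
    (block m h).symm.trans <|
      (Equiv.sigmaCongrRight fun i => (τ i).unop).trans <|
        (Equiv.sigmaCongrLeft (β := fun i => Fin (m i)) σ.unop.symm).symm.trans <|
          block (fun i => m (σ.unop.symm i)) (sum_reindex σ.unop.symm m h)

/-- A group operad: an operad `G` of groups with a morphism `π` to the symmetric groups operad,
whose composition is a crossed homomorphism. -/
structure GroupOperad where
  G : ℕ → Type v
  [group : ∀ n, Group (G n)]
  op : OperadStr G
  π : ∀ n, G n →* SymGrp n
  one_eq : op.one = 1
  π_comp : ∀ {k n : ℕ} (m : Fin k → ℕ) (h : ∑ i, m i = n) (a : G k) (b : ∀ i, G (m i)),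
    π n (op.comp m h a b) = symComp m h (π k a) (fun i => π (m i) (b i))
  crossed : ∀ {k n : ℕ} (m : Fin k → ℕ) (h : ∑ i, m i = n) (a a' : G k) (b b' : ∀ i, G (m i)),
    op.comp m h (a * a') (fun i => b i * b' i) =
      op.comp m h a b *
        op.comp (fun i => m ((π k a).unop.symm i)) (sum_reindex (π k a).unop.symm m h) a'
          (fun i => b' ((π k a).unop.symm i))

attribute [instance] GroupOperad.group

/-- The permutation of `{1, …, n}` underlying an element of the group `G n`. -/
def GroupOperad.perm (𝒢 : GroupOperad.{v}) {n : ℕ} (g : 𝒢.G n) : Equiv.Perm (Fin n) :=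
  (𝒢.π n g).unop

/-! ## Topological operads with an action of a group operad -/

/-- A topological `𝒢`-operad. All spaces are compactly generated Hausdorff spaces, and products are
taken among those, so that continuity of the composition means continuity on compact subsets of the
usual product. The groups of `𝒢` are discrete. -/
structure GOperad (𝒢 : GroupOperad.{v}) where
  space : ℕ → Type u
  [top : ∀ n, TopologicalSpace (space n)]
  [t2 : ∀ n, T2Space (space n)]
  [compactlyGenerated : ∀ n, CompactlyCoherentSpace (space n)]
  op : OperadStr space
  continuousOn_comp : ∀ {k n : ℕ} (m : Fin k → ℕ) (h : ∑ i, m i = n)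
    (K : Set (space k × (∀ i, space (m i)))), IsCompact K →
      ContinuousOn (fun p : space k × (∀ i, space (m i)) => op.comp m h p.1 p.2) K
  [action : ∀ n, MulAction (𝒢.G n) (space n)]
  [continuous_smul : ∀ n, ContinuousConstSMul (𝒢.G n) (space n)]
  equivariance : ∀ {k n : ℕ} (m : Fin k → ℕ) (h : ∑ i, m i = n) (σ : 𝒢.G k)
    (τ : ∀ i, 𝒢.G (m i)) (a : space k) (b : ∀ i, space (m i)),
    op.comp m h (σ • a) (fun i => τ i • b i) =
      𝒢.op.comp m h σ τ •
        op.comp (fun i => m ((𝒢.perm σ).symm i)) (sum_reindex (𝒢.perm σ).symm m h) a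
          (fun i => b ((𝒢.perm σ).symm i))

attribute [instance] GOperad.top GOperad.t2 GOperad.compactlyGenerated GOperad.action
  GOperad.continuous_smul

/-- A covering action of a (discrete) group: every point has a neighbourhood that is disjoint from
all its nontrivial translates. -/
def IsCoveringAction (G : Type v) [Group G] (X : Type u) [TopologicalSpace X] [MulAction G X] :
    Prop :=
  ∀ x : X, ∃ U : Set X, IsOpen U ∧ x ∈ U ∧ ∀ g : G, g ≠ 1 → ∀ y ∈ U, g • y ∉ U

/-- A covering `𝒢`-operad. -/
def GOperad.IsCovering {𝒢 : GroupOperad.{v}} (C : GOperad.{u, v} 𝒢) : Prop :=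
  ∀ n, IsCoveringAction (𝒢.G n) (C.space n)

/-- A morphism of topological `𝒢`-operads. -/
structure GOperad.Hom {𝒢 : GroupOperad.{v}} (C D : GOperad.{u, v} 𝒢) where
  toFun : ∀ n, C(C.space n, D.space n)
  map_smul : ∀ {n : ℕ} (g : 𝒢.G n) (x : C.space n), toFun n (g • x) = g • toFun n x
  map_one : toFun 1 C.op.one = D.op.one
  map_comp : ∀ {k n : ℕ} (m : Fin k → ℕ) (h : ∑ i, m i = n) (a : C.space k)
    (b : ∀ i, C.space (m i)),
    toFun n (C.op.comp m h a b) = D.op.comp m h (toFun k a) (fun i => toFun (m i) (b i))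

/-- `f` is a homotopy equivalence. -/
def IsHomotopyEquiv {X Y : Type u} [TopologicalSpace X] [TopologicalSpace Y] (f : C(X, Y)) : Prop :=
  ∃ g : C(Y, X), (g.comp f).Homotopic (ContinuousMap.id X) ∧
    (f.comp g).Homotopic (ContinuousMap.id Y)

/-- The (equivariant) map `f` is a `G`-equivariant homotopy equivalence: it has an equivariant
inverse up to homotopies through equivariant maps. -/
def IsEquivariantHomotopyEquiv (G : Type v) [Group G] {X Y : Type u} [TopologicalSpace X]
    [TopologicalSpace Y] [MulAction G X] [MulAction G Y] (f : C(X, Y)) : Prop :=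
  ∃ g : C(Y, X), (∀ (σ : G) (y : Y), g (σ • y) = σ • g y) ∧
    (∃ H : (g.comp f).Homotopy (ContinuousMap.id X),
      ∀ (t : unitInterval) (σ : G) (x : X), H (t, σ • x) = σ • H (t, x)) ∧
    (∃ H : (f.comp g).Homotopy (ContinuousMap.id Y),
      ∀ (t : unitInterval) (σ : G) (y : Y), H (t, σ • y) = σ • H (t, y))

/-- Equivalences of topological `𝒢`-operads. -/
def GOperad.Hom.IsEquivalence {𝒢 : GroupOperad.{v}} {C D : GOperad.{u, v} 𝒢}
    (ψ : C.Hom D) : Prop :=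
  (∀ n, IsEquivariantHomotopyEquiv (𝒢.G n) (ψ.toFun n)) ∨
    ((∀ n, IsHomotopyEquiv (ψ.toFun n)) ∧ C.IsCovering ∧ D.IsCovering)

/-! ## The identity component of the little intervals operad, and good basepoints -/

/-- `(𝒞₁)₀(k)`: the `k`-tuples of nondegenerate subintervals `[x_i, y_i]` of `[0,1]` with disjoint
interiors that are ordered from left to right (this is the path component, in the space of all
`k`-tuples of little intervals, of the subdivision of `[0,1]` into `k` equal intervals). A tuple is
recorded as the pair of the tuple `x` of left ends and the tuple `y` of right ends. -/
def IsIntervals {k : ℕ} (c : (Fin k → ℝ) × (Fin k → ℝ)) : Prop :=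
  (∀ i, 0 ≤ c.1 i ∧ c.1 i < c.2 i ∧ c.2 i ≤ 1) ∧ ∀ i j, i < j → c.2 i ≤ c.1 j

/-- The space `(𝒞₁)₀(k)`, topologized as a subspace of `ℝ^k × ℝ^k`. -/
def Intervals (k : ℕ) : Type := {c : (Fin k → ℝ) × (Fin k → ℝ) // IsIntervals c}

instance (k : ℕ) : TopologicalSpace (Intervals k) := instTopologicalSpaceSubtype

/-- The operadic composition of intervals: the intervals of `b i` are rescaled linearly into the
`i`-th interval of `a`. -/
def Intervals.comp {k n : ℕ} (m : Fin k → ℕ) (h : ∑ i, m i = n) (a : Intervals k)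
    (b : ∀ i, Intervals (m i)) : Intervals n :=
  ⟨(fun p => a.1.1 ((block m h).symm p).1 +
      (a.1.2 ((block m h).symm p).1 - a.1.1 ((block m h).symm p).1) *
        (b ((block m h).symm p).1).1.1 ((block m h).symm p).2,
    fun p => a.1.1 ((block m h).symm p).1 +
      (a.1.2 ((block m h).symm p).1 - a.1.1 ((block m h).symm p).1) *
        (b ((block m h).symm p).1).1.2 ((block m h).symm p).2), by
    constructor
    · intro p
      dsimp only
      generalize (block m h).symm p = q
      obtain ⟨h1, h2, h3⟩ := a.2.1 q.1
      obtain ⟨h4, h5, h6⟩ := (b q.1).2.1 q.2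
      refine ⟨?_, ?_, ?_⟩ <;> nlinarith
    · intro p p' hp
      have hb := block_symm_lt m h hp
      dsimp only
      generalize (block m h).symm p = q at hb
      generalize (block m h).symm p' = q' at hb
      obtain ⟨h1, h2, h3⟩ := a.2.1 q.1
      obtain ⟨h4, h5, h6⟩ := (b q.1).2.1 q.2
      obtain ⟨h1', h2', h3'⟩ := a.2.1 q'.1
      obtain ⟨h4', h5', h6'⟩ := (b q'.1).2.1 q'.2
      rcases hb with hb | ⟨e, hb⟩
      · have := a.2.2 _ _ hb
        nlinarith
      · obtain ⟨i, x⟩ := q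
        obtain ⟨j, y⟩ := q'
        obtain rfl : i = j := e
        have := (b i).2.2 x y hb
        dsimp only at *
        nlinarith⟩

/-- `c_k = ([0, 1/k], [1/k, 2/k], …, [(k-1)/k, 1])`. In particular `c₁` is the unit. -/
def Intervals.base (k : ℕ) : Intervals k :=
  ⟨(fun i => (i : ℝ) / k, fun i => ((i : ℝ) + 1) / k), by
    constructor
    · intro i
      have hk : (0 : ℝ) < k := by exact_mod_cast i.pos
      have hi : (i : ℝ) + 1 ≤ k := by exact_mod_cast i.2
      refine ⟨by positivity, by dsimp only; gcongr; linarith, ?_⟩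
      dsimp only
      rw [div_le_one hk]
      exact hi
    · intro i j hij
      have hij' : (i : ℝ) + 1 ≤ j := by exact_mod_cast hij
      dsimp only
      gcongr⟩

/-- The linear path `t ↦ (1 - t) c + t c'` in `(𝒞₁)₀(k)`. -/
def Intervals.linearPath {k : ℕ} (c c' : Intervals k) : Path c c' where
  toFun t := ⟨(1 - (t : ℝ)) • c.1 + (t : ℝ) • c'.1, by
    have ht0 := t.2.1
    have ht1 := t.2.2
    constructor
    · intro i
      obtain ⟨h1, h2, h3⟩ := c.2.1 i
      obtain ⟨h4, h5, h6⟩ := c'.2.1 i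
      simp only [Prod.fst_add, Prod.smul_fst, Prod.snd_add, Prod.smul_snd, Pi.add_apply,
        Pi.smul_apply, smul_eq_mul]
      refine ⟨by nlinarith, ?_, by nlinarith⟩
      rcases eq_or_lt_of_le ht0 with h | h
      · rw [← h]; linarith
      · nlinarith
    · intro i j hij
      have h1 := c.2.2 i j hij
      have h2 := c'.2.2 i j hij
      simp only [Prod.fst_add, Prod.smul_fst, Prod.snd_add, Prod.smul_snd, Pi.add_apply,
        Pi.smul_apply, smul_eq_mul]
      nlinarith⟩
  continuous_toFun := by
    refine Continuous.subtype_mk ?_ _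
    fun_prop
  source' := by
    apply Subtype.ext
    simp
  target' := by
    apply Subtype.ext
    simp

/-- A well-pointed topological `𝒢`-operad: a topological `𝒢`-operad together with a morphism
`η : (𝒞₁)₀ → C` of nonsymmetric topological operads. The points `η(c_k)` are the good basepoint. -/
structure WellPointedGOperad (𝒢 : GroupOperad.{v}) extends GOperad.{u, v} 𝒢 where
  η : ∀ k, C(Intervals k, space k)
  η_one : η 1 (Intervals.base 1) = op.one
  η_comp : ∀ {k n : ℕ} (m : Fin k → ℕ) (h : ∑ i, m i = n) (a : Intervals k)
    (b : ∀ i, Intervals (m i)),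
    η n (Intervals.comp m h a b) = op.comp m h (η k a) (fun i => η (m i) (b i))

/-- `C` and `D` are connected by one equivalence that is a morphism of well-pointed operads. -/
def WellPointedGOperad.EquivStep {𝒢 : GroupOperad.{v}} (C D : WellPointedGOperad.{u, v} 𝒢) : Prop :=
  ∃ ψ : C.toGOperad.Hom D.toGOperad, ψ.IsEquivalence ∧
    ∀ (k : ℕ) (c : Intervals k), D.η k c = ψ.toFun k (C.η k c)

/-- Two well-pointed topological `𝒢`-operads are equivalent if there is a (finite) chain of
equivalences, pointing in arbitrary directions, connecting them. -/
def WellPointedGOperad.Equivalent {𝒢 : GroupOperad.{v}} (C D : WellPointedGOperad.{u, v} 𝒢) : Prop :=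
  Relation.EqvGen WellPointedGOperad.EquivStep C D

/-! ## The fundamental groups operad -/

section Fundamental

variable {𝒢 : GroupOperad.{v}} (C : WellPointedGOperad.{u, v} 𝒢)

/-- The good basepoint `e_k = η(c_k)`. -/
def basepoint (k : ℕ) : C.space k := C.η k (Intervals.base k)

/-- The underlying set of `π₁(C(k)/G_k)`, identified with the set `π₁(C(k); e_k, G_k e_k)` of
homotopy classes of paths in `C(k)` from `e_k` to a point `g e_k` of its orbit (the action being a
covering action, `g` is determined by the end point of the path). -/
structure Fundamental (k : ℕ) where
  /-- the element `g ∈ G_k`; this is the projection `π₁(C(k)/G_k) → G_k` -/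
  proj : 𝒢.G k
  /-- the homotopy class relative to the end points of a path from `e_k` to `g e_k` -/
  cls : Path.Homotopic.Quotient (basepoint C k) (proj • basepoint C k)

variable {C} in
/-- Translation of a homotopy class of paths by an element of the group. -/
def translate {n : ℕ} (g : 𝒢.G n) {x y : C.space n} (p : Path.Homotopic.Quotient x y) :
    Path.Homotopic.Quotient (g • x) (g • y) :=
  p.map ⟨fun x => g • x, continuous_const_smul g⟩

variable {C} in
theorem Fundamental.ext' {k : ℕ} {x y : Fundamental C k} (h : x.proj = y.proj)
    (h' : x.cls.cast rfl (by rw [h]) = y.cls) : x = y := by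
  obtain ⟨g, p⟩ := x
  obtain ⟨g', q⟩ := y
  obtain rfl : g = g' := h
  rw [Path.Homotopic.Quotient.cast_rfl_rfl] at h'
  obtain rfl : p = q := h'
  rfl

theorem cls_trans_cast {X : Type u} [TopologicalSpace X] {x y z z' : X}
    (p : Path.Homotopic.Quotient x y) (q : Path.Homotopic.Quotient y z) (h : z' = z) :
    p.trans (q.cast rfl h) = (p.trans q).cast rfl h := by
  subst h
  simp

theorem cls_trans_cast_left {X : Type u} [TopologicalSpace X] {x y y' z : X}
    (p : Path.Homotopic.Quotient x y) (q : Path.Homotopic.Quotient y' z) (h : y' = y) :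
    (p.cast rfl h).trans q = p.trans (q.cast h.symm rfl) := by
  subst h
  simp

theorem cls_cast_trans_cast {X : Type u} [TopologicalSpace X] {x x' y z z' : X}
    (p : Path.Homotopic.Quotient x y) (q : Path.Homotopic.Quotient y z) (hx : x' = x)
    (hz : z' = z) : ((p.cast hx rfl).trans q).cast rfl hz = (p.trans q).cast hx hz := by
  subst hx hz
  simp

theorem cls_cast_refl {X : Type u} [TopologicalSpace X] {x y z : X} (h : y = x) (h' : z = x) :
    (Path.Homotopic.Quotient.refl x).cast h h' =
      (Path.Homotopic.Quotient.refl y).cast rfl (h'.trans h.symm) := by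
  subst h h'
  simp

theorem translate_cast {n : ℕ} (g : 𝒢.G n) {x y x' y' : C.space n}
    (p : Path.Homotopic.Quotient x y) (hx : x' = x) (hy : y' = y) :
    translate g (p.cast hx hy) = (translate g p).cast (by rw [hx]) (by rw [hy]) := by
  subst hx hy
  simp

theorem translate_trans {n : ℕ} (g : 𝒢.G n) {x y z : C.space n}
    (p : Path.Homotopic.Quotient x y) (q : Path.Homotopic.Quotient y z) :
    translate g (p.trans q) = (translate g p).trans (translate g q) := by
  induction p with | mk p =>
  induction q with | mk q =>
  exact congrArg Path.Homotopic.Quotient.mk (p.map_trans q (continuous_const_smul g))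

theorem translate_refl {n : ℕ} (g : 𝒢.G n) (x : C.space n) :
    translate g (Path.Homotopic.Quotient.refl x) = Path.Homotopic.Quotient.refl (g • x) := rfl

theorem translate_symm {n : ℕ} (g : 𝒢.G n) {x y : C.space n}
    (p : Path.Homotopic.Quotient x y) : translate g p.symm = (translate g p).symm := by
  induction p with | mk p => rfl

theorem translate_mul {n : ℕ} (g h : 𝒢.G n) {x y : C.space n}
    (p : Path.Homotopic.Quotient x y) :
    translate (g * h) p =
      (translate g (translate h p)).cast (mul_smul g h x) (mul_smul g h y) := by
  induction p with | mk p =>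
  refine congrArg Path.Homotopic.Quotient.mk ?_
  ext t
  exact mul_smul g h (p t)

theorem translate_one {n : ℕ} {x y : C.space n} (p : Path.Homotopic.Quotient x y) :
    translate (1 : 𝒢.G n) p = p.cast (one_smul _ x) (one_smul _ y) := by
  induction p with | mk p =>
  refine congrArg Path.Homotopic.Quotient.mk ?_
  ext t
  exact one_smul _ (p t)

/-- The product of `π₁(C(k)/G_k)` under the identification above: `[f] * [f'] = [f] · [(π f) f']`. -/
def Fundamental.mul {k : ℕ} (x y : Fundamental C k) : Fundamental C k where
  proj := x.proj * y.proj
  cls := x.cls.trans ((translate x.proj y.cls).cast rfl (mul_smul _ _ _))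

/-- The class of the constant path. -/
def Fundamental.one (k : ℕ) : Fundamental C k where
  proj := 1
  cls := (Path.Homotopic.Quotient.refl (basepoint C k)).cast rfl (one_smul _ _)

/-- The inverse of `[f]` is the class of the translate by `(π f)⁻¹` of the reversed path. -/
def Fundamental.inv {k : ℕ} (x : Fundamental C k) : Fundamental C k where
  proj := x.proj⁻¹
  cls := (translate x.proj⁻¹ x.cls.symm).cast (inv_smul_smul _ _).symm rfl

instance (k : ℕ) : Group (Fundamental C k) where
  mul := Fundamental.mul C
  one := Fundamental.one C k
  inv := Fundamental.inv C
  mul_assoc x y z := by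
    change Fundamental.mul C (Fundamental.mul C x y) z = Fundamental.mul C x (Fundamental.mul C y z)
    refine Fundamental.ext' (mul_assoc x.proj y.proj z.proj) ?_
    simp only [Fundamental.mul, translate_trans, cls_trans_cast, translate_cast,
      Path.Homotopic.Quotient.cast_cast, translate_mul, cls_trans_cast_left,
      Path.Homotopic.Quotient.trans_assoc]
    exact Path.Homotopic.Quotient.cast_cast _ _ _ _ _
  one_mul x := by
    change Fundamental.mul C (Fundamental.one C k) x = x
    refine Fundamental.ext' (one_mul x.proj) ?_
    simp only [Fundamental.mul, Fundamental.one, translate_one, cls_trans_cast_left,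
      Path.Homotopic.Quotient.refl_trans, Path.Homotopic.Quotient.cast_cast]
    exact (Path.Homotopic.Quotient.cast_cast _ _ _ _ _).trans
      (Path.Homotopic.Quotient.cast_rfl_rfl _)
  mul_one x := by
    change Fundamental.mul C x (Fundamental.one C k) = x
    refine Fundamental.ext' (mul_one x.proj) ?_
    simp only [Fundamental.mul, Fundamental.one, translate_cast, translate_refl,
      Path.Homotopic.Quotient.cast_cast, cls_trans_cast, Path.Homotopic.Quotient.trans_refl]
    exact (Path.Homotopic.Quotient.cast_cast _ _ _ _ _).trans
      (Path.Homotopic.Quotient.cast_rfl_rfl _)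
  inv_mul_cancel x := by
    change Fundamental.mul C (Fundamental.inv C x) x = Fundamental.one C k
    refine Fundamental.ext' (inv_mul_cancel x.proj) ?_
    simp only [Fundamental.mul, Fundamental.inv, Fundamental.one, cls_trans_cast, translate_symm,
      cls_cast_trans_cast, Path.Homotopic.Quotient.symm_trans]
    exact (Path.Homotopic.Quotient.cast_cast _ _ _ _ _).trans (cls_cast_refl _ _)

variable {C}

/-- The path `t ↦ γ(f(t); g₁(t), …, g_k(t))`. -/
def compPath {k n : ℕ} (m : Fin k → ℕ) (h : ∑ i, m i = n) {a a' : C.space k}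
    {b b' : ∀ i, C.space (m i)} (f : Path a a') (g : ∀ i, Path (b i) (b' i)) :
    Path (C.op.comp m h a b) (C.op.comp m h a' b') where
  toFun t := C.op.comp m h (f t) (fun i => g i t)
  continuous_toFun := by
    have hc : Continuous fun t : unitInterval => (f t, fun i => g i t) := by fun_prop
    have h2 := C.continuousOn_comp m h _ (isCompact_range hc)
    exact h2.comp_continuous hc fun t => Set.mem_range_self t
  source' := by simp
  target' := by simp

theorem compPath_homotopic {k n : ℕ} (m : Fin k → ℕ) (h : ∑ i, m i = n) {a a' : C.space k}
    {b b' : ∀ i, C.space (m i)} {f f' : Path a a'} {g g' : ∀ i, Path (b i) (b' i)}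
    (hf : f.Homotopic f') (hg : ∀ i, (g i).Homotopic (g' i)) :
    (compPath m h f g).Homotopic (compPath m h f' g') := by
  obtain ⟨F⟩ := hf
  have H := fun i => (hg i).some
  refine ⟨⟨⟨⟨fun p => C.op.comp m h (F p) (fun i => H i p), ?_⟩, ?_, ?_⟩, ?_⟩⟩
  · have hc : Continuous fun p : unitInterval × unitInterval => (F p, fun i => H i p) := by
      fun_prop
    exact (C.continuousOn_comp m h _ (isCompact_range hc)).comp_continuous hc
      fun t => Set.mem_range_self t
  · intro t
    simp [compPath]
  · intro t
    simp [compPath]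
  · intro t x hx
    rcases hx with rfl | hx
    · simp [compPath]
    · rw [Set.mem_singleton_iff] at hx
      subst hx
      simp [compPath]

/-- The class `γ([f]; [g₁], …, [g_k])` of `t ↦ γ(f(t); g₁(t), …, g_k(t))`. -/
def compClass {k n : ℕ} (m : Fin k → ℕ) (h : ∑ i, m i = n) {a a' : C.space k}
    {b b' : ∀ i, C.space (m i)} (f : Path.Homotopic.Quotient a a')
    (g : ∀ i, Path.Homotopic.Quotient (b i) (b' i)) :
    Path.Homotopic.Quotient (C.op.comp m h a b) (C.op.comp m h a' b') :=
  Path.Homotopic.Quotient.mk (compPath m h (Quotient.out f) (fun i => Quotient.out (g i)))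

theorem compClass_mk {k n : ℕ} (m : Fin k → ℕ) (h : ∑ i, m i = n) {a a' : C.space k}
    {b b' : ∀ i, C.space (m i)} (f : Path a a') (g : ∀ i, Path (b i) (b' i)) :
    compClass m h (Path.Homotopic.Quotient.mk f) (fun i => Path.Homotopic.Quotient.mk (g i)) =
      Path.Homotopic.Quotient.mk (compPath m h f g) :=
  Path.Homotopic.Quotient.eq.2 <| compPath_homotopic m h
    (Path.Homotopic.Quotient.exact (Quotient.out_eq _))
    (fun _ => Path.Homotopic.Quotient.exact (Quotient.out_eq _))

variable (C) in
/-- The (image under `η` of the) linear path from `e_n` to `γ(e_k; e_{m_1}, …, e_{m_k})`. -/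
def basePath {k n : ℕ} (m : Fin k → ℕ) (h : ∑ i, m i = n) :
    Path (basepoint C n) (C.op.comp m h (basepoint C k) (fun i => basepoint C (m i))) :=
  ((Intervals.linearPath (Intervals.base n)
    (Intervals.comp m h (Intervals.base k) (fun i => Intervals.base (m i)))).map
      (C.η n).continuous).cast rfl (C.η_comp m h _ _).symm

/-- The composition of the fundamental groups operad: for `[f], [g_i]` with projections `σ, τ_i`,
`γ([f]; [g₁], …, [g_k])` is the class of the path
`e_n → γ(e_k; e_{m_1}, …) → γ(σ e_k; τ₁ e_{m_1}, …) = γ(σ; τ₁, …) γ(e_k; e_{m_{σ⁻¹(1)}}, …) →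
γ(σ; τ₁, …) e_n`, where the middle arrow is `γ(f; g₁, …, g_k)` and the outer ones come from linear
paths. -/
def Fundamental.comp {k n : ℕ} (m : Fin k → ℕ) (h : ∑ i, m i = n) (x : Fundamental C k)
    (y : ∀ i, Fundamental C (m i)) : Fundamental C n where
  proj := 𝒢.op.comp m h x.proj (fun i => (y i).proj)
  cls :=
    ((Path.Homotopic.Quotient.mk (basePath C m h)).trans
      ((compClass m h x.cls (fun i => (y i).cls)).cast rfl
        (C.equivariance m h x.proj (fun i => (y i).proj) (basepoint C k)
          (fun i => basepoint C (m i))).symm)).trans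
      (translate (𝒢.op.comp m h x.proj (fun i => (y i).proj))
        (Path.Homotopic.Quotient.mk
          (basePath C (fun i => m ((𝒢.perm x.proj).symm i))
            (sum_reindex (𝒢.perm x.proj).symm m h)).symm))

end Fundamental

/-- An isomorphism `π₁(C/𝒢) ≅ π₁(C'/𝒢)` of fundamental groups operads over `𝒢`: group isomorphisms
in every arity, compatible with the operadic compositions and with the projections to `𝒢`. -/
structure FundamentalIso {𝒢 : GroupOperad.{v}} (C C' : WellPointedGOperad.{u, v} 𝒢) where
  toEquiv : ∀ k, Fundamental C k ≃* Fundamental C' k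
  proj_eq : ∀ {k : ℕ} (x : Fundamental C k), (toEquiv k x).proj = x.proj
  map_comp : ∀ {k n : ℕ} (m : Fin k → ℕ) (h : ∑ i, m i = n) (x : Fundamental C k)
    (y : ∀ i, Fundamental C (m i)),
    toEquiv n (Fundamental.comp m h x y) =
      Fundamental.comp m h (toEquiv k x) (fun i => toEquiv (m i) (y i))

/-! ## `K(π,1)` spaces and local conditions -/

/-- Every point has a neighbourhood all of whose loops at that point are null-homotopic in `X`. -/
def SemilocallySimplyConnected (X : Type u) [TopologicalSpace X] : Prop :=
  ∀ x : X, ∃ U : Set X, IsOpen U ∧ x ∈ U ∧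
    ∀ p : Path x x, (∀ t, p t ∈ U) → p.Homotopic (Path.refl x)

/-- `X` has the homotopy type of a CW complex. -/
def HasCWHomotopyType (X : Type u) [TopologicalSpace X] : Prop :=
  ∃ (Y : Type u) (_ : TopologicalSpace Y) (_ : T2Space Y),
    Nonempty (Topology.CWComplex (Set.univ : Set Y)) ∧ Nonempty (ContinuousMap.HomotopyEquiv X Y)

/-- `X` is a `K(π,1)` for some group `π`: a path-connected space of the homotopy type of a CW
complex which has a contractible (hence universal) covering space. -/
structure IsKPiOne (X : Type u) [TopologicalSpace X] : Prop where
  pathConnected : PathConnectedSpace X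
  cw : HasCWHomotopyType X
  contractible_cover : ∃ (E : Type u) (_ : TopologicalSpace E) (p : E → X),
    ContractibleSpace E ∧ IsCoveringMap p

/-- The standing assumptions on a path-connected, locally path-connected and semilocally
simply-connected `K(π,1)` covering `𝒢`-operad. -/
structure GOperad.IsNiceKPiOne {𝒢 : GroupOperad.{v}} (C : GOperad.{u, v} 𝒢) : Prop where
  covering : C.IsCovering
  pathConnected : ∀ k, PathConnectedSpace (C.space k)
  locPathConnected : ∀ k, LocallyPathConnectedSpace (C.space k)
  semilocallySimplyConnected : ∀ k, SemilocallySimplyConnected (C.space k)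
  kPiOne : ∀ k, IsKPiOne (C.space k)

end KPiOneOperads

end

open KPiOneOperads

/-! The forward direction is functoriality. An equivalence of well-pointed operads is a homotopy
equivalence in every arity. It therefore maps the classes of paths from `e_k` to `g e_k`
bijectively, and being equivariant and compatible with `η` and `γ` it respects the product, the
projection to `𝒢` and the composition (`FundamentalIso.ofIsEquivalence`). Such isomorphisms can be
composed and inverted along a chain.

For the converse, let `φ` be an isomorphism over `𝒢`. The kernel of `p : π₁(C(n)/G_n) → G_n` is
`π₁(C(n))`, so `φ` restricts to an isomorphism `π₁(C(n)) ≅ π₁(C'(n))`. Realize universal covers as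
sets of homotopy classes of based paths and put `D(n) = (C(n)~ × C'(n)~) / π₁(C(n))`, with loops
acting diagonally through `φ`; this is the covering of `C(n) × C'(n)` that belongs to the graph of
the isomorphism. Based paths are composed operadically by applying `γ` pointwise after the
connecting path from `e_n`, and the whole group `π₁(C(n)/G_n)` acts on them. The formula `γ(f P; g_i
Q_i) = γ(f; g_i) γ(P; Q_{σ⁻¹(i)})` (`BasedPath.comp_smul`), together with the fact that `φ`
preserves `γ`, shows that composition descends to `D` and is equivariant for `G_n`, the quotient of
`π₁(C(n)/G_n)` by its loops. Associativity, units and the basepoint `η` involve only connecting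
paths that come from the contractible spaces of intervals, so they hold automatically.

Thus `D` is a well-pointed covering operad with projections `C ← D → C'`, and these must be shown to
be homotopy equivalences. The fibre of `D(n) → C(n)` is the universal cover of `C'(n)`, which is
contractible. Over a simply connected compact space the projection is trivial
(`exists_trivialization`). Hence over a CW complex mapping to `C(n)` a section, and a contraction of
the fibres onto it, can be built one cell at a time by extending maps into a contractible space from
spheres to balls (`exists_section`, `exists_contraction`). Taking a CW complex homotopy equivalent
to `C(n)` and lifting the homotopy (`exists_homotopy_lift`) gives `isHomotopyEquiv_fst`; exchange of
the factors gives the other projection.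

The topology requires care because products are taken among compactly generated spaces. The cover is
topologized by transport along short paths in the compactly generated product. This product is
locally path-connected when the factors are (`locallyPathConnectedSpace_kmk_prod`), so continuity of
every structure map reduces to continuity of its projections and compatibility with transport
(`continuous_of_isTransport`). -/

noncomputable section

namespace KPiOneOperads

open Set Topology Filter
open scoped unitInterval

local notation "𝐤" X:max => CompactCoherentification X

local notation "PHQ" => Path.Homotopic.Quotient

/-! ## Compactly generated spaces -/

section Kification

variable {X Y Z : Type*} [TopologicalSpace X] [TopologicalSpace Y] [TopologicalSpace Z]

theorem continuous_of_continuousOn_isCompact [CompactlyCoherentSpace X] {f : X → Y}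
    (h : ∀ K, IsCompact K → ContinuousOn f K) : Continuous f :=
  (CompactlyCoherentSpace.isCoherentWith.continuous_iff).2 h

/-- By currying, `f` becomes a map from `X` to `C(Y, Z)`, whose continuity may be tested on compact
subsets of `X`; local compactness of `Y` allows uncurrying. Consequently products with `I` or with a
ball need no retopologizing. -/
theorem continuous_prod_of_continuousOn_isCompact [CompactlyCoherentSpace X] [LocallyCompactSpace Y]
    {f : X × Y → Z} (h : ∀ K : Set X, IsCompact K → ContinuousOn f (K ×ˢ univ)) :
    Continuous f := by
  have h1 : ∀ x, Continuous fun y => f (x, y) := fun x =>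
    (h {x} isCompact_singleton).comp_continuous (by fun_prop) (by simp)
  let F : X → C(Y, Z) := fun x => ⟨fun y => f (x, y), h1 x⟩
  have hF : Continuous F := by
    refine continuous_of_continuousOn_isCompact fun K hK => ?_
    rw [continuousOn_iff_continuous_domRestrict]
    have : Continuous fun q : K × Y => f (q.1, q.2) :=
      (h K hK).comp_continuous (by fun_prop) (by simp)
    exact (ContinuousMap.curry ⟨_, this⟩).continuous
  exact ContinuousMap.continuous_uncurry_of_continuous ⟨F, hF⟩

theorem compactlyCoherentSpace_of_continuous_mk (h : Continuous (CompactCoherentification.mk X)) :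
    CompactlyCoherentSpace X := by
  refine .of_isOpen fun A hA => ?_
  have : IsOpen (CompactCoherentification.mk X '' A) := by
    rw [CompactCoherentification.isOpen_iff, Equiv.preimage_image]
    exact hA
  simpa [Set.preimage_image_eq _ (CompactCoherentification.mk X).injective]
    using this.preimage h

instance compactlyCoherentSpace_prod [CompactlyCoherentSpace X] [CompactSpace Y]
    [LocallyCompactSpace Y] : CompactlyCoherentSpace (X × Y) :=
  compactlyCoherentSpace_of_continuous_mk <| continuous_prod_of_continuousOn_isCompact
    fun _ hK => CompactCoherentification.continuousOn_isCompact_mk (hK.prod isCompact_univ)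

theorem continuous_mk_comp [CompactlyCoherentSpace X] {f : X → Y} (hf : Continuous f) :
    Continuous (fun x => CompactCoherentification.mk Y (f x)) :=
  (CompactCoherentification.continuous_map_of_continuous hf).comp CompactCoherentification.continuous_mk

/-- A homeomorphism induces a homeomorphism of compactly generated refinements. -/
def kHomeomorph (e : X ≃ₜ Y) : 𝐤 X ≃ₜ 𝐤 Y where
  toFun := CompactCoherentification.map e
  invFun := CompactCoherentification.map e.symm
  left_inv x := e.symm_apply_apply x
  right_inv x := e.apply_symm_apply x
  continuous_toFun := CompactCoherentification.continuous_map_of_continuous e.continuous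
  continuous_invFun := CompactCoherentification.continuous_map_of_continuous e.symm.continuous

theorem joinedIn_kmk {f : unitInterval → X} (hf : Continuous f) {W : Set (𝐤 X)}
    (hW : ∀ t, CompactCoherentification.mk X (f t) ∈ W) :
    JoinedIn W (CompactCoherentification.mk X (f 0)) (CompactCoherentification.mk X (f 1)) :=
  ⟨⟨⟨fun t => CompactCoherentification.mk X (f t), continuous_mk_comp hf⟩, rfl, rfl⟩, hW⟩

/-- The tube lemma for the compactly generated topology: on a compact `K` the complement is the
projection, along the compact `L`, of a closed subset of `L × K`. -/
theorem isOpen_kmk_forall_mem {L : Set Y} (hL : IsCompact L) {W : Set (𝐤 (X × Y))}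
    (hW : IsOpen W) :
    IsOpen {x : 𝐤 X | ∀ y ∈ L,
      CompactCoherentification.mk (X × Y) ((CompactCoherentification.mk X).symm x, y) ∈ W} := by
  rw [CompactCoherentification.isOpen_iff]
  intro K hK
  have := isCompact_iff_compactSpace.1 hL
  have := isCompact_iff_compactSpace.1 hK
  have hc : Continuous fun q : L × K =>
      CompactCoherentification.mk (X × Y) ((q.2 : X), (q.1 : Y)) :=
    CompactCoherentification.continuous_rng_of_compactSpace.2 (by
      change Continuous fun q : L × K => ((q.2 : X), (q.1 : Y))
      fun_prop)
  have h1 := isClosedMap_snd_of_compactSpace (X := L) (Y := K) _ (hW.preimage hc).isClosed_compl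
  rw [← isClosed_compl_iff]
  convert h1 using 1
  ext x
  simp

/-- It suffices that path components of an open `W` are open, which is tested on a compact `M`. A
point `(x₁, y₁)` of `M` near `(x, y)` is reached by moving first inside `{x} × Y` and then inside `X
× {y₁}`. Each factor being locally path-connected, the only issue is to keep the second leg in `W`,
and this is what the tube lemma provides. -/
instance locallyPathConnectedSpace_kmk_prod [T2Space Y]
    [LocallyPathConnectedSpace (𝐤 X)] [LocallyPathConnectedSpace (𝐤 Y)] :
    LocallyPathConnectedSpace (𝐤 (X × Y)) := by
  rw [locallyPathConnectedSpace_iff_isOpen_pathComponentIn]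
  intro z W hW
  rw [CompactCoherentification.isOpen_iff]
  intro M hM
  rw [isOpen_iff_mem_nhds]
  rintro ⟨⟨x, y⟩, hxy⟩ hP
  have hP' : JoinedIn W z (CompactCoherentification.mk (X × Y) (x, y)) := hP
  have hxyW := hP'.mem.2
  let L := Prod.snd '' M
  have hL : IsCompact L := hM.image continuous_snd
  have := isCompact_iff_compactSpace.1 hL
  have hcL : Continuous fun y' : L => CompactCoherentification.mk (X × Y) (x, (y' : Y)) :=
    CompactCoherentification.continuous_rng_of_compactSpace.2 (by
      change Continuous fun y' : L => (x, (y' : Y))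
      fun_prop)
  let y0 : L := ⟨y, ⟨(x, y), hxy, rfl⟩⟩
  -- `Y` itself need not be locally compact, but the projection `L` of `M` is compact Hausdorff, so
  -- `y` has a compact neighbourhood `L'` in `L` with `{x} × L'` inside `W`.
  obtain ⟨L', hL'n, hL'W, hL'c⟩ := local_compact_nhds ((hW.preimage hcL).mem_nhds (x := y0) hxyW)
  have hU := isOpen_kmk_forall_mem (hL'c.image continuous_subtype_val) hW
  have hcY : Continuous fun y' : 𝐤 Y =>
      CompactCoherentification.mk (X × Y) (x, (CompactCoherentification.mk Y).symm y') :=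
    CompactCoherentification.continuous_map_of_continuous (f := fun y' : Y => (x, y')) (by fun_prop)
  have hV := hW.preimage hcY
  have hyV : CompactCoherentification.mk Y y ∈ (fun y' : 𝐤 Y =>
      CompactCoherentification.mk (X × Y) (x, (CompactCoherentification.mk Y).symm y')) ⁻¹' W := hxyW
  have hU0 := hU.pathComponentIn (CompactCoherentification.mk X x)
  have hV0 := hV.pathComponentIn (CompactCoherentification.mk Y y)
  have hxU : CompactCoherentification.mk X x ∈ {x' : 𝐤 X | ∀ y' ∈ Subtype.val '' L',
      CompactCoherentification.mk (X × Y) ((CompactCoherentification.mk X).symm x', y') ∈ W} := by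
    rintro _ ⟨y', hy', rfl⟩
    exact hL'W hy'
  have := isCompact_iff_compactSpace.1 hM
  have hp1 : Continuous fun p : M => CompactCoherentification.mk X p.1.1 :=
    CompactCoherentification.continuous_rng_of_compactSpace.2 (by
      change Continuous fun p : M => p.1.1
      fun_prop)
  have hp2 : Continuous fun p : M => CompactCoherentification.mk Y p.1.2 :=
    CompactCoherentification.continuous_rng_of_compactSpace.2 (by
      change Continuous fun p : M => p.1.2
      fun_prop)
  have hp3 : Continuous fun p : M => (⟨p.1.2, ⟨p.1, p.2, rfl⟩⟩ : L) := by fun_prop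
  have n1 := (hU0.preimage hp1).mem_nhds (x := ⟨(x, y), hxy⟩) (mem_pathComponentIn_self hxU)
  have n2 := (hV0.preimage hp2).mem_nhds (x := ⟨(x, y), hxy⟩)
    (mem_pathComponentIn_self hyV)
  have n3 := hp3.continuousAt.preimage_mem_nhds (x := (⟨(x, y), hxy⟩ : M)) hL'n
  filter_upwards [n1, n2, n3]
  rintro ⟨⟨x1, y1⟩, h1⟩ ⟨g, hg⟩ ⟨g', hg'⟩ h3
  refine hP'.trans ?_
  have j1 := joinedIn_kmk (X := X × Y) (W := W)
    (f := fun t => (x, (CompactCoherentification.mk Y).symm (g' t)))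
    (by
      have := CompactCoherentification.continuous_mk_symm.comp g'.continuous
      exact continuous_const.prodMk this) hg'
  have j2 := joinedIn_kmk (X := X × Y) (W := W)
    (f := fun t => ((CompactCoherentification.mk X).symm (g t), y1))
    (by
      have := CompactCoherentification.continuous_mk_symm.comp g.continuous
      exact this.prodMk continuous_const) (fun t => hg t _ ⟨_, h3, rfl⟩)
  simp only [Path.source, Path.target, Equiv.symm_apply_apply] at j1 j2
  exact j1.trans j2

theorem locallyPathConnectedSpace_kmk_of_homeomorph (e : X ≃ₜ Y)
    [LocallyPathConnectedSpace (𝐤 X)] : LocallyPathConnectedSpace (𝐤 Y) :=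
  (kHomeomorph e).symm.isOpenEmbedding.locallyPathConnectedSpace

instance locallyPathConnectedSpace_kmk [CompactlyCoherentSpace X] [LocallyPathConnectedSpace X] :
    LocallyPathConnectedSpace (𝐤 X) :=
  (CompactCoherentification.homeo (X := X)).symm.isOpenEmbedding.locallyPathConnectedSpace

instance locallyPathConnectedSpace_kmk_pi {n : ℕ} (F : Fin n → Type*)
    [∀ i, TopologicalSpace (F i)] [∀ i, T2Space (F i)]
    [∀ i, LocallyPathConnectedSpace (𝐤 (F i))] : LocallyPathConnectedSpace (𝐤 (∀ i, F i)) := by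
  induction n with
  | zero =>
    have : CompactlyCoherentSpace (∀ i, F i) := inferInstance
    infer_instance
  | succ n ih =>
    have := ih (fun i => F i.succ)
    let h : F 0 × (∀ i : Fin n, F i.succ) ≃ₜ ∀ i, F i :=
      { toEquiv := Fin.consEquiv F
        continuous_toFun := by
          refine continuous_pi fun i => ?_
          refine Fin.cases ?_ (fun i => ?_) i
          · exact continuous_fst
          · exact (continuous_apply i).comp continuous_snd
        continuous_invFun := by
          change Continuous fun f : ∀ i, F i => (f 0, fun i : Fin n => f i.succ)
          fun_prop }
    exact locallyPathConnectedSpace_kmk_of_homeomorph h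

end Kification

/-! ## Local homeomorphisms -/

section LocalHomeomorph

variable {E B T : Type*} [TopologicalSpace E] [TopologicalSpace B] [TopologicalSpace T]

theorem _root_.IsLocalHomeomorph.locallyPathConnectedSpace {f : E → B} (hf : IsLocalHomeomorph f)
    [LocallyPathConnectedSpace B] : LocallyPathConnectedSpace E := by
  refine ⟨fun x => hasBasis_self.2 fun t ht => ?_⟩
  obtain ⟨φ, hx, rfl⟩ := hf x
  have h1 : φ '' (φ.source ∩ interior t) ∈ 𝓝 (φ x) :=
    (φ.isOpen_image_source_inter isOpen_interior).mem_nhds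
      ⟨x, ⟨hx, mem_interior_iff_mem_nhds.2 ht⟩, rfl⟩
  obtain ⟨s, ⟨hs, hsc⟩, hst⟩ := (path_connected_basis (φ x)).mem_iff.1 h1
  have hst' : s ⊆ φ.target := hst.trans (by rintro _ ⟨y, hy, rfl⟩; exact φ.map_source hy.1)
  have h2 := φ.continuousAt_symm (φ.map_source hx)
  refine ⟨φ.symm '' s, ?_, hsc.image' (φ.continuousOn_symm.mono hst'), ?_⟩
  · have h3 : φ.source ∩ φ ⁻¹' s ∈ 𝓝 x :=
      inter_mem (φ.open_source.mem_nhds hx) ((φ.continuousAt hx).preimage_mem_nhds hs)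
    refine mem_of_superset h3 fun y hy => ⟨φ y, hy.2, φ.left_inv hy.1⟩
  · rintro _ ⟨y, hy, rfl⟩
    obtain ⟨z, hz, rfl⟩ := hst hy
    rw [φ.left_inv hz.1]
    exact interior_subset hz.2

/-- Openness of `A` is checked in a chart, where it becomes openness in `B` and can be tested on a
compact `K`. Near a point of the chart, `K` contains a compact neighbourhood `L` lying in the
target, and the inverse chart carries `L` to a compact subset of `E`, on which `A` is known to be
open. -/
theorem _root_.IsLocalHomeomorph.compactlyCoherentSpace {f : E → B} (hf : IsLocalHomeomorph f)
    [CompactlyCoherentSpace B] [T2Space B] : CompactlyCoherentSpace E := by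
  refine .of_isOpen fun A hA => ?_
  rw [isOpen_iff_mem_nhds]
  intro a ha
  obtain ⟨φ, haφ, rfl⟩ := hf a
  have key : IsOpen (φ '' (A ∩ φ.source)) := by
    rw [CompactlyCoherentSpace.isOpen_iff]
    intro K hK
    rw [isOpen_iff_mem_nhds]
    rintro ⟨b, hb⟩ hbA
    have := isCompact_iff_compactSpace.1 hK
    have hbt : b ∈ φ.target := by
      obtain ⟨a', ha', rfl⟩ := hbA
      exact φ.map_source ha'.2
    obtain ⟨L, hLn, hLt, hLc⟩ := local_compact_nhds
      ((φ.open_target.preimage continuous_subtype_val).mem_nhds (x := (⟨b, hb⟩ : K)) hbt)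
    have hc : ContinuousOn (fun y : K => φ.symm y) L :=
      φ.continuousOn_symm.comp continuous_subtype_val.continuousOn hLt
    have hLE := hA _ (hLc.image_of_continuousOn hc)
    have hbA' : φ.symm b ∈ A := by
      obtain ⟨a', ha', rfl⟩ := hbA
      rw [φ.left_inv ha'.2]
      exact ha'.1
    obtain ⟨O, hO, hOA⟩ := isOpen_induced_iff.1 hLE
    have hbL : (⟨b, hb⟩ : K) ∈ L := mem_of_mem_nhds hLn
    have hbO : φ.symm b ∈ O := by
      have : (⟨φ.symm b, ⟨_, hbL, rfl⟩⟩ : (fun y : K => φ.symm y) '' L) ∈ Subtype.val ⁻¹' O := by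
        rw [hOA]; exact hbA'
      exact this
    have h2 := hc ⟨b, hb⟩ hbL
    have h3 : ∀ᶠ y in 𝓝 (⟨b, hb⟩ : K), y ∈ L → φ.symm y ∈ O :=
      eventually_nhdsWithin_iff.1 (h2.eventually_mem (hO.mem_nhds hbO))
    filter_upwards [h3, hLn] with y hy hyL
    refine ⟨φ.symm y, ⟨?_, φ.map_target (hLt hyL)⟩, φ.right_inv (hLt hyL)⟩
    have : (⟨φ.symm y, ⟨_, hyL, rfl⟩⟩ : (fun y : K => φ.symm y) '' L) ∈ Subtype.val ⁻¹' O := hy hyL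
    rw [hOA] at this
    exact this
  have h4 := (φ.isOpen_inter_preimage key)
  refine mem_of_superset (h4.mem_nhds ⟨haφ, ⟨a, ⟨ha, haφ⟩, rfl⟩⟩) ?_
  rintro x ⟨hx, ⟨y, ⟨hy, hy'⟩, hxy⟩⟩
  rwa [← φ.injOn hy' hx hxy]

/-- The pullback of a local homeomorphism is a local homeomorphism. -/
theorem _root_.IsLocalHomeomorph.pullback {f : E → B} (hf : IsLocalHomeomorph f) {g : T → B}
    (hg : Continuous g) :
    IsLocalHomeomorph (fun q : {q : T × E // g q.1 = f q.2} => q.1.1) := by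
  rw [isLocalHomeomorph_iff_isOpenEmbedding_restrict]
  rintro ⟨⟨t, d⟩, htd⟩
  obtain ⟨φ, hd, rfl⟩ := hf d
  have ho : IsOpen {q : {q : T × E // g q.1 = φ q.2} | q.1.2 ∈ φ.source} :=
    φ.open_source.preimage (by fun_prop)
  refine ⟨_, ho.mem_nhds hd, .of_continuous_injective_isOpenMap ?_ ?_ ?_⟩
  · exact (continuous_fst.comp continuous_subtype_val).comp continuous_subtype_val
  · rintro ⟨⟨⟨t1, d1⟩, h1⟩, h1'⟩ ⟨⟨⟨t2, d2⟩, h2⟩, h2'⟩ (h : t1 = t2)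
    subst h
    obtain rfl : d1 = d2 := φ.injOn h1' h2' (h1.symm.trans h2)
    rfl
  · intro O hO
    rw [isOpen_iff_mem_nhds]
    rintro _ ⟨⟨⟨⟨t1, d1⟩, h1⟩, h1'⟩, hO1, rfl⟩
    obtain ⟨O', hO', rfl⟩ := isOpen_induced_iff.1 hO
    obtain ⟨O'', hO'', rfl⟩ := isOpen_induced_iff.1 hO'
    obtain ⟨T1, U1, hT1, hU1, ht1, hd1, hTU⟩ := isOpen_prod_iff.1 hO'' t1 d1 hO1
    have h2 : IsOpen (φ '' (φ.source ∩ U1)) := φ.isOpen_image_source_inter hU1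
    have h3 := (hT1.inter (h2.preimage hg)).mem_nhds (x := t1)
      ⟨ht1, ⟨d1, ⟨h1', hd1⟩, h1.symm⟩⟩
    filter_upwards [h3]
    rintro t2 ⟨ht2, d2, ⟨hd2, hd2'⟩, h2⟩
    exact ⟨⟨⟨⟨t2, d2⟩, h2.symm⟩, hd2⟩, hTU ⟨ht2, hd2'⟩, rfl⟩

end LocalHomeomorph

/-! ## The covering space attached to a correspondence between fundamental groups -/

/-- The graph of an isomorphism between the fundamental groups of two pointed spaces. -/
structure LoopCorrespondence {X X' : Type u} [TopologicalSpace X] [TopologicalSpace X']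
    (e : X) (e' : X') where
  rel : PHQ e e → PHQ e' e' → Prop
  rel_refl : rel (.refl e) (.refl e')
  rel_trans : ∀ {a a' b b'}, rel a a' → rel b b' → rel (a.trans b) (a'.trans b')
  rel_symm : ∀ {a a'}, rel a a' → rel a.symm a'.symm
  exists_right : ∀ a, ∃ a', rel a a'
  exists_left : ∀ a', ∃ a, rel a a'
  unique_right : ∀ {a'}, rel (.refl e) a' → a' = .refl e'
  unique_left : ∀ {a}, rel a (.refl e') → a = .refl e

/-- Homotopy classes of paths starting at `e`. -/
abbrev BasedPath {X : Type u} [TopologicalSpace X] (e : X) : Type u := Σ x, PHQ e x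

theorem BasedPath.ext {X : Type u} [TopologicalSpace X] {e : X} {P Q : BasedPath e}
    (h : P.1 = Q.1) (h' : P.2.cast rfl h.symm = Q.2) : P = Q := by
  obtain ⟨x, p⟩ := P
  obtain ⟨y, q⟩ := Q
  obtain rfl : x = y := h
  rw [Path.Homotopic.Quotient.cast_rfl_rfl] at h'
  exact congrArg _ h'

namespace LoopCorrespondence

variable {X X' : Type u} [TopologicalSpace X] [TopologicalSpace X'] {e : X} {e' : X'}
  (R : LoopCorrespondence e e')

/-- The correspondence read in the other direction. -/
def swap : LoopCorrespondence e' e where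
  rel a b := R.rel b a
  rel_refl := R.rel_refl
  rel_trans := R.rel_trans
  rel_symm := R.rel_symm
  exists_right := R.exists_left
  exists_left := R.exists_right
  unique_right := R.unique_left
  unique_left := R.unique_right

/-- Two pairs of based paths are identified if they differ by corresponding loops. -/
def setoid : Setoid (BasedPath e × BasedPath e') where
  r P Q := ∃ a a', R.rel a a' ∧ Q.1 = ⟨P.1.1, a.trans P.1.2⟩ ∧ Q.2 = ⟨P.2.1, a'.trans P.2.2⟩
  iseqv :=
    { refl := fun P => ⟨_, _, R.rel_refl, by simp, by simp⟩
      symm := by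
        rintro ⟨P, P'⟩ ⟨Q, Q'⟩ ⟨a, a', h, h1, h2⟩
        dsimp only at h1 h2
        subst h1 h2
        refine ⟨_, _, R.rel_symm h, ?_, ?_⟩ <;>
          simp [← Path.Homotopic.Quotient.trans_assoc]
      trans := by
        rintro ⟨P, P'⟩ ⟨Q, Q'⟩ ⟨S, S'⟩ ⟨a, a', h, h1, h2⟩ ⟨b, b', k, k1, k2⟩
        dsimp only at h1 h2 k1 k2
        subst h1 h2
        exact ⟨_, _, R.rel_trans k h, by rw [k1, Path.Homotopic.Quotient.trans_assoc],
          by rw [k2, Path.Homotopic.Quotient.trans_assoc]⟩ }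

/-- The quotient of the product of the universal covers by the corresponding loops. -/
def Cover : Type u := Quotient R.setoid

namespace Cover

variable {R}

/-- The point of the cover given by two classes of paths. -/
def mk {x : X} {x' : X'} (p : PHQ e x) (p' : PHQ e' x') : R.Cover :=
  Quotient.mk R.setoid (⟨x, p⟩, ⟨x', p'⟩)

theorem exists_mk (d : R.Cover) : ∃ (x : X) (x' : X') (p : PHQ e x) (p' : PHQ e' x'),
    d = mk p p' := by
  induction d using Quotient.ind with
  | _ P => exact ⟨_, _, P.1.2, P.2.2, rfl⟩

/-- The projection to the first space. -/
def fst (d : R.Cover) : X :=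
  Quotient.lift (fun P => P.1.1) (by
    rintro P Q ⟨a, a', h, h1, h2⟩
    rw [h1]) d

/-- The projection to the second space. -/
def snd (d : R.Cover) : X' :=
  Quotient.lift (fun P => P.2.1) (by
    rintro P Q ⟨a, a', h, h1, h2⟩
    rw [h2]) d

variable {x y : X} {x' y' : X'}

@[simp] theorem fst_mk (p : PHQ e x) (p' : PHQ e' x') : fst (mk (R := R) p p') = x := rfl

@[simp] theorem snd_mk (p : PHQ e x) (p' : PHQ e' x') : snd (mk (R := R) p p') = x' := rfl

theorem mk_eq_mk_iff {p q : PHQ e x} {p' q' : PHQ e' x'} :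
    mk (R := R) p p' = mk q q' ↔ ∃ a a', R.rel a a' ∧ q = a.trans p ∧ q' = a'.trans p' := by
  refine Quotient.eq.trans ?_
  refine exists_congr fun a => exists_congr fun a' => and_congr_right fun _ => ?_
  constructor
  · rintro ⟨h, h'⟩
    exact ⟨eq_of_heq (Sigma.mk.inj h).2, eq_of_heq (Sigma.mk.inj h').2⟩
  · rintro ⟨rfl, rfl⟩
    exact ⟨rfl, rfl⟩

/-- Loops act on the left and transport on the right, and the two commute. Hence transport along a
fixed pair of classes is well defined and injective on the cover. -/
theorem mk_trans_eq_mk_trans_iff {p q : PHQ e x} {p' q' : PHQ e' x'} (g : PHQ x y)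
    (g' : PHQ x' y') : mk (R := R) (p.trans g) (p'.trans g') = mk (q.trans g) (q'.trans g') ↔
      mk (R := R) p p' = mk q q' := by
  rw [mk_eq_mk_iff, mk_eq_mk_iff]
  refine exists_congr fun a => exists_congr fun a' => and_congr_right fun _ => ?_
  have key : ∀ {Z : Type u} [TopologicalSpace Z] {z z1 z2 : Z} (a : PHQ z z) (p q : PHQ z z1)
      (g : PHQ z1 z2), q.trans g = a.trans (p.trans g) ↔ q = a.trans p := by
    intro Z _ z z1 z2 a p q g
    constructor
    · intro h
      have := congrArg (fun r => r.trans g.symm) h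
      simpa [Path.Homotopic.Quotient.trans_assoc] using this
    · rintro rfl
      simp [Path.Homotopic.Quotient.trans_assoc]
  rw [key, key]

/-- `mk p p'` with given first path determines the second one. -/
theorem mk_left_injective {p : PHQ e x} {p' q' : PHQ e' x'}
    (h : mk (R := R) p p' = mk p q') : p' = q' := by
  obtain ⟨a, a', hr, h1, h2⟩ := mk_eq_mk_iff.1 h
  have : a = .refl e := by
    have := congrArg (fun r => r.trans p.symm) h1
    simpa [Path.Homotopic.Quotient.trans_assoc] using this.symm
  subst this
  rw [R.unique_right hr] at h2
  simpa using h2.symm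

/-- The loop `p · q⁻¹` has a partner in the other group, and changing the representative by this
pair normalizes its first path to `p`. With `mk_left_injective` this identifies the fibre of `fst`
over `x` with the set of classes of paths in `X'` from `e'`, that is, with the universal cover of
`X'`. -/
theorem exists_mk_left (p : PHQ e x) (d : R.Cover) (hd : fst d = x) :
    ∃ (x' : X') (p' : PHQ e' x'), d = mk p p' := by
  obtain ⟨x, x', q, q', rfl⟩ := exists_mk d
  obtain rfl : x = _ := hd
  obtain ⟨a', h⟩ := R.exists_right (p.trans q.symm)
  exact ⟨x', a'.trans q', mk_eq_mk_iff.2 ⟨_, _, h, by simp [Path.Homotopic.Quotient.trans_assoc],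
    rfl⟩⟩

/-- `d₁` is obtained from `d` by transport along a pair of paths. -/
def IsTransport (d d₁ : R.Cover) (γ : I → X) (γ' : I → X') : Prop :=
  ∃ (x y : X) (x' y' : X') (p : PHQ e x) (p' : PHQ e' x') (g : Path x y) (g' : Path x' y'),
    d = mk p p' ∧ d₁ = mk (p.trans (.mk g)) (p'.trans (.mk g')) ∧ ⇑g = γ ∧ ⇑g' = γ'

theorem isTransport_mk (p : PHQ e x) (p' : PHQ e' x') (g : Path x y) (g' : Path x' y') :
    IsTransport (mk (R := R) p p') (mk (p.trans (.mk g)) (p'.trans (.mk g'))) g g' :=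
  ⟨_, _, _, _, p, p', g, g', rfl, rfl, rfl, rfl⟩

/-- `IsTransport` records the paths as mere functions, which still determine the end points; the
choice of representative does not matter by `mk_trans_eq_mk_trans_iff`. -/
theorem IsTransport.eq_mk {p : PHQ e x} {p' : PHQ e' x'} {d : R.Cover} {g : Path x y}
    {g' : Path x' y'} (h : IsTransport (mk p p') d g g') :
    d = mk (p.trans (.mk g)) (p'.trans (.mk g')) := by
  obtain ⟨a, b, a', b', q, q', k, k', h1, rfl, h2, h3⟩ := h
  obtain rfl : a = x := by rw [← k.source, h2, g.source]
  obtain rfl : b = y := by rw [← k.target, h2, g.target]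
  obtain rfl : a' = x' := by rw [← k'.source, h3, g'.source]
  obtain rfl : b' = y' := by rw [← k'.target, h3, g'.target]
  obtain rfl : k = g := DFunLike.coe_injective h2
  obtain rfl : k' = g' := DFunLike.coe_injective h3
  rw [mk_trans_eq_mk_trans_iff, h1]

variable (R) in
/-- The projection to the product (in the category of compactly generated spaces). -/
def proj (d : R.Cover) : 𝐤 (X × X') := CompactCoherentification.mk _ (fst d, snd d)

/-- A set is open if it contains, with a point, its transports along short paths. -/
instance : TopologicalSpace R.Cover where
  IsOpen O := ∀ ⦃x : X⦄ ⦃x' : X'⦄ (p : PHQ e x) (p' : PHQ e' x'), mk p p' ∈ O →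
    ∃ V : Set (𝐤 (X × X')), IsOpen V ∧ CompactCoherentification.mk _ (x, x') ∈ V ∧
      ∀ ⦃y : X⦄ ⦃y' : X'⦄ (g : Path x y) (g' : Path x' y'),
        (∀ t, CompactCoherentification.mk _ (g t, g' t) ∈ V) →
          mk (p.trans (.mk g)) (p'.trans (.mk g')) ∈ O
  isOpen_univ _ _ _ _ _ := ⟨univ, isOpen_univ, mem_univ _, fun _ _ _ _ _ => mem_univ _⟩
  isOpen_inter O₁ O₂ h₁ h₂ x x' p p' hp := by
    obtain ⟨V₁, hV₁, hx₁, H₁⟩ := h₁ p p' hp.1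
    obtain ⟨V₂, hV₂, hx₂, H₂⟩ := h₂ p p' hp.2
    exact ⟨V₁ ∩ V₂, hV₁.inter hV₂, ⟨hx₁, hx₂⟩, fun y y' g g' hg =>
      ⟨H₁ g g' fun t => (hg t).1, H₂ g g' fun t => (hg t).2⟩⟩
  isOpen_sUnion S hS x x' p p' := by
    rintro ⟨O, hO, hp⟩
    obtain ⟨V, hV, hx, H⟩ := hS O hO p p' hp
    exact ⟨V, hV, hx, fun y y' g g' hg => ⟨O, hO, H g g' hg⟩⟩

theorem isOpen_iff {O : Set R.Cover} : IsOpen O ↔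
    ∀ ⦃x : X⦄ ⦃x' : X'⦄ (p : PHQ e x) (p' : PHQ e' x'), mk p p' ∈ O →
    ∃ V : Set (𝐤 (X × X')), IsOpen V ∧ CompactCoherentification.mk _ (x, x') ∈ V ∧
      ∀ ⦃y : X⦄ ⦃y' : X'⦄ (g : Path x y) (g' : Path x' y'),
        (∀ t, CompactCoherentification.mk _ (g t, g' t) ∈ V) →
          mk (p.trans (.mk g)) (p'.trans (.mk g')) ∈ O := Iff.rfl

theorem continuous_proj : Continuous (proj R) := by
  refine ⟨fun V hV => ?_⟩
  refine isOpen_iff.2 fun x x' p p' h => ⟨V, hV, h, fun y y' g g' hg => ?_⟩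
  simpa [proj] using hg 1

theorem continuous_fst : Continuous (fst (R := R)) :=
  _root_.continuous_fst.comp (CompactCoherentification.continuous_mk_symm.comp continuous_proj)

theorem continuous_snd : Continuous (snd (R := R)) :=
  _root_.continuous_snd.comp (CompactCoherentification.continuous_mk_symm.comp continuous_proj)

/-- A map from a locally path-connected space that is compatible with transport is continuous. -/
theorem continuous_of_isTransport {W : Type*} [TopologicalSpace W] [LocallyPathConnectedSpace W]
    {f : W → R.Cover} (hf : Continuous fun w => proj R (f w))
    (h : ∀ ⦃w₀ w₁⦄ (ω : Path w₀ w₁),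
      IsTransport (f w₀) (f w₁) (fun t => fst (f (ω t))) (fun t => snd (f (ω t)))) :
    Continuous f := by
  refine ⟨fun O hO => ?_⟩
  rw [isOpen_iff_mem_nhds]
  intro w hw
  obtain ⟨x, x', p, p', hp⟩ := exists_mk (f w)
  obtain ⟨V, hV, hx, H⟩ := isOpen_iff.1 hO p p' (by rw [← hp]; exact hw)
  have hwV : f w ∈ proj R ⁻¹' V := by rw [hp]; exact hx
  obtain ⟨N, ⟨hN, hNc⟩, hNV⟩ := (path_connected_basis w).mem_iff.1
    ((hV.preimage hf).mem_nhds (x := w) hwV)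
  refine mem_of_superset hN fun w₁ hw₁ => ?_
  obtain ⟨ω, hω⟩ := hNc.joinedIn w (mem_of_mem_nhds hN) w₁ hw₁
  obtain ⟨a, b, a', b', q, q', g, g', h1, h2, h3, h4⟩ := h ω
  rw [hp] at h1
  obtain rfl : x = a := by simpa using congrArg fst h1
  obtain rfl : x' = a' := by simpa using congrArg snd h1
  rw [mem_preimage, h2, ← (mk_trans_eq_mk_trans_iff (Path.Homotopic.Quotient.mk g) (Path.Homotopic.Quotient.mk g')).2 h1]
  refine H g g' fun t => ?_
  rw [h3, h4]
  exact hNV (hω t)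

/-! ### Sheets of the cover, and the projection to the product as a separated local homeomorphism -/

section Local

variable [LocallyPathConnectedSpace (𝐤 (X × X'))]

/-- Local path-connectedness of the product enters here: points near `proj R d` are reached by short
paths, and transporting `d` along them stays in `O`. -/
theorem isOpenMap_proj : IsOpenMap (proj R) := by
  intro O hO
  rw [isOpen_iff_mem_nhds]
  rintro _ ⟨d, hd, rfl⟩
  obtain ⟨x, x', p, p', rfl⟩ := exists_mk d
  obtain ⟨V, hV, hx, H⟩ := isOpen_iff.1 hO p p' hd
  obtain ⟨N, ⟨hN, hNc⟩, hNV⟩ := (path_connected_basis _).mem_iff.1 (hV.mem_nhds hx)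
  refine mem_of_superset hN fun w₁ hw₁ => ?_
  obtain ⟨ω, hω⟩ := hNc.joinedIn _ (mem_of_mem_nhds hN) w₁ hw₁
  have hc := CompactCoherentification.continuous_mk_symm (X := X × X')
  exact ⟨_, H ((ω.map hc).map _root_.continuous_fst) ((ω.map hc).map _root_.continuous_snd) fun t => hNV (hω t),
    rfl⟩

variable (hX : SemilocallySimplyConnected X) (hX' : SemilocallySimplyConnected X')

include hX hX' in
omit [LocallyPathConnectedSpace (𝐤 (X × X'))] in
/-- Small neighbourhoods in which transport does not depend on the path. -/
theorem exists_nhds_unique_transport (x : X) (x' : X') : ∃ V : Set (𝐤 (X × X')), IsOpen V ∧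
    CompactCoherentification.mk _ (x, x') ∈ V ∧ ∀ ⦃y : X⦄ ⦃y' : X'⦄ (g h : Path x y)
      (g' h' : Path x' y'), (∀ t, CompactCoherentification.mk _ (g t, g' t) ∈ V) →
        (∀ t, CompactCoherentification.mk _ (h t, h' t) ∈ V) →
        Path.Homotopic.Quotient.mk g = .mk h ∧ Path.Homotopic.Quotient.mk g' = .mk h' := by
  obtain ⟨U, hU, hxU, HU⟩ := hX x
  obtain ⟨U', hU', hxU', HU'⟩ := hX' x'
  have key : ∀ {Z : Type u} [TopologicalSpace Z] {z z1 : Z} {U : Set Z}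
      (_ : ∀ p : Path z z, (∀ t, p t ∈ U) → p.Homotopic (Path.refl z)) (g h : Path z z1),
      (∀ t, g t ∈ U) → (∀ t, h t ∈ U) → Path.Homotopic.Quotient.mk g = .mk h := by
    intro Z _ z z1 U H g h hg hh
    -- The loop `g · h⁻¹` at the centre stays in `U`, so it is null-homotopic in the whole space and
    -- `g`, `h` have the same class.
    have h1 : ∀ t, (g.trans h.symm) t ∈ U := by
      intro t
      rw [Path.trans_apply]
      split_ifs
      · exact hg _
      · exact hh _
    have h2 := Path.Homotopic.Quotient.eq.2 (H _ h1)
    rw [Path.Homotopic.Quotient.mk_trans, Path.Homotopic.Quotient.mk_symm] at h2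
    have h3 := congrArg (fun r => r.trans (Path.Homotopic.Quotient.mk h)) h2
    simpa [Path.Homotopic.Quotient.trans_assoc] using h3
  refine ⟨(CompactCoherentification.mk _).symm ⁻¹' (U ×ˢ U'),
    (hU.prod hU').preimage CompactCoherentification.continuous_mk_symm, ⟨hxU, hxU'⟩, ?_⟩
  intro y y' g h g' h' hg hh
  exact ⟨key HU g h (fun t => (hg t).1) fun t => (hh t).1,
    key HU' g' h' (fun t => (hg t).2) fun t => (hh t).2⟩

/-- The transports of `mk p p'` along paths in `V`. -/
def sheet (V : Set (𝐤 (X × X'))) (p : PHQ e x) (p' : PHQ e' x') : Set R.Cover :=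
  {d | ∃ (y : X) (y' : X') (g : Path x y) (g' : Path x' y'),
    (∀ t, CompactCoherentification.mk _ (g t, g' t) ∈ V) ∧
      d = mk (p.trans (.mk g)) (p'.trans (.mk g'))}

omit [LocallyPathConnectedSpace (𝐤 (X × X'))] in
theorem isOpen_sheet {V : Set (𝐤 (X × X'))} (hV : IsOpen V) (p : PHQ e x) (p' : PHQ e' x') :
    IsOpen (sheet (R := R) V p p') := by
  refine isOpen_iff.2 ?_
  rintro y y' q q' ⟨z, z', g, g', hg, h⟩
  obtain rfl : y = z := by simpa using congrArg fst h
  obtain rfl : y' = z' := by simpa using congrArg snd h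
  refine ⟨V, hV, by simpa using hg 1, fun z z' k k' hk => ?_⟩
  refine ⟨z, z', g.trans k, g'.trans k', fun t => ?_, ?_⟩
  · rw [Path.trans_apply, Path.trans_apply]
    split_ifs
    · exact hg _
    · exact hk _
  · rw [Path.Homotopic.Quotient.mk_trans, Path.Homotopic.Quotient.mk_trans,
      ← Path.Homotopic.Quotient.trans_assoc, ← Path.Homotopic.Quotient.trans_assoc]
    exact (mk_trans_eq_mk_trans_iff _ _).2 h

omit [LocallyPathConnectedSpace (𝐤 (X × X'))] in
theorem mem_sheet {V : Set (𝐤 (X × X'))} (h : CompactCoherentification.mk _ (x, x') ∈ V)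
    (p : PHQ e x) (p' : PHQ e' x') : mk p p' ∈ sheet (R := R) V p p' :=
  ⟨x, x', .refl x, .refl x', fun _ => h, by simp⟩

-- On the sheet through a point the projection is open; it is injective because paths in `V` from
-- the centre with equal end points give equal transports.
include hX hX' in
theorem isLocalHomeomorph_proj : IsLocalHomeomorph (proj R) := by
  rw [isLocalHomeomorph_iff_isOpenEmbedding_restrict]
  intro d
  obtain ⟨x, x', p, p', rfl⟩ := exists_mk d
  obtain ⟨V, hV, hx, H⟩ := exists_nhds_unique_transport hX hX' x x'
  refine ⟨sheet V p p', (isOpen_sheet hV p p').mem_nhds (mem_sheet hx p p'),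
    .of_continuous_injective_isOpenMap (continuous_proj.comp continuous_subtype_val) ?_
      (isOpenMap_proj.comp (isOpen_sheet hV p p').isOpenMap_subtype_val)⟩
  rintro ⟨_, y, y', g, g', hg, rfl⟩ ⟨_, z, z', k, k', hk, rfl⟩ h
  have h' : (y, y') = (z, z') := (CompactCoherentification.mk _).injective h
  obtain ⟨rfl, rfl⟩ := Prod.mk.inj h'
  obtain ⟨h1, h2⟩ := H g k g' k' hg hk
  exact Subtype.ext (by dsimp only; rw [h1, h2])

-- Points with different projections are separated in the base. For two points of one fibre, take
-- the sheets over a common `V`: at a common point of the two sheets both would be transported along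
-- the same classes, and transport is injective.
include hX hX' in
omit [LocallyPathConnectedSpace (𝐤 (X × X'))] in
theorem t2Space_cover [T2Space X] [T2Space X'] : T2Space R.Cover := by
  refine ⟨fun d d' hdd => ?_⟩
  by_cases hp : proj R d = proj R d'
  · obtain ⟨x, x', p, p', rfl⟩ := exists_mk d
    obtain ⟨y, y', q, q', rfl⟩ := exists_mk d'
    have hp' : (x, x') = (y, y') := (CompactCoherentification.mk _).injective hp
    obtain ⟨rfl, rfl⟩ := Prod.mk.inj hp'
    obtain ⟨V, hV, hx, H⟩ := exists_nhds_unique_transport hX hX' x x'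
    refine ⟨_, _, isOpen_sheet hV p p', isOpen_sheet hV q q', mem_sheet hx p p',
      mem_sheet hx q q', disjoint_left.2 ?_⟩
    rintro _ ⟨y, y', g, g', hg, rfl⟩ ⟨z, z', k, k', hk, h⟩
    obtain rfl : y = z := by simpa using congrArg fst h
    obtain rfl : y' = z' := by simpa using congrArg snd h
    obtain ⟨h1, h2⟩ := H g k g' k' hg hk
    rw [h1, h2] at h
    exact hdd ((mk_trans_eq_mk_trans_iff _ _).1 h)
  · obtain ⟨U, U', hU, hU', h, h', hd⟩ := t2_separation hp
    exact ⟨_, _, hU.preimage continuous_proj, hU'.preimage continuous_proj, h, h',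
      hd.preimage _⟩

end Local

end Cover

end LoopCorrespondence

/-! ## Lifting paths and homotopies to the cover -/

instance : ContractibleSpace I := (convex_Icc (0 : ℝ) 1).contractibleSpace ⟨0, by simp⟩

instance : LocallyPathConnectedSpace I := (convex_Icc (0 : ℝ) 1).locallyPathConnectedSpace

theorem quotient_map_trans {X Y : Type*} [TopologicalSpace X] [TopologicalSpace Y] {x y z : X}
    (p : PHQ x y) (q : PHQ y z) (f : C(X, Y)) : (p.trans q).map f = (p.map f).trans (q.map f) := by
  induction p with | mk p =>
  induction q with | mk q =>
  exact congrArg Path.Homotopic.Quotient.mk (p.map_trans q f.continuous)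

theorem quotient_map_refl {X Y : Type*} [TopologicalSpace X] [TopologicalSpace Y] (x : X)
    (f : C(X, Y)) : (Path.Homotopic.Quotient.refl x).map f = .refl (f x) := rfl

namespace LoopCorrespondence.Cover

variable {X X' : Type u} [TopologicalSpace X] [TopologicalSpace X'] {e : X} {e' : X'}
  {R : LoopCorrespondence e e'}

theorem exists_mk_of_eq (d : R.Cover) {x : X} {x' : X'} (h : fst d = x) (h' : snd d = x') :
    ∃ (p : PHQ e x) (p' : PHQ e' x'), d = mk p p' := by
  obtain ⟨y, y', p, p', rfl⟩ := exists_mk d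
  obtain rfl : y = x := h
  obtain rfl : y' = x' := h'
  exact ⟨p, p', rfl⟩

variable [T2Space X] [T2Space X'] [LocallyPathConnectedSpace (𝐤 (X × X'))]
  (hX : SemilocallySimplyConnected X) (hX' : SemilocallySimplyConnected X')

include hX hX'

/-- A path in the cover is determined by transport along its projections. -/
theorem isTransport_path (δ : C(I, R.Cover)) :
    IsTransport (δ 0) (δ 1) (fun t => fst (δ t)) (fun t => snd (δ t)) := by
  have := t2Space_cover (R := R) hX hX'
  let γ : C(I, X) := ⟨fun t => fst (δ t), continuous_fst.comp δ.continuous⟩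
  let γ' : C(I, X') := ⟨fun t => snd (δ t), continuous_snd.comp δ.continuous⟩
  obtain ⟨p, p', hp⟩ := exists_mk_of_eq (δ 0) (x := γ 0) (x' := γ' 0) rfl rfl
  -- `I` is simply connected, so the chosen path from `0` to `t` is irrelevant up to homotopy. The
  -- candidate `δ'` transports `δ 0` along the projections of `δ`, and it remains to identify it
  -- with `δ`.
  let q : ∀ t : I, PHQ (0 : I) t := fun t => .mk (PathConnectedSpace.somePath 0 t)
  let δ' : I → R.Cover := fun t => mk (p.trans ((q t).map γ)) (p'.trans ((q t).map γ'))
  have hδ' : Continuous δ' := by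
    refine continuous_of_isTransport ?_ ?_
    · change Continuous fun t => CompactCoherentification.mk _ (γ t, γ' t)
      exact continuous_mk_comp (by fun_prop)
    · intro t₀ t₁ ω
      have h1 : q t₁ = (q t₀).trans (.mk ω) := Subsingleton.elim _ _
      have h2 := isTransport_mk (R := R) (p.trans ((q t₀).map γ)) (p'.trans ((q t₀).map γ'))
        (ω.map γ.continuous) (ω.map γ'.continuous)
      have h3 : δ' t₁ = mk ((p.trans ((q t₀).map γ)).trans (.mk (ω.map γ.continuous)))
          ((p'.trans ((q t₀).map γ')).trans (.mk (ω.map γ'.continuous))) := by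
        simp only [δ', h1, quotient_map_trans, Path.Homotopic.Quotient.trans_assoc]
        rfl
      rw [h3]
      exact h2
  have hq0 : q 0 = .refl 0 := Subsingleton.elim _ _
  have h0 : δ 0 = δ' 0 := by
    simp only [δ', hq0, quotient_map_refl, Path.Homotopic.Quotient.trans_refl, hp]
  -- Uniqueness of lifts: `δ` and `δ'` have the same projection and agree at `0`, `I` is connected,
  -- and `proj` is separated and locally injective.
  have hs : IsSeparatedMap (proj R) := T2Space.isSeparatedMap _
  have heq : ⇑δ = δ' := hs.eq_of_comp_eq (isLocalHomeomorph_proj hX hX').isLocallyInjective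
    δ.continuous hδ' rfl 0 h0
  have h1 : q 1 = .mk (⟨⟨id, continuous_id⟩, rfl, rfl⟩ : Path (0 : I) 1) := Subsingleton.elim _ _
  have h2 : δ 1 = mk (p.trans (.mk (⟨γ, rfl, rfl⟩ : Path (γ 0) (γ 1))))
      (p'.trans (.mk (⟨γ', rfl, rfl⟩ : Path (γ' 0) (γ' 1)))) := by
    rw [heq]
    simp only [δ', h1]
    rfl
  rw [h2, hp]
  exact isTransport_mk p p' ⟨γ, rfl, rfl⟩ ⟨γ', rfl, rfl⟩

/-- The homotopy lifting property for locally path-connected spaces. -/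
theorem exists_homotopy_lift {W : Type*} [TopologicalSpace W] [LocallyPathConnectedSpace W]
    (f : C(W, R.Cover)) (h : C(I × W, X)) (h' : C(I × W, X'))
    (hc : Continuous fun q => CompactCoherentification.mk (X × X') (h q, h' q))
    (h0 : ∀ w, fst (f w) = h (0, w)) (h0' : ∀ w, snd (f w) = h' (0, w)) :
    ∃ H : C(I × W, R.Cover), (∀ q, fst (H q) = h q) ∧ (∀ q, snd (H q) = h' q) ∧
      ∀ w, H (0, w) = f w := by
  choose p p' hp using fun w => exists_mk_of_eq (f w) (h0 w) (h0' w)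
  let ι : W → C(I, I × W) := fun w => ⟨fun t => (t, w), by fun_prop⟩
  let q : ∀ a : I × W, PHQ ((0 : I), a.2) a := fun a =>
    (Path.Homotopic.Quotient.mk (PathConnectedSpace.somePath 0 a.1)).map (ι a.2)
  -- The lift at `(t, w)` is the transport of `f w` along the images of the vertical path from `(0,
  -- w)` to `(t, w)`.
  let H : I × W → R.Cover := fun a =>
    mk ((p a.2).trans ((q a).map h)) ((p' a.2).trans ((q a).map h'))
  have hH : Continuous H := by
    refine continuous_of_isTransport hc ?_
    rintro ⟨t₀, w₀⟩ ⟨t₁, w₁⟩ ω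
    let ω₂ : Path w₀ w₁ := ω.map _root_.continuous_snd
    let ω₀ : Path ((0 : I), w₀) ((0 : I), w₁) := ω₂.map (f := fun w => (0, w)) (by fun_prop)
    -- Up to homotopy, going up and then along `ω` is the same as going along the shadow `ω₀` of `ω`
    -- in `{0} × W` and then up: the `I`-components agree because `I` is simply connected, and the
    -- `W`-components are both `ω₂`.
    have hq : (q (t₀, w₀)).trans (.mk ω) = (Path.Homotopic.Quotient.mk ω₀).trans (q (t₁, w₁)) := by
      rw [← Path.Homotopic.prod_projLeft_projRight ((q (t₀, w₀)).trans (.mk ω)),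
        ← Path.Homotopic.prod_projLeft_projRight ((Path.Homotopic.Quotient.mk ω₀).trans _)]
      congr 1
      · exact Subsingleton.elim (α := PHQ (0 : I) t₁) _ _
      · have e1 : Path.Homotopic.projRight (q (t₀, w₀)) = .refl w₀ := rfl
        have e2 : Path.Homotopic.projRight (q (t₁, w₁)) = .refl w₁ := rfl
        have e3 : Path.Homotopic.projRight (Path.Homotopic.Quotient.mk ω₀) = .mk ω₂ := rfl
        unfold Path.Homotopic.projRight at *
        rw [quotient_map_trans, quotient_map_trans]
        erw [e1, e2, e3]
        simp
    -- Along the bottom edge the values of the continuous map `f` are themselves related by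
    -- transport.
    have h1 := isTransport_path hX hX' (f.comp ⟨ω₂, ω₂.continuous⟩)
    have h2 : f w₁ = mk ((p w₀).trans (.mk (ω₀.map h.continuous)))
        ((p' w₀).trans (.mk (ω₀.map h'.continuous))) := by
      refine IsTransport.eq_mk ?_
      rw [← hp]
      convert h1 using 1
      · simp
      · simp
      · funext t
        exact (h0 _).symm
      · funext t
        exact (h0' _).symm
    have h3 : H (t₁, w₁) = mk (((p w₀).trans ((q (t₀, w₀)).map h)).trans (.mk (ω.map h.continuous)))
        (((p' w₀).trans ((q (t₀, w₀)).map h')).trans (.mk (ω.map h'.continuous))) := by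
      rw [hp w₁] at h2
      have h4 := (mk_trans_eq_mk_trans_iff ((q (t₁, w₁)).map h) ((q (t₁, w₁)).map h')).2 h2
      refine h4.trans ?_
      have e1 := congrArg (fun r => Path.Homotopic.Quotient.map r h) hq
      have e2 := congrArg (fun r => Path.Homotopic.Quotient.map r h') hq
      simp only [quotient_map_trans] at e1 e2
      rw [Path.Homotopic.Quotient.trans_assoc, Path.Homotopic.Quotient.trans_assoc]
      erw [← e1, ← e2]
      rw [← Path.Homotopic.Quotient.trans_assoc, ← Path.Homotopic.Quotient.trans_assoc]
      rfl
    rw [h3]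
    exact isTransport_mk _ _ _ _
  refine ⟨⟨H, hH⟩, fun _ => rfl, fun _ => rfl, fun w => ?_⟩
  have hq0 : q (0, w) = .refl (0, w) := by
    change Path.Homotopic.Quotient.map _ (ι w) = _
    rw [Subsingleton.elim (Path.Homotopic.Quotient.mk _) (Path.Homotopic.Quotient.refl (0 : I))]
    rfl
  change mk ((p w).trans ((q (0, w)).map h)) ((p' w).trans ((q (0, w)).map h')) = _
  rw [hp w, hq0]
  simp [quotient_map_refl]

omit [T2Space X] [T2Space X'] in
/-- Over a simply connected compact space `Δ` mapping to `X`, the cover is the product of `Δ` with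
the simply connected cover of `X'`. -/
theorem exists_trivialization [PathConnectedSpace X] [CompactlyCoherentSpace X']
    [LocallyPathConnectedSpace X'] {E : Type*} [TopologicalSpace E] [SimplyConnectedSpace E]
    {ϖ : E → X'} (hϖ : IsCoveringMap ϖ) (ε₀ : E) (hε₀ : ϖ ε₀ = e') {Δ : Type*}
    [TopologicalSpace Δ] [SimplyConnectedSpace Δ] [CompactSpace Δ] [LocallyCompactSpace Δ]
    [LocallyPathConnectedSpace Δ] (φ : C(Δ, X)) :
    ∃ (Θ : C(Δ × E, R.Cover)) (ξ : Δ × R.Cover → E), (∀ z ε, fst (Θ (z, ε)) = φ z) ∧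
      (∀ z ε, ξ (z, Θ (z, ε)) = ε) ∧ (∀ z d, fst d = φ z → Θ (z, ξ (z, d)) = d) ∧
      ContinuousOn ξ {q | fst q.2 = φ q.1} := by
  subst hε₀
  have hΔ : PathConnectedSpace Δ := inferInstance
  obtain ⟨z₀⟩ : Nonempty Δ := hΔ.nonempty
  let ϖc : C(E, X') := ⟨ϖ, hϖ.continuous⟩
  let p₀ : PHQ e (φ z₀) := .mk (PathConnectedSpace.somePath e (φ z₀))
  let a : ∀ z : Δ, PHQ z₀ z := fun z => .mk (PathConnectedSpace.somePath z₀ z)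
  let b : ∀ ε : E, PHQ ε₀ ε := fun ε => .mk (PathConnectedSpace.somePath ε₀ ε)
  -- In the simply connected spaces `Δ` and `E` there is a unique class of paths from the base point
  -- to a given point. Their images in `X` and `X'` represent the point `Θ (z, ε)`.
  let Θ : Δ × E → R.Cover := fun q =>
    mk (p₀.trans ((a q.1).map φ)) ((b q.2).map ϖc)
  let g : Δ × X' → 𝐤 (X × X') := fun q => CompactCoherentification.mk _ (φ q.1, q.2)
  have hE : LocallyPathConnectedSpace E := hϖ.isLocalHomeomorph.locallyPathConnectedSpace
  -- Compactness of `Δ` makes the ordinary product `Δ × X'` compactly generated, so `g` is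
  -- continuous into the finer topology of `𝐤 (X × X')`.
  have hg : Continuous g := by
    have : CompactlyCoherentSpace (Δ × X') :=
      compactlyCoherentSpace_of_continuous_mk (by
        have := (CompactCoherentification.continuous_map_of_continuous
          (Homeomorph.prodComm X' Δ).continuous).comp
          (CompactCoherentification.continuous_mk (X := X' × Δ))
        exact this.comp (Homeomorph.prodComm Δ X').continuous)
    exact continuous_mk_comp (by fun_prop)
  have hΘ : Continuous Θ := by
    refine continuous_of_isTransport ?_ ?_
    · exact hg.comp (f := fun q : Δ × E => (q.1, ϖ q.2))
        (_root_.continuous_fst.prodMk (hϖ.continuous.comp _root_.continuous_snd))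
    · rintro ⟨z, ε⟩ ⟨z₁, ε₁⟩ ω
      let ω₁ : Path z z₁ := ω.map _root_.continuous_fst
      let ω₂ : Path ε ε₁ := ω.map _root_.continuous_snd
      have h1 : a z₁ = (a z).trans (.mk ω₁) := Subsingleton.elim _ _
      have h2 : b ε₁ = (b ε).trans (.mk ω₂) := Subsingleton.elim _ _
      have h3 : Θ (z₁, ε₁) = mk ((p₀.trans ((a z).map φ)).trans (.mk (ω₁.map φ.continuous)))
          (((b ε).map ϖc).trans (.mk (ω₂.map ϖc.continuous))) := by
        simp only [Θ, h1, h2, quotient_map_trans, Path.Homotopic.Quotient.trans_assoc]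
        rfl
      rw [h3]
      exact isTransport_mk _ _ _ _
  -- `Q` is the pullback of the cover to `Δ × X'`. Both `Q` and `Δ × E` are local homeomorphisms
  -- over `Δ × X'`, so the map `Θ'` between them is one too, and bijectivity suffices to make it a
  -- homeomorphism.
  let Q := {q : (Δ × X') × R.Cover // g q.1 = proj R q.2}
  let ψ : Q → Δ × X' := fun q => q.1.1
  have hψ : IsLocalHomeomorph ψ := (isLocalHomeomorph_proj hX hX').pullback hg
  let Θ' : Δ × E → Q := fun q => ⟨((q.1, ϖ q.2), Θ q), rfl⟩
  have hΘ' : IsLocalHomeomorph Θ' := by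
    refine IsLocalHomeomorph.of_comp (g := ψ) ?_ hψ ?_
    · rintro ⟨z, ε⟩
      obtain ⟨k, hk, hk'⟩ := hϖ.isLocalHomeomorph ε
      refine ⟨(OpenPartialHomeomorph.refl Δ).prod k, ⟨mem_univ _, hk⟩, ?_⟩
      funext q
      change (q.1, ϖ q.2) = (q.1, k q.2)
      rw [hk']
    · refine Continuous.subtype_mk ?_ _
      exact (_root_.continuous_fst.prodMk (hϖ.continuous.comp _root_.continuous_snd)).prodMk hΘ
  have hinj : Function.Injective Θ' := by
    rintro ⟨z, ε⟩ ⟨z₁, ε₁⟩ h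
    have h1 : ((z, ϖ ε), Θ (z, ε)) = ((z₁, ϖ ε₁), Θ (z₁, ε₁)) := congrArg Subtype.val h
    obtain ⟨h2, h3⟩ := Prod.mk.inj h1
    obtain ⟨rfl, h4⟩ := Prod.mk.inj h2
    -- The first paths coincide, so equality in the cover forces equality of the classes in `X'`;
    -- lifts to `E` of equal classes from `ε₀` then end at the same point.
    have h5 : (b ε).map ϖc = ((b ε₁).map ϖc).cast rfl h4 := by
      refine mk_left_injective (R := R) (p := p₀.trans ((a z).map φ)) ?_
      refine h3.trans ?_
      change mk (p₀.trans ((a z).map φ)) ((b ε₁).map ϖc) = _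
      have : ∀ {x₁ x₂ : X'} (h : x₂ = x₁) (r : PHQ (ϖ ε₀) x₁),
          mk (R := R) (p₀.trans ((a z).map φ)) r =
            mk (p₀.trans ((a z).map φ)) (r.cast rfl h) := by
        rintro x₁ _ rfl r
        simp
      exact this h4 _
    have h6 := hϖ.monodromy_map (b ε)
    have h7 := hϖ.monodromy_eq_of_map_eq (γ := (b ε).map ϖc) (ex := ⟨ε₀, rfl⟩) (ey := ⟨ε₁, h4.symm⟩)
      (b ε₁) (by
        change (b ε₁).map ϖc = ((b ε).map ϖc).cast _ _
        rw [h5]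
        exact ((Path.Homotopic.Quotient.cast_cast _ _ _ _ _).trans
          (Path.Homotopic.Quotient.cast_rfl_rfl _)).symm)
    have h8 : ε = ε₁ := congrArg Subtype.val (h6.symm.trans h7)
    rw [h8]
  have hsurj : Function.Surjective Θ' := by
    rintro ⟨⟨⟨z, x'⟩, d⟩, hd⟩
    have hd' : (φ z, x') = (fst d, snd d) := (CompactCoherentification.mk _).injective hd
    obtain ⟨hd1, hd2⟩ := Prod.mk.inj hd'
    obtain ⟨y', p', rfl⟩ := exists_mk_left (p₀.trans ((a z).map φ)) d hd1.symm
    obtain rfl : x' = y' := hd2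
    -- The preimage is the end point of the lift of `p'` to the covering `E` starting at `ε₀`.
    let ε := hϖ.monodromy p' ⟨ε₀, rfl⟩
    have h1 := hϖ.map_liftPathQuotient p' ⟨ε₀, rfl⟩
    have h2 : b ε.1 = hϖ.liftPathQuotient p' ⟨ε₀, rfl⟩ := Subsingleton.elim _ _
    have h3 : (b ε.1).map ϖc = p'.cast rfl ε.2 := by
      rw [h2]
      exact h1
    clear h1 h2
    generalize ε = ε' at h3
    obtain ⟨ε', hε'⟩ := ε'
    have hε'' : ϖ ε' = x' := hε'
    subst hε''
    refine ⟨(z, ε'), Subtype.ext (Prod.ext rfl ?_)⟩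
    change mk (p₀.trans ((a z).map φ)) ((b ε').map ϖc) = _
    rw [h3]
    exact congrArg (mk _) (Path.Homotopic.Quotient.cast_rfl_rfl _)
  let Ψ : Δ × E ≃ₜ Q := hΘ'.toHomeomorphOfBijective ⟨hinj, hsurj⟩
  have hmem : ∀ (z : Δ) (d : R.Cover), fst d = φ z → g (z, snd d) = proj R d := by
    intro z d h
    change CompactCoherentification.mk _ _ = CompactCoherentification.mk _ _
    rw [h]
  classical
  let ξ : Δ × R.Cover → E := fun q =>
    if h : fst q.2 = φ q.1 then (Ψ.symm ⟨((q.1, snd q.2), q.2), hmem _ _ h⟩).2 else ε₀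
  refine ⟨⟨Θ, hΘ⟩, ξ, fun _ _ => rfl, ?_, ?_, ?_⟩
  · intro z ε
    have h1 : Ψ (z, ε) = ⟨((z, snd (Θ (z, ε))), Θ (z, ε)), hmem z (Θ (z, ε)) rfl⟩ := rfl
    have : ξ (z, Θ (z, ε)) =
        (Ψ.symm ⟨((z, snd (Θ (z, ε))), Θ (z, ε)), hmem z (Θ (z, ε)) rfl⟩).2 := dif_pos rfl
    exact this.trans (by rw [← h1, Homeomorph.symm_apply_apply])
  · intro z d hd
    have h1 : ξ (z, d) = (Ψ.symm ⟨((z, snd d), d), hmem z d hd⟩).2 := dif_pos hd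
    have h2 := congrArg Subtype.val (Ψ.apply_symm_apply ⟨((z, snd d), d), hmem z d hd⟩)
    generalize Ψ.symm ⟨((z, snd d), d), hmem z d hd⟩ = r at h1 h2
    obtain ⟨z', ε⟩ := r
    have h3 : ((z', ϖ ε), Θ (z', ε)) = ((z, snd d), d) := h2
    obtain ⟨h4, h5⟩ := Prod.mk.inj h3
    obtain ⟨rfl, -⟩ := Prod.mk.inj h4
    change Θ (_, ξ _) = d
    rw [h1, h5]
  · rw [continuousOn_iff_continuous_domRestrict]
    have h1 : Continuous fun q : {q : Δ × R.Cover | fst q.2 = φ q.1} =>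
        (Ψ.symm ⟨((q.1.1, snd q.1.2), q.1.2), hmem _ _ q.2⟩).2 := by
      refine _root_.continuous_snd.comp (Ψ.symm.continuous.comp (Continuous.subtype_mk ?_ _))
      have := (continuous_snd (R := R))
      fun_prop
    refine h1.congr fun q => ?_
    have hq : fst q.1.2 = φ q.1.1 := q.2
    have h2 : ξ q.1 = (Ψ.symm ⟨((q.1.1, snd q.1.2), q.1.2), hmem _ _ hq⟩).2 := dif_pos hq
    exact h2.symm

end LoopCorrespondence.Cover

section CellularMethods

open Metric

/-! ## Extension over balls -/

/-- A family of maps from the unit sphere to a contractible space extends over the whole space. -/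
theorem exists_extension_of_sphere {V W E : Type*} [NormedAddCommGroup V] [NormedSpace ℝ V]
    [ProperSpace V] [TopologicalSpace W] [TopologicalSpace E] [ContractibleSpace E]
    (f : V × W → E) (hf : ContinuousOn f (sphere 0 1 ×ˢ univ)) :
    ∃ F : V × W → E, Continuous F ∧ ∀ v ∈ sphere (0 : V) 1, ∀ w, F (v, w) = f (v, w) := by
  classical
  obtain ⟨e₁, ⟨c⟩⟩ := id_nullhomotopic E
  -- Coning off: `c` runs from the identity at time `0` to the constant `e₁` at time `1`, and `s` is
  -- `0` on and outside the unit sphere and `1` at the origin. So `F` is `f` on the sphere and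
  -- contracts radially to `e₁`.
  let s : V → I := fun v => projIcc 0 1 zero_le_one (1 - ‖v‖)
  have hs : Continuous s := continuous_projIcc.comp (by fun_prop)
  let F : V × W → E := fun q => if q.1 = 0 then e₁ else c (s q.1, f (‖q.1‖⁻¹ • q.1, q.2))
  refine ⟨F, ?_, ?_⟩
  · have hG : ContinuousOn (fun q : V × W => c (s q.1, f (‖q.1‖⁻¹ • q.1, q.2))) {q | q.1 ≠ 0} := by
      refine c.continuous.comp_continuousOn ?_
      refine (hs.comp continuous_fst).continuousOn.prodMk (hf.comp ?_ ?_)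
      · refine ContinuousOn.prodMk (ContinuousOn.smul (ContinuousOn.inv₀ (by fun_prop) ?_)
          (by fun_prop)) (by fun_prop)
        intro q hq
        simpa using hq
      · intro q hq
        refine ⟨?_, mem_univ _⟩
        rw [mem_sphere_zero_iff_norm, norm_smul, norm_inv, norm_norm, inv_mul_cancel₀]
        simpa using hq
    have ho : IsOpen {q : V × W | q.1 ≠ 0} := isOpen_ne.preimage continuous_fst
    rw [continuous_iff_continuousAt]
    rintro ⟨v, w⟩
    by_cases hv : v = 0
    · subst hv
      rw [ContinuousAt, _root_.tendsto_nhds]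
      intro O hO hO0
      have hO1 : e₁ ∈ O := by simpa [F] using hO0
      let g : sphere (0 : V) 1 × (I × W) → E := fun q => c (q.2.1, f (q.1, q.2.2))
      have hg : Continuous g := by
        refine c.continuous.comp (Continuous.prodMk (by fun_prop) ?_)
        exact hf.comp_continuous (f := fun q : sphere (0 : V) 1 × (I × W) => ((q.1 : V), q.2.2))
          (by fun_prop) fun q => ⟨q.1.2, mem_univ _⟩
      have hK : IsCompact (univ : Set (sphere (0 : V) 1)) :=
        isCompact_iff_isCompact_univ.1 (isCompact_sphere (0 : V) 1)
      -- The direction `v / ‖v‖` has no limit at the origin. Compactness of the sphere gives a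
      -- neighbourhood of `(1, w)` that works for all directions at once.
      obtain ⟨A, B, -, hB, hA, hB1, hAB⟩ := generalized_tube_lemma hK
        (isCompact_singleton (x := ((1 : I), w))) (hO.preimage hg) (by
          rintro ⟨θ, t, w'⟩ ⟨-, h⟩
          obtain ⟨rfl, rfl⟩ := Prod.mk.inj h
          simpa [g] using hO1)
      have hc : Continuous fun q : V × W => (s q.1, q.2) := by fun_prop
      have hs0 : s 0 = 1 := by simp [s]
      have hn : (fun q : V × W => (s q.1, q.2)) ⁻¹' B ∈ 𝓝 ((0 : V), w) :=
        (hB.preimage hc).mem_nhds (hB1 (by simp [hs0]))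
      filter_upwards [hn] with q hq
      by_cases hq0 : q.1 = 0
      · simpa [F, hq0] using hO1
      · have h1 : ‖q.1‖⁻¹ • q.1 ∈ sphere (0 : V) 1 := by
          rw [mem_sphere_zero_iff_norm, norm_smul, norm_inv, norm_norm, inv_mul_cancel₀]
          simpa using hq0
        have := hAB (a := (⟨_, h1⟩, (s q.1, q.2))) ⟨hA (mem_univ _), hq⟩
        simpa [F, hq0] using this
    · refine (hG.continuousAt (ho.mem_nhds (x := (v, w)) hv)).congr ?_
      filter_upwards [ho.mem_nhds (x := (v, w)) hv] with q hq
      exact (if_neg hq).symm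
  · intro v hv w
    rw [mem_sphere_zero_iff_norm] at hv
    have : v ≠ 0 := by
      rintro rfl
      simp at hv
    simp [F, this, hv, s]

/-! ## Cell by cell constructions -/

section Cells

variable {Y : Type u} [TopologicalSpace Y] [CWComplex (univ : Set Y)]

theorem mem_closedCell_cases {n : ℕ} {c : RelCWComplex.cell (univ : Set Y) n} {y : Y}
    (hy : y ∈ RelCWComplex.closedCell n c) : y ∈ RelCWComplex.openCell n c ∨
      ∃ m < n, ∃ d : RelCWComplex.cell (univ : Set Y) m, y ∈ RelCWComplex.openCell m d := by
  rw [← RelCWComplex.cellFrontier_union_openCell_eq_closedCell] at hy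
  rcases hy with hy | hy
  · obtain ⟨J, hJ⟩ := CWComplex.cellFrontier_subset_finite_openCell n c
    have := hJ hy
    simp only [mem_iUnion] at this
    obtain ⟨m, hm, d, -, hd⟩ := this
    exact Or.inr ⟨m, hm, d, hd⟩
  · exact Or.inl hy

theorem cell_eq_of_mem {n m : ℕ} {c : RelCWComplex.cell (univ : Set Y) n}
    {d : RelCWComplex.cell (univ : Set Y) m} {y : Y} (hc : y ∈ RelCWComplex.openCell n c)
    (hd : y ∈ RelCWComplex.openCell m d) :
    (⟨n, c⟩ : Σ n, RelCWComplex.cell (univ : Set Y) n) = ⟨m, d⟩ :=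
  RelCWComplex.eq_of_not_disjoint_openCell (not_disjoint_iff.2 ⟨y, hc, hd⟩)

theorem exists_mem_openCell (y : Y) :
    ∃ (n : ℕ) (c : RelCWComplex.cell (univ : Set Y) n), y ∈ RelCWComplex.openCell n c := by
  have : y ∈ (univ : Set Y) := mem_univ y
  rw [← CWComplex.iUnion_openCell_eq_complex (C := (univ : Set Y))] at this
  simpa using this

/-- Data on the points of a CW complex can be constructed cell by cell. -/
theorem exists_good_on_cells {Φ : Y → Type*}
    (good : ∀ n, RelCWComplex.cell (univ : Set Y) n → (∀ y, Φ y) → Prop)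
    (congr : ∀ n c s s', (∀ y ∈ RelCWComplex.closedCell n c, s y = s' y) → good n c s → good n c s')
    (ext : ∀ n c s, (∀ m < n, ∀ d, good m d s) →
      ∃ s', (∀ y ∉ RelCWComplex.openCell n c, s' y = s y) ∧ good n c s')
    (s₀ : ∀ y, Φ y) : ∃ s, ∀ n c, good n c s := by
  classical
  choose nx hnx hgood using ext
  -- Stage `n` changes the data on all open `n`-cells simultaneously, which is consistent because
  -- open cells are disjoint. The second condition of the `if` only supplies the hypothesis that
  -- `nx` requires.
  let step : ℕ → (∀ y, Φ y) → ∀ y, Φ y := fun n s y =>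
    if h : (∃ c : RelCWComplex.cell (univ : Set Y) n, y ∈ RelCWComplex.openCell n c) ∧
      (∀ m < n, ∀ d, good m d s) then nx n h.1.choose s h.2 y else s y
  have step_eq : ∀ n s y, (∀ c : RelCWComplex.cell (univ : Set Y) n, y ∉ RelCWComplex.openCell n c) →
      step n s y = s y := fun n s y h => dif_neg fun h' => h _ h'.1.choose_spec
  -- The frontier of an `n`-cell lies in open cells of lower dimension, where neither `step` nor the
  -- one-cell modification `nx` changes anything.
  have step_closed : ∀ n s (hs : ∀ m < n, ∀ d, good m d s) (c : RelCWComplex.cell (univ : Set Y) n),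
      ∀ y ∈ RelCWComplex.closedCell n c, step n s y = nx n c s hs y := by
    intro n s hs c y hy
    rcases mem_closedCell_cases hy with hy | ⟨m, hm, d, hd⟩
    · have h : (∃ c : RelCWComplex.cell (univ : Set Y) n, y ∈ RelCWComplex.openCell n c) ∧
        (∀ m < n, ∀ d, good m d s) := ⟨⟨c, hy⟩, hs⟩
      have h1 : h.1.choose = c :=
        eq_of_heq (Sigma.mk.inj (cell_eq_of_mem h.1.choose_spec hy)).2
      have h2 : step n s y = nx n h.1.choose s h.2 y := dif_pos h
      rw [h2, h1]
    · have h3 : ∀ c : RelCWComplex.cell (univ : Set Y) n, y ∉ RelCWComplex.openCell n c := by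
        intro c' hc'
        have := congrArg Sigma.fst (cell_eq_of_mem hc' hd)
        dsimp only at this
        omega
      rw [step_eq n s y h3, hnx n c s hs y (h3 c)]
  let seq : ℕ → ∀ y, Φ y := fun n => Nat.rec s₀ step n
  have seq_succ : ∀ n, seq (n + 1) = step n (seq n) := fun n => rfl
  have step_lower : ∀ n s m (d : RelCWComplex.cell (univ : Set Y) m), m < n →
      ∀ y ∈ RelCWComplex.closedCell m d, step n s y = s y := by
    intro n s m d hmn y hy
    refine step_eq n s y fun c hc => ?_
    rcases mem_closedCell_cases hy with hy | ⟨k, hk, d, hd⟩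
    · have := congrArg Sigma.fst (cell_eq_of_mem hc hy)
      dsimp only at this
      omega
    · have := congrArg Sigma.fst (cell_eq_of_mem hc hd)
      dsimp only at this
      omega
  have seq_good : ∀ n, ∀ m < n, ∀ d, good m d (seq n) := by
    intro n
    induction n with
    | zero => intro m hm; omega
    | succ n ih =>
      intro m hm d
      rw [seq_succ]
      rcases Nat.lt_succ_iff_lt_or_eq.1 hm with h | rfl
      · exact congr m d _ _ (fun y hy => (step_lower n _ m d h y hy).symm) (ih m h d)
      · exact congr m d _ _ (fun y hy => (step_closed m _ ih d y hy).symm) (hgood m d _ ih)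
  choose dim cel hcel using exists_mem_openCell (Y := Y)
  refine ⟨fun y => seq (dim y + 1) y, fun n c => ?_⟩
  refine congr n c (seq (n + 1)) _ (fun y hy => ?_) (seq_good (n + 1) n (by omega) c)
  have hdim : dim y ≤ n := by
    rcases mem_closedCell_cases hy with hy | ⟨k, hk, d, hd⟩
    · have := congrArg Sigma.fst (cell_eq_of_mem (hcel y) hy)
      dsimp only at this
      omega
    · have := congrArg Sigma.fst (cell_eq_of_mem (hcel y) hd)
      dsimp only at this
      omega
  -- The value at `y` is final once the cells of dimension `dim y` have been treated, that is, from
  -- stage `dim y + 1` on.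
  have key : ∀ k, seq (dim y + 1 + k) y = seq (dim y + 1) y := by
    intro k
    induction k with
    | zero => rfl
    | succ k ih =>
      rw [← ih, ← Nat.add_assoc, seq_succ]
      exact step_lower _ _ (dim y) (cel y) (by omega) y
        (RelCWComplex.openCell_subset_closedCell _ _ (hcel y))
  obtain ⟨k, hk⟩ := Nat.exists_eq_add_of_le hdim
  have : n + 1 = dim y + 1 + k := by omega
  rw [this]
  exact key k

/-- A compact subset of a CW complex is contained in a finite union of closed cells. -/
theorem IsCompact.exists_finite_cells [T2Space Y] {T : Set Y} (hT : IsCompact T) :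
    ∃ F : Set (Σ n, RelCWComplex.cell (univ : Set Y) n), F.Finite ∧
      T ⊆ ⋃ c ∈ F, RelCWComplex.closedCell c.1 c.2 := by
  let F : Set (Σ n, RelCWComplex.cell (univ : Set Y) n) :=
    {c | (RelCWComplex.openCell c.1 c.2 ∩ T).Nonempty}
  refine ⟨F, ?_, fun y hy => ?_⟩
  · by_contra hF
    have hne : ∀ c : F, (RelCWComplex.openCell c.1.1 c.1.2 ∩ T).Nonempty := fun c => c.2
    choose p hp using hne
    have hinj : Function.Injective p := by
      intro c d hcd
      have h1 := (hp c).1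
      rw [hcd] at h1
      exact Subtype.ext (cell_eq_of_mem h1 (hp d).1)
    have hfin : ∀ n (c : RelCWComplex.cell (univ : Set Y) n),
        (range p ∩ RelCWComplex.closedCell n c).Finite := by
      intro n c
      obtain ⟨J, hJ⟩ := CWComplex.cellFrontier_subset_finite_openCell n c
      let A : Set (Σ n, RelCWComplex.cell (univ : Set Y) n) :=
        {⟨n, c⟩} ∪ ⋃ m ∈ Finset.range n, (fun d => ⟨m, d⟩) '' (J m : Set _)
      have hA : A.Finite := (finite_singleton _).union
        ((Finset.finite_toSet _).biUnion fun m _ => (Finset.finite_toSet _).image _)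
      refine ((hA.preimage (f := fun c : F => c.1) Subtype.val_injective.injOn).image p).subset ?_
      rintro _ ⟨⟨d, rfl⟩, hd⟩
      refine ⟨d, ?_, rfl⟩
      rw [← RelCWComplex.cellFrontier_union_openCell_eq_closedCell] at hd
      rcases hd with hd | hd
      · have := hJ hd
        simp only [mem_iUnion] at this
        obtain ⟨m, hm, d', hd', h⟩ := this
        refine Or.inr (mem_biUnion (x := m) (by simpa using hm) ⟨d', hd', ?_⟩)
        exact (cell_eq_of_mem (hp d).1 h).symm
      · exact Or.inl (cell_eq_of_mem (hp d).1 hd)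
    have hinf : (range p).Infinite := by
      have := (Set.infinite_coe_iff).2 hF
      exact infinite_range_of_injective hinj
    -- If infinitely many open cells met `T`, the chosen points would accumulate in `T`. But any set
    -- of chosen points meets each closed cell in a finite set and is therefore closed, so there is
    -- no accumulation point.
    obtain ⟨x, -, hx⟩ := hinf.exists_accPt_of_subset_isCompact hT
      (by rintro _ ⟨c, rfl⟩; exact (hp c).2)
    have hcl : IsClosed (range p \ {x}) := by
      rw [CWComplex.closed (univ : Set Y) _ (subset_univ _)]
      intro n c
      exact ((hfin n c).subset (inter_subset_inter_left _ sdiff_subset)).isClosed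
    rw [accPt_principal_iff_nhdsWithin] at hx
    have : x ∈ closure (range p \ {x}) := mem_closure_iff_nhdsWithin_neBot.2 hx
    rw [hcl.closure_eq] at this
    exact this.2 rfl
  · obtain ⟨n, c, hc⟩ := exists_mem_openCell y
    exact mem_biUnion (x := (⟨n, c⟩ : Σ n, RelCWComplex.cell (univ : Set Y) n)) ⟨y, hc, hy⟩
      (RelCWComplex.openCell_subset_closedCell _ _ hc)

/-- Continuity can be checked after composing with the characteristic maps of the cells. -/
theorem continuousOn_of_cells [T2Space Y] {P Z T : Type*} [TopologicalSpace P] [TopologicalSpace Z]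
    [TopologicalSpace T] {S : Y × P → Z} {A : Set (Y × P)} (hA : IsClosed A)
    {F : Set (Σ n, RelCWComplex.cell (univ : Set Y) n)} (hF : F.Finite)
    (hS : ∀ c ∈ F, ContinuousOn (fun q : (Fin c.1 → ℝ) × P => S (RelCWComplex.map c.1 c.2 q.1, q.2))
      {q | q.1 ∈ closedBall 0 1 ∧ (RelCWComplex.map c.1 c.2 q.1, q.2) ∈ A})
    {g : T → Y} {B : Set T} (hB : IsClosed B) (hg : ContinuousOn g B)
    (hgF : ∀ t ∈ B, g t ∈ ⋃ c ∈ F, RelCWComplex.closedCell c.1 c.2) :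
    ContinuousOn (fun q : T × P => S (g q.1, q.2)) {q | q.1 ∈ B ∧ (g q.1, q.2) ∈ A} := by
  rw [continuousOn_iff_isClosed]
  intro C hC
  refine ⟨(fun q : T × P => S (g q.1, q.2)) ⁻¹' C ∩ {q | q.1 ∈ B ∧ (g q.1, q.2) ∈ A}, ?_, by
    rw [inter_assoc, inter_self]⟩
  -- The preimage of a closed set `C` is the union, over the finitely many cells, of the projections
  -- along a compact ball of the closed sets `D c`, and such projections are closed. In this way no
  -- topology on `Y × P` as a quotient of cells is needed.
  let D : ∀ c : Σ n, RelCWComplex.cell (univ : Set Y) n,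
      Set (closedBall (0 : Fin c.1 → ℝ) 1 × (T × P)) := fun c =>
    {q | q.2.1 ∈ B ∧ g q.2.1 = RelCWComplex.map c.1 c.2 q.1 ∧
      (RelCWComplex.map c.1 c.2 (q.1 : Fin c.1 → ℝ), q.2.2) ∈ A ∧
      S (RelCWComplex.map c.1 c.2 q.1, q.2.2) ∈ C}
  have hD : ∀ c ∈ F, IsClosed (D c) := by
    intro c hc
    have hm : Continuous fun z : closedBall (0 : Fin c.1 → ℝ) 1 => RelCWComplex.map c.1 c.2 z :=
      (RelCWComplex.continuousOn c.1 c.2).comp_continuous continuous_subtype_val fun z => z.2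
    have h1 : IsClosed {q : closedBall (0 : Fin c.1 → ℝ) 1 × (T × P) | q.2.1 ∈ B ∧
        (g q.2.1, RelCWComplex.map c.1 c.2 (q.1 : Fin c.1 → ℝ)) ∈ {r : Y × Y | r.1 = r.2}} := by
      have hc : ContinuousOn (fun q : closedBall (0 : Fin c.1 → ℝ) 1 × (T × P) =>
          (g q.2.1, RelCWComplex.map c.1 c.2 (q.1 : Fin c.1 → ℝ))) {q | q.2.1 ∈ B} := by
        refine ContinuousOn.prodMk (hg.comp (by fun_prop) fun q hq => hq) ?_
        exact (hm.comp continuous_fst).continuousOn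
      exact hc.preimage_isClosed_of_isClosed (hB.preimage (by fun_prop)) isClosed_diagonal
    have hm2 : Continuous fun q : closedBall (0 : Fin c.1 → ℝ) 1 × (T × P) =>
        (RelCWComplex.map c.1 c.2 (q.1 : Fin c.1 → ℝ), q.2.2) :=
      (hm.comp continuous_fst).prodMk (by fun_prop)
    have h2 : IsClosed {q : closedBall (0 : Fin c.1 → ℝ) 1 × (T × P) |
        (RelCWComplex.map c.1 c.2 (q.1 : Fin c.1 → ℝ), q.2.2) ∈ A ∧
        S (RelCWComplex.map c.1 c.2 q.1, q.2.2) ∈ C} := by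
      have hc2 : ContinuousOn (fun q : closedBall (0 : Fin c.1 → ℝ) 1 × (T × P) =>
          S (RelCWComplex.map c.1 c.2 q.1, q.2.2))
          {q | (RelCWComplex.map c.1 c.2 (q.1 : Fin c.1 → ℝ), q.2.2) ∈ A} :=
        (hS c hc).comp (f := fun q : closedBall (0 : Fin c.1 → ℝ) 1 × (T × P) =>
          ((q.1 : Fin c.1 → ℝ), q.2.2)) (by fun_prop) fun q hq => ⟨q.1.2, hq⟩
      exact hc2.preimage_isClosed_of_isClosed (hA.preimage hm2) hC
    convert h1.inter h2 using 1
    ext q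
    simp only [D, mem_ofPred_eq, mem_inter_iff]
    tauto
  have hun : (fun q : T × P => S (g q.1, q.2)) ⁻¹' C ∩ {q | q.1 ∈ B ∧ (g q.1, q.2) ∈ A} =
      ⋃ c ∈ F, Prod.snd '' (D c) := by
    ext q
    simp only [mem_inter_iff, mem_preimage, mem_ofPred_eq, mem_iUnion, mem_image, exists_prop, D]
    constructor
    · rintro ⟨h1, h2, h3⟩
      have := hgF q.1 h2
      simp only [mem_iUnion] at this
      obtain ⟨c, hc, z, hz, hzg⟩ := this
      exact ⟨c, hc, (⟨z, hz⟩, q), ⟨h2, hzg.symm, hzg ▸ h3, by dsimp only; rw [hzg]; exact h1⟩, rfl⟩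
    · rintro ⟨c, hc, r, ⟨h1, h2, h3, h4⟩, rfl⟩
      rw [h2]
      exact ⟨h4, h1, h3⟩
  rw [hun]
  refine hF.isClosed_biUnion fun c hc => ?_
  have : CompactSpace (closedBall (0 : Fin c.1 → ℝ) 1) :=
    isCompact_iff_compactSpace.1 (isCompact_closedBall _ _)
  exact isClosedMap_snd_of_compactSpace _ (hD c hc)

end Cells

/-! ## The projections of the cover are homotopy equivalences -/

instance compactlyCoherentSpace_prod_left {X Y : Type*} [TopologicalSpace X] [TopologicalSpace Y]
    [CompactlyCoherentSpace X] [CompactSpace Y] [LocallyCompactSpace Y] :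
    CompactlyCoherentSpace (Y × X) :=
  compactlyCoherentSpace_of_continuous_mk <|
    ((CompactCoherentification.continuous_map_of_continuous
      (Homeomorph.prodComm X Y).continuous).comp
        (CompactCoherentification.continuous_mk (X := X × Y))).comp
          (Homeomorph.prodComm Y X).continuous

section Cells

variable {Y : Type u} [TopologicalSpace Y] [CWComplex (univ : Set Y)]

theorem exists_finite_lower_cells (n : ℕ) (c : RelCWComplex.cell (univ : Set Y) n) :
    ∃ F : Set (Σ n, RelCWComplex.cell (univ : Set Y) n), F.Finite ∧ (∀ d ∈ F, d.1 < n) ∧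
      ∀ z ∈ sphere (0 : Fin n → ℝ) 1,
        RelCWComplex.map n c z ∈ ⋃ d ∈ F, RelCWComplex.closedCell d.1 d.2 := by
  obtain ⟨J, hJ⟩ := CWComplex.cellFrontier_subset_finite_closedCell n c
  refine ⟨⋃ m ∈ Finset.range n, (fun d => ⟨m, d⟩) '' (J m : Set _),
    (Finset.finite_toSet _).biUnion fun m _ => (Finset.finite_toSet _).image _, ?_, ?_⟩
  · intro d hd
    simp only [mem_iUnion] at hd
    obtain ⟨m, hm, d, -, rfl⟩ := hd
    exact Finset.mem_range.1 hm
  · intro z hz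
    have := hJ (mem_image_of_mem _ hz)
    simp only [mem_iUnion] at this
    obtain ⟨m, hm, d, hd, h⟩ := this
    refine mem_biUnion (x := (⟨m, d⟩ : Σ n, RelCWComplex.cell (univ : Set Y) n)) ?_ h
    exact mem_biUnion (x := m) (by simpa using hm) ⟨d, hd, rfl⟩

theorem map_mem_openCell_or (n : ℕ) (c : RelCWComplex.cell (univ : Set Y) n) {z : Fin n → ℝ}
    (hz : z ∈ closedBall (0 : Fin n → ℝ) 1) :
    (RelCWComplex.map n c z ∈ RelCWComplex.openCell n c ∧
      (RelCWComplex.map n c).symm (RelCWComplex.map n c z) = z) ∨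
    (RelCWComplex.map n c z ∉ RelCWComplex.openCell n c ∧ z ∈ sphere (0 : Fin n → ℝ) 1) := by
  rcases (ball_union_sphere (x := (0 : Fin n → ℝ)) (ε := 1)).symm ▸ hz with h | h
  · refine Or.inl ⟨mem_image_of_mem _ h, (RelCWComplex.map n c).left_inv ?_⟩
    rw [RelCWComplex.source_eq]
    exact h
  · refine Or.inr ⟨fun hc => ?_, h⟩
    obtain ⟨J, hJ⟩ := CWComplex.cellFrontier_subset_finite_openCell n c
    have := hJ (mem_image_of_mem _ h)
    simp only [mem_iUnion] at this
    obtain ⟨m, hm, d, -, hd⟩ := this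
    have := congrArg Sigma.fst (cell_eq_of_mem hc hd)
    dsimp only at this
    omega

theorem mem_openCell_symm {n : ℕ} {c : RelCWComplex.cell (univ : Set Y) n} {y : Y}
    (hy : y ∈ RelCWComplex.openCell n c) : (RelCWComplex.map n c).symm y ∈
      ball (0 : Fin n → ℝ) 1 ∧ RelCWComplex.map n c ((RelCWComplex.map n c).symm y) = y := by
  obtain ⟨z, hz, rfl⟩ := hy
  have h : (RelCWComplex.map n c).symm (RelCWComplex.map n c z) = z := by
    refine (RelCWComplex.map n c).left_inv ?_
    rw [RelCWComplex.source_eq]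
    exact hz
  rw [h]
  exact ⟨hz, rfl⟩

end Cells

namespace LoopCorrespondence.Cover

variable {X X' : Type u} [TopologicalSpace X] [TopologicalSpace X'] {e : X} {e' : X'}
  {R : LoopCorrespondence e e'} [T2Space X] [T2Space X'] [LocallyPathConnectedSpace (𝐤 (X × X'))]
  (hX : SemilocallySimplyConnected X) (hX' : SemilocallySimplyConnected X')
  [PathConnectedSpace X] [CompactlyCoherentSpace X'] [LocallyPathConnectedSpace X']
  {E : Type u} [TopologicalSpace E] [ContractibleSpace E]
  {ϖ : E → X'} (hϖ : IsCoveringMap ϖ) (ε₀ : E) (hε₀ : ϖ ε₀ = e')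

include hX hX' hϖ hε₀

-- The closed ball is compact and convex, so `exists_trivialization` applies. Since characteristic
-- maps are total functions on `Fin n → ℝ`, the result is phrased with total functions as well,
-- whose values outside the ball carry no meaning.
omit [T2Space X] [T2Space X'] in
theorem exists_ball_trivialization {n : ℕ} {φ : (Fin n → ℝ) → X}
    (hφ : ContinuousOn φ (closedBall 0 1)) :
    ∃ (Θ : (Fin n → ℝ) × E → R.Cover) (ξ : (Fin n → ℝ) × R.Cover → E),
      ContinuousOn Θ (closedBall 0 1 ×ˢ univ) ∧
      (∀ z ∈ closedBall (0 : Fin n → ℝ) 1, ∀ ε, fst (Θ (z, ε)) = φ z) ∧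
      (∀ z ∈ closedBall (0 : Fin n → ℝ) 1, ∀ ε, ξ (z, Θ (z, ε)) = ε) ∧
      (∀ z ∈ closedBall (0 : Fin n → ℝ) 1, ∀ d, fst d = φ z → Θ (z, ξ (z, d)) = d) ∧
      ContinuousOn ξ {q | q.1 ∈ closedBall 0 1 ∧ fst q.2 = φ q.1} := by
  classical
  let Δ := closedBall (0 : Fin n → ℝ) 1
  have hc : Convex ℝ (closedBall (0 : Fin n → ℝ) 1) := convex_closedBall _ _
  have : ContractibleSpace Δ := hc.contractibleSpace ⟨0, mem_closedBall_self zero_le_one⟩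
  have : LocallyPathConnectedSpace Δ := hc.locallyPathConnectedSpace
  have : CompactSpace Δ := isCompact_iff_compactSpace.1 (isCompact_closedBall _ _)
  obtain ⟨Θ, ξ, h1, h2, h3, h4⟩ := exists_trivialization (R := R) hX hX' hϖ ε₀ hε₀
    (⟨fun z => φ z.1, hφ.comp_continuous continuous_subtype_val fun z => z.2⟩ : C(Δ, X))
  let r : (Fin n → ℝ) → Δ := fun z => if h : z ∈ closedBall 0 1 then ⟨z, h⟩ else
    ⟨0, mem_closedBall_self zero_le_one⟩
  have hr : ∀ z (hz : z ∈ closedBall 0 1), r z = ⟨z, hz⟩ := fun z hz => dif_pos hz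
  have hrc : ContinuousOn r (closedBall 0 1) := by
    rw [continuousOn_iff_continuous_domRestrict]
    exact continuous_id.congr fun z => (hr z.1 z.2).symm
  refine ⟨fun q => Θ (r q.1, q.2), fun q => ξ (r q.1, q.2), ?_, ?_, ?_, ?_, ?_⟩
  · refine Θ.continuous.comp_continuousOn (ContinuousOn.prodMk ?_ (by fun_prop))
    exact hrc.comp (by fun_prop) fun q hq => hq.1
  · intro z hz ε
    rw [h1, hr z hz]
    rfl
  · intro z hz ε
    exact h2 _ _
  · intro z hz d hd
    refine h3 _ _ ?_
    rw [hr z hz]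
    exact hd
  · refine h4.comp (ContinuousOn.prodMk ?_ (by fun_prop)) ?_
    · exact hrc.comp (by fun_prop) fun q hq => hq.1
    · intro q hq
      change fst q.2 = φ (r q.1)
      rw [hr q.1 hq.1]
      exact hq.2

variable {Y : Type u} [TopologicalSpace Y] [T2Space Y] [CWComplex (univ : Set Y)] (f : C(Y, X))

omit [T2Space X] [T2Space X'] in
/-- There is a lift to the cover of a map from a CW complex. -/
theorem exists_section : ∃ sec : Y → R.Cover, (∀ y, fst (sec y) = f y) ∧
    ∀ n (c : RelCWComplex.cell (univ : Set Y) n),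
      ContinuousOn (fun z => sec (RelCWComplex.map n c z)) (closedBall 0 1) := by
  classical
  have hne : ∀ y, ∃ d : R.Cover, fst d = f y := fun y =>
    ⟨mk (.mk (PathConnectedSpace.somePath e (f y))) (.refl e'), rfl⟩
  obtain ⟨s, hs⟩ := exists_good_on_cells (Φ := fun y => {d : R.Cover // fst d = f y})
    (fun n c s => ContinuousOn (fun z => (s (RelCWComplex.map n c z)).1) (closedBall 0 1))
    (fun n c s s' h hc => hc.congr fun z hz => by
      rw [← h _ (mem_image_of_mem _ hz)])
    (fun n c s hs => by
      have hφ : ContinuousOn (fun z => f (RelCWComplex.map n c z)) (closedBall 0 1) :=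
        f.continuous.comp_continuousOn (RelCWComplex.continuousOn n c)
      obtain ⟨Θ, ξ, h1, h2, h3, h4, h5⟩ :=
        exists_ball_trivialization (R := R) hX hX' hϖ ε₀ hε₀ hφ
      obtain ⟨F, hF, hFn, hFc⟩ := exists_finite_lower_cells n c
      have hsub : sphere (0 : Fin n → ℝ) 1 ⊆ closedBall 0 1 := sphere_subset_closedBall
      have hb := continuousOn_of_cells (P := Unit) (Z := R.Cover) (S := fun q => (s q.1).1)
        (A := univ) isClosed_univ hF
        (fun d hd => (hs d.1 (hFn d hd) d.2).comp (by fun_prop) fun q hq => hq.1)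
        isClosed_sphere ((RelCWComplex.continuousOn n c).mono hsub) hFc
      -- In the trivialization over the cell, the section already built on the frontier becomes a
      -- map from the sphere to the contractible space `E`, which extends over the ball.
      have hb' : ContinuousOn (fun q : (Fin n → ℝ) × Unit =>
          ξ (q.1, (s (RelCWComplex.map n c q.1)).1)) (sphere 0 1 ×ˢ univ) :=
        h5.comp (continuousOn_fst.prodMk (hb.mono fun q hq => ⟨hq.1, mem_univ _⟩))
          fun q hq => ⟨hsub hq.1, (s _).2⟩
      obtain ⟨G, hG, hGs⟩ := exists_extension_of_sphere _ hb'
      refine ⟨fun y => if h : y ∈ RelCWComplex.openCell n c then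
        ⟨Θ ((RelCWComplex.map n c).symm y, G ((RelCWComplex.map n c).symm y, ())), by
          obtain ⟨h6, h7⟩ := mem_openCell_symm h
          rw [h2 _ (ball_subset_closedBall h6), h7]⟩ else s y, fun y hy => dif_neg hy, ?_⟩
      have hcont : ContinuousOn (fun z => Θ (z, G (z, ()))) (closedBall 0 1) :=
        h1.comp (continuousOn_id.prodMk (hG.comp (by fun_prop)).continuousOn)
          fun z hz => ⟨hz, mem_univ _⟩
      refine hcont.congr fun z hz => ?_
      rcases map_mem_openCell_or n c hz with ⟨h6, h7⟩ | ⟨h6, h7⟩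
      · simp only [dif_pos h6]
        rw [h7]
      · simp only [dif_neg h6]
        rw [hGs z h7, h4 z hz _ (s _).2])
    (fun y => ⟨(hne y).choose, (hne y).choose_spec⟩)
  exact ⟨fun y => (s y).1, fun y => (s y).2, hs⟩

omit [T2Space X'] in
/-- The fibres over a CW complex contract onto a section. -/
theorem exists_contraction {sec : Y → R.Cover} (hsec : ∀ y, fst (sec y) = f y)
    (hsecc : ∀ n (c : RelCWComplex.cell (univ : Set Y) n),
      ContinuousOn (fun z => sec (RelCWComplex.map n c z)) (closedBall 0 1)) :
    ∃ Γ : Y × (R.Cover × ℝ) → R.Cover,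
      (∀ y d, fst d = f y → Γ (y, d, -1) = d ∧ Γ (y, d, 1) = sec y) ∧
      ∀ n (c : RelCWComplex.cell (univ : Set Y) n),
        ContinuousOn (fun q : (Fin n → ℝ) × (R.Cover × ℝ) => Γ (RelCWComplex.map n c q.1, q.2))
          {q | q.1 ∈ closedBall 0 1 ∧ (RelCWComplex.map n c q.1, q.2) ∈
            {r : Y × (R.Cover × ℝ) | fst r.2.1 = f r.1 ∧ r.2.2 ∈ Icc (-1) 1}} := by
  classical
  let A : Set (Y × (R.Cover × ℝ)) := {r | fst r.2.1 = f r.1 ∧ r.2.2 ∈ Icc (-1) 1}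
  have hA : IsClosed A := by
    refine (isClosed_eq (continuous_fst.comp (by fun_prop)) (by fun_prop)).inter ?_
    exact isClosed_Icc.preimage (by fun_prop)
  obtain ⟨s, hs⟩ := exists_good_on_cells
    (Φ := fun y => {Γ : R.Cover × ℝ → R.Cover // ∀ d, fst d = f y →
      (∀ t, fst (Γ (d, t)) = f y) ∧ Γ (d, -1) = d ∧ Γ (d, 1) = sec y})
    (fun n c s => ContinuousOn (fun q : (Fin n → ℝ) × (R.Cover × ℝ) =>
      (s (RelCWComplex.map n c q.1)).1 q.2)
        {q | q.1 ∈ closedBall 0 1 ∧ (RelCWComplex.map n c q.1, q.2) ∈ A})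
    (fun n c s s' h hc => hc.congr fun q hq => by
      rw [← h _ (mem_image_of_mem _ hq.1)])
    (fun n c s hs => by
      have hφ : ContinuousOn (fun z => f (RelCWComplex.map n c z)) (closedBall 0 1) :=
        f.continuous.comp_continuousOn (RelCWComplex.continuousOn n c)
      obtain ⟨Θ, ξ, h1, h2, h3, h4, h5⟩ :=
        exists_ball_trivialization (R := R) hX hX' hϖ ε₀ hε₀ hφ
      obtain ⟨F, hF, hFn, hFc⟩ := exists_finite_lower_cells n c
      have hsub : sphere (0 : Fin n → ℝ) 1 ⊆ closedBall 0 1 := sphere_subset_closedBall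
      have hb := continuousOn_of_cells (Z := R.Cover) (S := fun q => (s q.1).1 q.2) hA hF
        (fun d hd => hs d.1 (hFn d hd) d.2)
        isClosed_sphere ((RelCWComplex.continuousOn n c).mono hsub) hFc
      -- The contraction over a cell is an extension problem on the prism (ball) × `[-1, 1]`,
      -- parametrized by the fibre point in `E`. In the sup norm this prism is the unit ball of
      -- `(Fin n → ℝ) × ℝ`, which is why time runs over `[-1, 1]`. The boundary values are `f₁` on
      -- the sides (the contraction on lower cells), the identity at the bottom `-1`, and `f₂` (the
      -- section) at the top `1`.
      let f₁ : ((Fin n → ℝ) × ℝ) × E → E := fun q =>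
        ξ (q.1.1, (s (RelCWComplex.map n c q.1.1)).1 (Θ (q.1.1, q.2), q.1.2))
      let f₂ : ((Fin n → ℝ) × ℝ) × E → E := fun q =>
        ξ (q.1.1, sec (RelCWComplex.map n c q.1.1))
      let f₀ : ((Fin n → ℝ) × ℝ) × E → E := fun q =>
        if q.1.2 = -1 then q.2 else if q.1.2 = 1 then f₂ q else f₁ q
      have hmem : ∀ q : ((Fin n → ℝ) × ℝ) × E, q.1 ∈ closedBall 0 1 ↔
          q.1.1 ∈ closedBall 0 1 ∧ q.1.2 ∈ Icc (-1) 1 := by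
        rintro ⟨⟨z, t⟩, ε⟩
        simp [Prod.norm_def, abs_le]
      let B₁ : Set (((Fin n → ℝ) × ℝ) × E) := {q | q.1 ∈ closedBall 0 1 ∧ q.1.1 ∈ sphere 0 1}
      let B₂ : Set (((Fin n → ℝ) × ℝ) × E) := {q | q.1 ∈ closedBall 0 1 ∧ q.1.2 = -1}
      let B₃ : Set (((Fin n → ℝ) × ℝ) × E) := {q | q.1 ∈ closedBall 0 1 ∧ q.1.2 = 1}
      have hB : IsClosed {q : ((Fin n → ℝ) × ℝ) × E | q.1 ∈ closedBall 0 1} :=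
        isClosed_closedBall.preimage (by fun_prop)
      have hB₁ : IsClosed B₁ := hB.inter
        (isClosed_sphere.preimage (f := fun q : ((Fin n → ℝ) × ℝ) × E => q.1.1) (by fun_prop))
      have hB₂ : IsClosed B₂ := hB.inter (isClosed_eq (by fun_prop) (by fun_prop))
      have hB₃ : IsClosed B₃ := hB.inter (isClosed_eq (by fun_prop) (by fun_prop))
      have hf₁ : ContinuousOn f₁ B₁ := by
        have hθ : ContinuousOn (fun q : ((Fin n → ℝ) × ℝ) × E => Θ (q.1.1, q.2)) B₁ :=
          h1.comp (by fun_prop) fun q hq => ⟨hsub hq.2, mem_univ _⟩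
        refine h5.comp (ContinuousOn.prodMk (by fun_prop) (hb.comp
          (ContinuousOn.prodMk (f := fun q : ((Fin n → ℝ) × ℝ) × E => q.1.1) (by fun_prop)
            (hθ.prodMk (by fun_prop))) ?_)) ?_
        · intro q hq
          exact ⟨hq.2, h2 _ (hsub hq.2) _, ((hmem q).1 hq.1).2⟩
        · intro q hq
          exact ⟨hsub hq.2, ((s _).2 _ (h2 _ (hsub hq.2) _)).1 _⟩
      have hf₂ : ContinuousOn f₂ B₃ := by
        refine h5.comp (ContinuousOn.prodMk (by fun_prop) ((hsecc n c).comp (by fun_prop) ?_)) ?_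
        · intro q hq
          exact ((hmem q).1 hq.1).1
        · intro q hq
          exact ⟨((hmem q).1 hq.1).1, hsec _⟩
      -- At the edges the prescriptions agree, because the contraction on lower cells already starts
      -- at the identity and ends at the section.
      have hf₀₁ : EqOn f₀ f₁ B₁ := by
        rintro ⟨⟨z, t⟩, ε⟩ hq
        have hz : z ∈ closedBall (0 : Fin n → ℝ) 1 := hsub hq.2
        have h6 := ((s (RelCWComplex.map n c z)).2 _ (h2 z hz ε)).2
        by_cases ht : t = -1
        · subst ht
          simp only [f₀, f₁, if_pos, h6.1, h3 z hz]
        · by_cases ht' : t = 1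
          · subst ht'
            simp only [f₀, f₁, f₂, if_neg ht, if_pos, h6.2]
          · simp only [f₀, if_neg ht, if_neg ht']
      have hf₀ : ContinuousOn f₀ (sphere 0 1 ×ˢ univ) := by
        have h6 : ContinuousOn f₀ ((B₁ ∪ B₂) ∪ B₃) := by
          refine ContinuousOn.union_of_isClosed (ContinuousOn.union_of_isClosed
            (hf₁.congr hf₀₁) ?_ hB₁ hB₂) ?_ (hB₁.union hB₂) hB₃
          · exact continuousOn_snd.congr fun q hq => if_pos hq.2
          · refine hf₂.congr fun q hq => ?_
            have : q.1.2 = 1 := hq.2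
            simp only [f₀, this]
            norm_num
        refine h6.mono ?_
        rintro ⟨⟨z, t⟩, ε⟩ ⟨hq, -⟩
        have hq' : ((z, t) : (Fin n → ℝ) × ℝ) ∈ closedBall 0 1 := sphere_subset_closedBall hq
        have h7 : max ‖z‖ |t| = 1 := by
          simpa [Prod.norm_def] using hq
        rcases max_choice ‖z‖ |t| with h8 | h8
        · rw [h8] at h7
          exact Or.inl (Or.inl ⟨hq', by simpa using h7⟩)
        · rw [h8] at h7
          rcases (abs_eq zero_le_one).1 h7 with h9 | h9
          · exact Or.inr ⟨hq', h9⟩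
          · exact Or.inl (Or.inr ⟨hq', h9⟩)
      obtain ⟨G, hG, hGs⟩ := exists_extension_of_sphere f₀ hf₀
      have hm1 : ∀ z ∈ closedBall (0 : Fin n → ℝ) 1, ∀ t : ℝ, |t| = 1 →
          ((z, t) : (Fin n → ℝ) × ℝ) ∈ sphere 0 1 := by
        intro z hz t ht
        have : ‖z‖ ≤ 1 := by simpa using hz
        simp [Prod.norm_def, ht, this]
      refine ⟨fun y => if h : y ∈ RelCWComplex.openCell n c then
        ⟨fun q => Θ ((RelCWComplex.map n c).symm y,
          G (((RelCWComplex.map n c).symm y, q.2), ξ ((RelCWComplex.map n c).symm y, q.1))), by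
          obtain ⟨h6, h7⟩ := mem_openCell_symm h
          have h6' := ball_subset_closedBall h6
          intro d hd
          rw [← h7] at hd
          refine ⟨fun t => by rw [h2 _ h6', h7], ?_, ?_⟩
          · dsimp only
            rw [hGs _ (hm1 _ h6' _ (by simp)), ← h4 _ h6' d hd]
            simp only [f₀, if_pos, h3 _ h6']
          · dsimp only
            rw [hGs _ (hm1 _ h6' _ (by simp))]
            have : (1 : ℝ) ≠ -1 := by norm_num
            simp only [f₀, f₂, if_neg this, if_pos]
            rw [h4 _ h6' _ (hsec _), h7]⟩ else s y,
        fun y hy => dif_neg hy, ?_⟩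
      have hcont : ContinuousOn (fun q : (Fin n → ℝ) × (R.Cover × ℝ) =>
          Θ (q.1, G ((q.1, q.2.2), ξ (q.1, q.2.1))))
          {q | q.1 ∈ closedBall 0 1 ∧ (RelCWComplex.map n c q.1, q.2) ∈ A} := by
        refine h1.comp (ContinuousOn.prodMk (by fun_prop) (hG.comp_continuousOn
          (ContinuousOn.prodMk (by fun_prop) (h5.comp (by fun_prop) ?_)))) ?_
        · intro q hq
          exact ⟨hq.1, hq.2.1⟩
        · intro q hq
          exact ⟨hq.1, mem_univ _⟩
      refine hcont.congr ?_
      rintro ⟨z, d, t⟩ ⟨hz, hd, ht⟩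
      rcases map_mem_openCell_or n c hz with ⟨h6, h7⟩ | ⟨h6, h7⟩
      · simp only [dif_pos h6]
        rw [h7]
      · simp only [dif_neg h6]
        have hzt : ((z, t) : (Fin n → ℝ) × ℝ) ∈ closedBall 0 1 :=
          (hmem ((z, t), ε₀)).2 ⟨hz, ht⟩
        have hzs : ((z, t) : (Fin n → ℝ) × ℝ) ∈ sphere 0 1 := by
          have h8 : ‖z‖ = 1 := by simpa using h7
          have h9 : |t| ≤ 1 := abs_le.2 ht
          simp [Prod.norm_def, h8, h9]
        rw [hGs _ hzs, hf₀₁ (show ((z, t), ξ (z, d)) ∈ B₁ from ⟨hzt, h7⟩)]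
        simp only [f₁]
        rw [h4 z hz d hd, h4 z hz _ (((s _).2 d hd).1 t)])
    -- The initial data only needs the correct end values in each fibre; its jump at time `1` is
    -- harmless, since every open cell is overwritten.
    (fun y => ⟨fun q => if q.2 = 1 then sec y else q.1, fun d hd => ⟨fun t => by
      dsimp only
      split_ifs
      · exact hsec y
      · exact hd, by
        dsimp only
        rw [if_neg]
        norm_num, by simp⟩⟩)
  exact ⟨fun q => (s q.1).1 q.2, fun y d hd => ((s y).2 d hd).2, hs⟩

omit [T2Space Y] [CWComplex (univ : Set Y)] in
/-- The projection to a space of the homotopy type of a CW complex is a homotopy equivalence if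
the other space has a contractible covering space. -/
theorem isHomotopyEquiv_fst [CompactlyCoherentSpace X] (hcw : HasCWHomotopyType X) :
    IsHomotopyEquiv (⟨fst, continuous_fst⟩ : C(R.Cover, X)) := by
  obtain ⟨Y, _, _, ⟨_⟩, ⟨w⟩⟩ := hcw
  obtain ⟨sec, hsec, hsecc⟩ := exists_section (R := R) hX hX' hϖ ε₀ hε₀ w.invFun
  obtain ⟨Γ, hΓ, hΓc⟩ := exists_contraction hX hX' hϖ ε₀ hε₀ w.invFun hsec hsecc
  have hlh := isLocalHomeomorph_proj (R := R) hX hX'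
  have : LocallyPathConnectedSpace R.Cover := hlh.locallyPathConnectedSpace
  have : CompactlyCoherentSpace R.Cover := hlh.compactlyCoherentSpace
  have : T2Space R.Cover := t2Space_cover hX hX'
  have hfst : Continuous (fst (R := R)) := continuous_fst
  have hsnd : Continuous (snd (R := R)) := continuous_snd
  -- The homotopy inverse is the section over `Y` composed with `X → Y`. Continuity is tested on
  -- compact sets, whose images in `Y` lie in finitely many cells.
  have hsu : Continuous fun x : X => sec (w.toFun x) := by
    refine continuous_of_continuousOn_isCompact fun L hL => ?_
    have hg : Continuous w.toFun := w.toFun.continuous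
    obtain ⟨F, hF, hFc⟩ := IsCompact.exists_finite_cells (hL.image hg)
    have := continuousOn_of_cells (P := Unit) (S := fun q => sec q.1) (A := univ) isClosed_univ hF
      (fun c _ => (hsecc c.1 c.2).comp (by fun_prop) fun q hq => hq.1) hL.isClosed hg.continuousOn
      fun t ht => hFc (mem_image_of_mem _ ht)
    exact this.comp (f := fun d => (d, ())) (by fun_prop) fun d hd => ⟨hd, mem_univ _⟩
  obtain ⟨G⟩ := w.left_inv.symm
  let h : C(I × R.Cover, X) := ⟨fun q => G (q.1, fst q.2), by fun_prop⟩
  let h' : C(I × R.Cover, X') := ⟨fun q => snd q.2, by fun_prop⟩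
  -- Lifting the homotopy from the identity of `X` to `w.invFun ∘ w.toFun` moves `d` into the fibre
  -- indexed by the point `w.toFun (fst d)` of `Y`, where `Γ` contracts it onto the section.
  obtain ⟨H, hH, -, hH0⟩ := exists_homotopy_lift hX hX' (ContinuousMap.id R.Cover) h h'
    (continuous_mk_comp (by fun_prop)) (fun d => by simp [h]) (fun d => rfl)
  have hH1 : ∀ d, fst (H (1, d)) = w.invFun (w.toFun (fst d)) := fun d => by
    rw [hH]
    simp [h]
  have hK : Continuous fun q : I × R.Cover =>
      Γ (w.toFun (fst q.2), H (1, q.2), 2 * (q.1 : ℝ) - 1) := by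
    refine continuous_of_continuousOn_isCompact fun L hL => ?_
    have hg : Continuous fun q : I × R.Cover => w.toFun (fst q.2) := by fun_prop
    obtain ⟨F, hF, hFc⟩ := IsCompact.exists_finite_cells (hL.image hg)
    have hA : IsClosed {r : Y × (R.Cover × ℝ) | fst r.2.1 = w.invFun r.1 ∧
        r.2.2 ∈ Icc (-1) 1} := by
      refine (isClosed_eq (hfst.comp (by fun_prop)) (by fun_prop)).inter ?_
      exact isClosed_Icc.preimage (by fun_prop)
    have := continuousOn_of_cells hA hF (fun c _ => hΓc c.1 c.2) hL.isClosed hg.continuousOn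
      fun t ht => hFc (mem_image_of_mem _ ht)
    refine this.comp (f := fun q : I × R.Cover => (q, H (1, q.2), 2 * (q.1 : ℝ) - 1))
      (by fun_prop) fun q hq => ⟨hq, hH1 _, ?_, ?_⟩
    · have := q.1.2.1
      dsimp only
      linarith
    · have := q.1.2.2
      dsimp only
      linarith
  refine ⟨⟨_, hsu⟩, ?_, ?_⟩
  · have h1 : (ContinuousMap.id R.Cover).Homotopic ⟨fun d => H (1, d), by fun_prop⟩ :=
      ⟨⟨H, hH0, fun _ => rfl⟩⟩
    have h2 : (⟨fun d => H (1, d), by fun_prop⟩ : C(R.Cover, R.Cover)).Homotopic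
        ((⟨_, hsu⟩ : C(X, R.Cover)).comp ⟨fst, continuous_fst⟩) := by
      refine ⟨⟨⟨_, hK⟩, fun d => ?_, fun d => ?_⟩⟩
      · have := (hΓ (w.toFun (fst d)) (H (1, d)) (hH1 d)).1
        simpa using this
      · have := (hΓ (w.toFun (fst d)) (H (1, d)) (hH1 d)).2
        norm_num
        exact this
    exact (h1.trans h2).symm
  · have : (⟨fst, continuous_fst⟩ : C(R.Cover, X)).comp ⟨_, hsu⟩ = w.invFun.comp w.toFun := by
      ext x
      exact hsec _
    rw [this]
    exact w.left_inv

end LoopCorrespondence.Cover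

end CellularMethods

/-! ## The space of ordered little intervals -/

theorem convex_isIntervals (k : ℕ) : Convex ℝ {c : (Fin k → ℝ) × (Fin k → ℝ) | IsIntervals c} := by
  rintro c hc c' hc' a b ha hb hab
  refine ⟨fun i => ?_, fun i j hij => ?_⟩
  · obtain ⟨h1, h2, h3⟩ := hc.1 i
    obtain ⟨h4, h5, h6⟩ := hc'.1 i
    simp only [Prod.fst_add, Prod.smul_fst, Prod.snd_add, Prod.smul_snd, Pi.add_apply,
      Pi.smul_apply, smul_eq_mul]
    refine ⟨by positivity, ?_, by nlinarith⟩
    rcases eq_or_lt_of_le ha with h | h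
    · subst h
      obtain rfl : b = 1 := by linarith
      linarith
    · nlinarith
  · have h1 := hc.2 i j hij
    have h2 := hc'.2 i j hij
    simp only [Prod.fst_add, Prod.smul_fst, Prod.snd_add, Prod.smul_snd, Pi.add_apply,
      Pi.smul_apply, smul_eq_mul]
    nlinarith

namespace Intervals

instance (k : ℕ) : ContractibleSpace (Intervals k) :=
  (convex_isIntervals k).contractibleSpace ⟨_, (base k).2⟩

instance (k : ℕ) : LocallyPathConnectedSpace (Intervals k) :=
  (convex_isIntervals k).locallyPathConnectedSpace

instance (k : ℕ) : CompactlyCoherentSpace (Intervals k) :=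
  inferInstanceAs (CompactlyCoherentSpace {c : (Fin k → ℝ) × (Fin k → ℝ) // IsIntervals c})

theorem ext {k : ℕ} {a b : Intervals k} (h : ∀ i, a.1.1 i = b.1.1 i)
    (h' : ∀ i, a.1.2 i = b.1.2 i) : a = b :=
  Subtype.ext (Prod.ext (funext h) (funext h'))

theorem comp_block {k n : ℕ} (m : Fin k → ℕ) (h : ∑ i, m i = n) (a : Intervals k)
    (b : ∀ i, Intervals (m i)) (i : Fin k) (l : Fin (m i)) :
    (comp m h a b).1.1 (block m h ⟨i, l⟩) = a.1.1 i + (a.1.2 i - a.1.1 i) * (b i).1.1 l ∧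
    (comp m h a b).1.2 (block m h ⟨i, l⟩) = a.1.1 i + (a.1.2 i - a.1.1 i) * (b i).1.2 l := by
  simp only [comp]
  have := (block m h).symm_apply_apply ⟨i, l⟩
  generalize (block m h).symm (block m h ⟨i, l⟩) = y at this
  subst this
  exact ⟨rfl, rfl⟩

theorem continuous_comp {k n : ℕ} (m : Fin k → ℕ) (h : ∑ i, m i = n) :
    Continuous fun p : Intervals k × (∀ i, Intervals (m i)) => comp m h p.1 p.2 := by
  refine Continuous.subtype_mk ?_ _
  have h1 : Continuous fun p : Intervals k × (∀ i, Intervals (m i)) => p.1.1 :=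
    continuous_subtype_val.comp continuous_fst
  have h2 : ∀ i, Continuous fun p : Intervals k × (∀ i, Intervals (m i)) => (p.2 i).1 := fun i =>
    continuous_subtype_val.comp (by fun_prop)
  refine Continuous.prodMk ?_ ?_ <;>
  · refine continuous_pi fun p => ?_
    have := h2 ((block m h).symm p).1
    fun_prop

end Intervals

theorem block_val {k n : ℕ} (m : Fin k → ℕ) (h : ∑ i, m i = n) (i : Fin k) (l : Fin (m i)) :
    (block m h ⟨i, l⟩ : ℕ) = (∑ j, if j < i then m j else 0) + l := by
  rw [block_apply_val]
  congr 1
  rw [← Finset.sum_filter]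
  refine Finset.sum_bij (fun (j : Fin i) _ => Fin.castLE i.2.le j) ?_ ?_ ?_ ?_
  · intro j _
    rw [Finset.mem_filter]
    exact ⟨Finset.mem_univ _, j.2⟩
  · intro j _ j' _ hj
    simpa using hj
  · intro j hj
    simp only [Finset.mem_filter, Finset.mem_univ, true_and] at hj
    exact ⟨⟨j, hj⟩, Finset.mem_univ _, rfl⟩
  · intro j _
    rfl

theorem block_lt_block_iff {k n : ℕ} (m : Fin k → ℕ) (h : ∑ i, m i = n) (i j : Fin k)
    (l : Fin (m i)) (r : Fin (m j)) :
    block m h ⟨i, l⟩ < block m h ⟨j, r⟩ ↔ i < j ∨ i = j ∧ (l : ℕ) < r := by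
  rcases lt_trichotomy i j with hij | rfl | hij
  · simp [hij, block_lt_of_fst_lt m h ⟨i, l⟩ ⟨j, r⟩ hij]
  · rw [Fin.lt_def, block_val, block_val]
    simp
  · have := block_lt_of_fst_lt m h ⟨j, r⟩ ⟨i, l⟩ hij
    simp [hij.not_gt, hij.ne', this.le]

/-- Both positions count what precedes: all earlier outer blocks, then the earlier inner blocks of
the same outer block, then `l`. The left side counts the first two kinds in a single sum. -/
theorem block_block {k M N : ℕ} (m : Fin k → ℕ) (h : ∑ i, m i = M) (q : Fin M → ℕ)
    (hq : ∑ j, q j = N) (i : Fin k) (r : Fin (m i)) (l : Fin (q (block m h ⟨i, r⟩))) :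
    block q hq ⟨block m h ⟨i, r⟩, l⟩ =
      block (fun i => ∑ l, q (block m h ⟨i, l⟩)) (sum_block m h q hq)
        ⟨i, block (fun l => q (block m h ⟨i, l⟩)) rfl ⟨r, l⟩⟩ := by
  apply Fin.ext
  rw [block_val, block_val, block_val, ← Equiv.sum_comp (block m h), Fintype.sum_sigma,
    ← Nat.add_assoc]
  congr 1
  have : ∀ i', (∑ l', if block m h ⟨i', l'⟩ < block m h ⟨i, r⟩ then q (block m h ⟨i', l'⟩) else 0) =
      (if i' < i then ∑ l', q (block m h ⟨i', l'⟩) else 0) +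
        if i' = i then ∑ l' : Fin (m i'), if (l' : ℕ) < r then q (block m h ⟨i', l'⟩) else 0
          else 0 := by
    intro i'
    simp only [block_lt_block_iff]
    rcases lt_trichotomy i' i with hi | rfl | hi
    · simp [hi, hi.ne]
    · simp
    · simp [hi.not_gt, hi.ne']
  rw [Finset.sum_congr rfl fun i' _ => this i', Finset.sum_add_distrib]
  simp

namespace Intervals

theorem comp_assoc {k M N : ℕ} (m : Fin k → ℕ) (h : ∑ i, m i = M) (q : Fin M → ℕ)
    (hq : ∑ j, q j = N) (a : Intervals k) (b : ∀ i, Intervals (m i)) (c : ∀ j, Intervals (q j)) :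
    comp q hq (comp m h a b) c =
      comp (fun i => ∑ l, q (block m h ⟨i, l⟩)) (sum_block m h q hq) a
        (fun i => comp (fun l => q (block m h ⟨i, l⟩)) rfl (b i)
          (fun l => c (block m h ⟨i, l⟩))) := by
  have key : ∀ p, (comp q hq (comp m h a b) c).1.1 p =
      (comp (fun i => ∑ l, q (block m h ⟨i, l⟩)) (sum_block m h q hq) a
        (fun i => comp (fun l => q (block m h ⟨i, l⟩)) rfl (b i)
          (fun l => c (block m h ⟨i, l⟩)))).1.1 p ∧ (comp q hq (comp m h a b) c).1.2 p =
      (comp (fun i => ∑ l, q (block m h ⟨i, l⟩)) (sum_block m h q hq) a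
        (fun i => comp (fun l => q (block m h ⟨i, l⟩)) rfl (b i)
          (fun l => c (block m h ⟨i, l⟩)))).1.2 p := by
    intro p
    obtain ⟨⟨j, l⟩, rfl⟩ := (block q hq).surjective p
    obtain ⟨⟨i, r⟩, rfl⟩ := (block m h).surjective j
    rw [(comp_block q hq _ c _ l).1, (comp_block q hq _ c _ l).2, (comp_block m h a b i r).1,
      (comp_block m h a b i r).2, block_block]
    rw [(comp_block _ (sum_block m h q hq) a _ i _).1, (comp_block _ (sum_block m h q hq) a _ i _).2,
      (comp_block _ rfl (b i) (fun l => c (block m h ⟨i, l⟩)) r l).1,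
      (comp_block _ rfl (b i) (fun l => c (block m h ⟨i, l⟩)) r l).2]
    constructor <;> ring
  exact ext (fun p => (key p).1) fun p => (key p).2

theorem base_one_comp {n : ℕ} (h : ∑ _ : Fin 1, n = n) (a : Intervals n) :
    comp (fun _ => n) h (base 1) (fun _ => a) = a := by
  have hb : ∀ l : Fin n, block (fun _ : Fin 1 => n) h ⟨0, l⟩ = l := by
    intro l
    apply Fin.ext
    rw [block_val]
    simp
  refine ext (fun l => ?_) fun l => ?_
  · rw [← hb l, (comp_block (fun _ => n) h (base 1) (fun _ => a) 0 l).1, hb]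
    simp [base]
  · rw [← hb l, (comp_block (fun _ => n) h (base 1) (fun _ => a) 0 l).2, hb]
    simp [base]

theorem comp_base_one {n : ℕ} (h : ∑ _ : Fin n, 1 = n) (a : Intervals n) :
    comp (fun _ => 1) h a (fun _ => base 1) = a := by
  have hb : ∀ l : Fin n, block (fun _ : Fin n => 1) h ⟨l, 0⟩ = l := by
    intro l
    apply Fin.ext
    rw [block_val, ← Finset.sum_filter, Finset.sum_const, smul_eq_mul, mul_one,
      Finset.filter_gt_eq_Iio, Fin.card_Iio]
    rfl
  refine ext (fun l => ?_) fun l => ?_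
  · rw [← hb l, (comp_block (fun _ => 1) h a (fun _ => base 1) l 0).1, hb]
    simp [base]
  · rw [← hb l, (comp_block (fun _ => 1) h a (fun _ => base 1) l 0).2, hb]
    simp [base]

end Intervals

/-! ## Homotopy classes of paths with arbitrary end points -/

section Arrow

variable {X Y : Type*} [TopologicalSpace X] [TopologicalSpace Y]

/-- A homotopy class of paths together with its end points. -/
def arrow {x y : X} (p : PHQ x y) : Σ q : X × X, PHQ q.1 q.2 := ⟨(x, y), p⟩

/-- The operad axioms identify end points only propositionally. Comparing classes as `arrow`s makes
casts disappear, and nothing is lost when the end points are fixed. -/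
theorem arrow_inj {x y : X} {p q : PHQ x y} : arrow p = arrow q ↔ p = q :=
  ⟨fun h => eq_of_heq (Sigma.mk.inj h).2, fun h => h ▸ rfl⟩

@[simp] theorem arrow_cast {x y x' y' : X} (p : PHQ x y) (h : x' = x) (h' : y' = y) :
    arrow (p.cast h h') = arrow p := by
  subst h h'
  simp

theorem arrow_mk_congr {x y x' y' : X} {p : Path x y} {q : Path x' y'} (h : ∀ t, p t = q t) :
    arrow (.mk p) = arrow (.mk q) := by
  obtain rfl : x = x' := by rw [← p.source, h, q.source]
  obtain rfl : y = y' := by rw [← p.target, h, q.target]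
  obtain rfl : p = q := Path.ext (funext h)
  rfl

theorem arrow_trans_congr {x y z x' y' z' : X} {p : PHQ x y} {q : PHQ y z} {p' : PHQ x' y'}
    {q' : PHQ y' z'} (h : arrow p = arrow p') (h' : arrow q = arrow q') :
    arrow (p.trans q) = arrow (p'.trans q') := by
  obtain ⟨h1, h2⟩ := Sigma.mk.inj h
  obtain ⟨h3, h4⟩ := Sigma.mk.inj h'
  obtain ⟨rfl, rfl⟩ := Prod.mk.inj h1
  obtain ⟨-, rfl⟩ := Prod.mk.inj h3
  rw [eq_of_heq h2, eq_of_heq h4]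

theorem arrow_map_congr {x y x' y' : X} {p : PHQ x y} {p' : PHQ x' y'} (f : C(X, Y))
    (h : arrow p = arrow p') : arrow (p.map f) = arrow (p'.map f) := by
  obtain ⟨h1, h2⟩ := Sigma.mk.inj h
  obtain ⟨rfl, rfl⟩ := Prod.mk.inj h1
  rw [eq_of_heq h2]

theorem quotient_symm_trans_cancel_left {x y z : X} (p : PHQ x y) (q : PHQ y z) :
    p.symm.trans (p.trans q) = q := by
  rw [← Path.Homotopic.Quotient.trans_assoc, Path.Homotopic.Quotient.symm_trans,
    Path.Homotopic.Quotient.refl_trans]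

theorem arrow_refl_congr {x x' : X} (h : x = x') :
    arrow (.refl x) = arrow (Path.Homotopic.Quotient.refl x') := by
  rw [h]

/-- Applied to `η` on the contractible spaces of intervals, this settles every coherence question
about connecting paths: only their end points matter. -/
theorem arrow_map_congr_of_subsingleton [SimplyConnectedSpace X] {x y x' y' : X} (p : PHQ x y)
    (p' : PHQ x' y') (f : C(X, Y)) (h : x = x') (h' : y = y') :
    arrow (p.map f) = arrow (p'.map f) := by
  subst h h'
  rw [Subsingleton.elim p p']

theorem BasedPath.ext_arrow {X : Type u} [TopologicalSpace X] {e : X} {P Q : BasedPath e} (h : arrow P.2 = arrow Q.2) : P = Q := by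
  obtain ⟨x, p⟩ := P
  obtain ⟨y, q⟩ := Q
  obtain ⟨h1, h2⟩ := Sigma.mk.inj h
  obtain rfl : x = y := (Prod.mk.inj h1).2
  obtain rfl : p = q := eq_of_heq h2
  rfl

/-- Prolongation of a based path. -/
def BasedPath.extend {X : Type u} [TopologicalSpace X] {e : X} (P : BasedPath e) {y : X} (p : PHQ P.1 y) : BasedPath e :=
  ⟨y, P.2.trans p⟩

end Arrow

/-! ### Operadic composition of homotopy classes of paths -/

section Operad

variable {𝒢 : GroupOperad.{v}} {C : WellPointedGOperad.{u, v} 𝒢}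

theorem arrow_translate_congr {n : ℕ} (g : 𝒢.G n) {x y x' y' : C.space n} {p : PHQ x y}
    {p' : PHQ x' y'} (h : arrow p = arrow p') : arrow (translate g p) = arrow (translate g p') :=
  arrow_map_congr _ h

theorem arrow_translate_mul {n : ℕ} (g h : 𝒢.G n) {x y : C.space n} (p : PHQ x y) :
    arrow (translate (g * h) p) = arrow (translate g (translate h p)) := by
  rw [translate_mul, arrow_cast]

theorem arrow_translate_one {n : ℕ} {x y : C.space n} (p : PHQ x y) :
    arrow (translate (1 : 𝒢.G n) p) = arrow p := by
  rw [translate_one, arrow_cast]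

section Comp

variable {k n : ℕ} (m : Fin k → ℕ) (h : ∑ i, m i = n) {a a' a'' : C.space k}
    {b b' b'' : ∀ i, C.space (m i)}

theorem arrow_compClass_congr {f : PHQ a a'} {g : ∀ i, PHQ (b i) (b' i)} {c c' : C.space k}
    {d d' : ∀ i, C.space (m i)} {f' : PHQ c c'} {g' : ∀ i, PHQ (d i) (d' i)}
    (hf : arrow f = arrow f') (hg : ∀ i, arrow (g i) = arrow (g' i)) :
    arrow (compClass m h f g) = arrow (compClass m h f' g') := by
  obtain ⟨h1, h2⟩ := Sigma.mk.inj hf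
  obtain ⟨rfl, rfl⟩ := Prod.mk.inj h1
  obtain rfl : b = d := funext fun i => (Prod.mk.inj (Sigma.mk.inj (hg i)).1).1
  obtain rfl : b' = d' := funext fun i => (Prod.mk.inj (Sigma.mk.inj (hg i)).1).2
  obtain rfl : g = g' := funext fun i => arrow_inj.1 (hg i)
  rw [eq_of_heq h2]

theorem exists_mk_family (g : ∀ i, PHQ (b i) (b' i)) :
    ∃ p : ∀ i, Path (b i) (b' i), g = fun i => .mk (p i) :=
  ⟨fun i => Quotient.out (g i), funext fun i => (Quotient.out_eq (g i)).symm⟩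

/-- The interchange law holds on the level of paths, because all concatenations switch at the same
parameter value. -/
theorem compClass_trans (f : PHQ a a') (f' : PHQ a' a'') (g : ∀ i, PHQ (b i) (b' i))
    (g' : ∀ i, PHQ (b' i) (b'' i)) :
    compClass m h (f.trans f') (fun i => (g i).trans (g' i)) =
      (compClass m h f g).trans (compClass m h f' g') := by
  induction f with | mk f =>
  induction f' with | mk f' =>
  obtain ⟨g, rfl⟩ := exists_mk_family m g
  obtain ⟨g', rfl⟩ := exists_mk_family m g'
  simp only [← Path.Homotopic.Quotient.mk_trans, compClass_mk]
  congr 1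
  ext t
  simp only [compPath, Path.trans_apply, Path.coe_mk_mk]
  split_ifs <;> rfl

theorem compClass_trans_left (f : PHQ a a') (f' : PHQ a' a'') (g : ∀ i, PHQ (b i) (b' i)) :
    compClass m h (f.trans f') g =
      (compClass m h f (fun i => .refl (b i))).trans (compClass m h f' g) := by
  rw [← compClass_trans]
  simp

theorem compClass_trans_right (f : PHQ a a') (g : ∀ i, PHQ (b i) (b' i))
    (g' : ∀ i, PHQ (b' i) (b'' i)) :
    compClass m h f (fun i => (g i).trans (g' i)) =
      (compClass m h (.refl a) g).trans (compClass m h f g') := by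
  rw [← compClass_trans]
  simp

theorem arrow_compClass_translate (s : 𝒢.G k) (τ : ∀ i, 𝒢.G (m i)) (f : PHQ a a')
    (g : ∀ i, PHQ (b i) (b' i)) :
    arrow (compClass m h (translate s f) (fun i => translate (τ i) (g i))) =
      arrow (translate (𝒢.op.comp m h s τ)
        (compClass (fun i => m ((𝒢.perm s).symm i)) (sum_reindex (𝒢.perm s).symm m h) f
          (fun i => g ((𝒢.perm s).symm i)))) := by
  induction f with | mk f =>
  obtain ⟨g, rfl⟩ := exists_mk_family m g
  have h1 : ∀ {N : ℕ} (s : 𝒢.G N) {x y : C.space N} (p : Path x y), translate s (.mk p) =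
    Path.Homotopic.Quotient.mk (p.map (continuous_const_smul s)) := fun _ _ _ _ => rfl
  simp only [compClass_mk, h1]
  exact arrow_mk_congr fun t => C.equivariance m h s τ _ _

theorem arrow_compClass_assoc {N : ℕ} (q : Fin n → ℕ) (hq : ∑ j, q j = N) (f : PHQ a a')
    (g : ∀ i, PHQ (b i) (b' i)) {c c' : ∀ j, C.space (q j)} (r : ∀ j, PHQ (c j) (c' j)) :
    arrow (compClass q hq (compClass m h f g) r) =
      arrow (compClass (fun i => ∑ l, q (block m h ⟨i, l⟩)) (sum_block m h q hq) f
        (fun i => compClass (fun l => q (block m h ⟨i, l⟩)) rfl (g i)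
          (fun l => r (block m h ⟨i, l⟩)))) := by
  induction f with | mk f =>
  obtain ⟨g, rfl⟩ := exists_mk_family m g
  obtain ⟨r, rfl⟩ := exists_mk_family q r
  simp only [compClass_mk]
  exact arrow_mk_congr fun t => C.op.assoc m h q hq _ _ _

end Comp

theorem arrow_compClass_one_left {n : ℕ} (h : ∑ _ : Fin 1, n = n) {x y : C.space n}
    (p : PHQ x y) :
    arrow (compClass (fun _ => n) h (.refl C.op.one) (fun _ => p)) = arrow p := by
  induction p with | mk p =>
  rw [← Path.Homotopic.Quotient.mk_refl, compClass_mk]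
  exact arrow_mk_congr fun t => C.op.one_comp h _

theorem arrow_compClass_one_right {n : ℕ} (h : ∑ _ : Fin n, 1 = n) {x y : C.space n}
    (p : PHQ x y) :
    arrow (compClass (fun _ => 1) h p (fun _ => .refl C.op.one)) = arrow p := by
  induction p with | mk p =>
  simp only [← Path.Homotopic.Quotient.mk_refl, compClass_mk]
  exact arrow_mk_congr fun t => C.op.comp_one h _

/-- By simple connectivity `r` may be replaced by the pointwise composite of the paths in the operad
of intervals, and `η` is a morphism of operads. -/
theorem arrow_compClass_map_eta {k n : ℕ} (m : Fin k → ℕ) (h : ∑ i, m i = n) {a a' : Intervals k}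
    {b b' : ∀ i, Intervals (m i)} (f : PHQ a a') (g : ∀ i, PHQ (b i) (b' i))
    (r : PHQ (Intervals.comp m h a b) (Intervals.comp m h a' b')) :
    arrow (compClass m h (f.map (C.η k)) (fun i => (g i).map (C.η (m i)))) =
      arrow (r.map (C.η n)) := by
  induction f with | mk f =>
  obtain ⟨g, rfl⟩ : ∃ p : ∀ i, Path (b i) (b' i), g = fun i => .mk (p i) :=
    ⟨fun i => Quotient.out (g i), funext fun i => (Quotient.out_eq (g i)).symm⟩
  let r' : Path (Intervals.comp m h a b) (Intervals.comp m h a' b') :=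
    { toFun := fun t => Intervals.comp m h (f t) (fun i => g i t)
      continuous_toFun := (Intervals.continuous_comp m h).comp
        (f := fun t => (f t, fun i => g i t)) (by fun_prop)
      source' := by simp
      target' := by simp }
  rw [Subsingleton.elim r (.mk r')]
  simp only [← Path.Homotopic.Quotient.mk_map, compClass_mk]
  exact arrow_mk_congr fun t => (C.η_comp m h _ _).symm

theorem arrow_mk_basePath {k n : ℕ} (m : Fin k → ℕ) (h : ∑ i, m i = n)
    (r : PHQ (Intervals.base n)
      (Intervals.comp m h (Intervals.base k) (fun i => Intervals.base (m i)))) :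
    arrow (.mk (basePath C m h)) = arrow (r.map (C.η n)) := by
  rw [Subsingleton.elim r (.mk (Intervals.linearPath _ _))]
  exact arrow_mk_congr fun t => rfl

/-! ### Composition of based paths -/

variable (C) in
/-- The path from the basepoint to a point in the image of `η`. -/
def etaPath {k : ℕ} (c : Intervals k) : BasedPath (basepoint C k) :=
  ⟨C.η k c, (Path.Homotopic.Quotient.mk (Intervals.linearPath (Intervals.base k) c)).map (C.η k)⟩

theorem arrow_etaPath {k : ℕ} {c : Intervals k} (r : PHQ (Intervals.base k) c) :
    arrow (etaPath C c).2 = arrow (r.map (C.η k)) := by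
  rw [Subsingleton.elim r (.mk (Intervals.linearPath _ _))]
  rfl

/-- The operadic composition of based paths. -/
def BasedPath.comp {k n : ℕ} (m : Fin k → ℕ) (h : ∑ i, m i = n) (P : BasedPath (basepoint C k))
    (Q : ∀ i, BasedPath (basepoint C (m i))) : BasedPath (basepoint C n) :=
  ⟨C.op.comp m h P.1 (fun i => (Q i).1),
    (Path.Homotopic.Quotient.mk (basePath C m h)).trans
      (compClass m h P.2 (fun i => (Q i).2))⟩

theorem etaPath_comp {k n : ℕ} (m : Fin k → ℕ) (h : ∑ i, m i = n) (a : Intervals k)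
    (b : ∀ i, Intervals (m i)) :
    etaPath C (Intervals.comp m h a b) =
      BasedPath.comp m h (etaPath C a) (fun i => etaPath C (b i)) := by
  let p₁ : PHQ (Intervals.base n)
    (Intervals.comp m h (Intervals.base k) (fun i => Intervals.base (m i))) :=
      .mk (PathConnectedSpace.somePath _ _)
  let p₂ : PHQ (Intervals.comp m h (Intervals.base k) (fun i => Intervals.base (m i)))
    (Intervals.comp m h a b) := .mk (PathConnectedSpace.somePath _ _)
  refine BasedPath.ext_arrow ((arrow_etaPath (p₁.trans p₂)).trans ?_)
  rw [quotient_map_trans]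
  have h₂ := arrow_compClass_map_eta (C := C) m h
    (.mk (Intervals.linearPath (Intervals.base k) a))
    (fun i => .mk (Intervals.linearPath (Intervals.base (m i)) (b i))) p₂
  exact (arrow_trans_congr (q' := p₂.map (C.η n)) (arrow_mk_basePath m h p₁) h₂).symm

theorem arrow_mk_basePath_of_eq {k n : ℕ} (m : Fin k → ℕ) (h : ∑ i, m i = n)
    (hb : Intervals.comp m h (Intervals.base k) (fun i => Intervals.base (m i)) =
      Intervals.base n) :
    arrow (.mk (basePath C m h)) = arrow (Path.Homotopic.Quotient.refl (basepoint C n)) := by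
  rw [arrow_mk_basePath m h (.mk (PathConnectedSpace.somePath _ _))]
  exact arrow_map_congr_of_subsingleton _ (.refl (Intervals.base n)) (C.η n) rfl hb

theorem arrow_etaPath_base_one :
    arrow (etaPath C (Intervals.base 1)).2 = arrow (.refl C.op.one) := by
  rw [arrow_etaPath (.refl _)]
  exact arrow_refl_congr C.η_one

theorem BasedPath.one_comp {n : ℕ} (h : ∑ _ : Fin 1, n = n) (P : BasedPath (basepoint C n)) :
    BasedPath.comp (fun _ => n) h (etaPath C (Intervals.base 1)) (fun _ => P) = P := by
  refine BasedPath.ext_arrow ?_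
  have h' : arrow (compClass (fun _ => n) h (etaPath C (Intervals.base 1)).2 (fun _ => P.2)) =
      arrow P.2 := (arrow_compClass_congr _ h arrow_etaPath_base_one fun _ => rfl).trans
    (arrow_compClass_one_left h _)
  exact (arrow_trans_congr (p' := .refl (basepoint C n)) (q' := P.2)
    (arrow_mk_basePath_of_eq _ h (Intervals.base_one_comp h _)) h').trans
    (congrArg arrow (Path.Homotopic.Quotient.refl_trans _))

theorem BasedPath.comp_one {n : ℕ} (h : ∑ _ : Fin n, 1 = n) (P : BasedPath (basepoint C n)) :
    BasedPath.comp (fun _ => 1) h P (fun _ => etaPath C (Intervals.base 1)) = P := by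
  refine BasedPath.ext_arrow ?_
  have h' : arrow (compClass (fun _ => 1) h P.2 (fun _ => (etaPath C (Intervals.base 1)).2)) =
      arrow P.2 := (arrow_compClass_congr _ h rfl fun _ => arrow_etaPath_base_one).trans
    (arrow_compClass_one_right h _)
  exact (arrow_trans_congr (p' := .refl (basepoint C n)) (q' := P.2)
    (arrow_mk_basePath_of_eq _ h (Intervals.comp_base_one h _)) h').trans
    (congrArg arrow (Path.Homotopic.Quotient.refl_trans _))

theorem BasedPath.comp_assoc {k M N : ℕ} (m : Fin k → ℕ) (h : ∑ i, m i = M) (q : Fin M → ℕ)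
    (hq : ∑ j, q j = N) (P : BasedPath (basepoint C k)) (Q : ∀ i, BasedPath (basepoint C (m i)))
    (S : ∀ j, BasedPath (basepoint C (q j))) :
    BasedPath.comp q hq (BasedPath.comp m h P Q) S =
      BasedPath.comp (fun i => ∑ l, q (block m h ⟨i, l⟩)) (sum_block m h q hq) P
        (fun i => BasedPath.comp (fun l => q (block m h ⟨i, l⟩)) rfl (Q i)
          (fun l => S (block m h ⟨i, l⟩))) := by
  refine BasedPath.ext_arrow ?_
  simp only [BasedPath.comp]
  rw [compClass_trans_left, compClass_trans_right, ← Path.Homotopic.Quotient.trans_assoc,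
    ← Path.Homotopic.Quotient.trans_assoc]
  refine arrow_trans_congr ?_ (arrow_compClass_assoc m h q hq _ _ _)
  let ι : ∀ {n : ℕ} (a b : Intervals n), PHQ a b := fun a b =>
    .mk (PathConnectedSpace.somePath a b)
  -- After the pointwise composite, which is associative, has been split off, each side retains a
  -- connecting path. Both are images under `η` of paths with the same ends, by associativity of the
  -- composition of intervals.
  have h1 : arrow ((Path.Homotopic.Quotient.mk (basePath C q hq)).trans
      (compClass q hq (.mk (basePath C m h)) fun j => .refl (basepoint C (q j)))) = _ :=
    (arrow_trans_congr (arrow_mk_basePath q hq (ι _ _))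
      ((arrow_compClass_congr q hq (arrow_mk_basePath m h (ι _ _)) fun j =>
        congrArg arrow (quotient_map_refl (Intervals.base (q j)) (C.η (q j))).symm).trans
          (arrow_compClass_map_eta q hq _ _ (ι _ _)))).trans
            (congrArg arrow (quotient_map_trans _ _ _).symm)
  have h2 : arrow ((Path.Homotopic.Quotient.mk
      (basePath C (fun i => ∑ l, q (block m h ⟨i, l⟩)) (sum_block m h q hq))).trans
      (compClass _ (sum_block m h q hq) (.refl (basepoint C k))
        fun i => .mk (basePath C (fun l => q (block m h ⟨i, l⟩)) rfl))) = _ :=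
    (arrow_trans_congr (arrow_mk_basePath _ (sum_block m h q hq) (ι _ _))
      ((arrow_compClass_congr _ (sum_block m h q hq)
        (congrArg arrow (quotient_map_refl (Intervals.base k) (C.η k)).symm) fun i =>
          arrow_mk_basePath _ rfl (ι _ _)).trans
          (arrow_compClass_map_eta _ (sum_block m h q hq) _ _ (ι _ _)))).trans
            (congrArg arrow (quotient_map_trans _ _ _).symm)
  exact h1.trans ((arrow_map_congr_of_subsingleton _ _ (C.η N) rfl
    (Intervals.comp_assoc m h q hq _ _ _)).trans h2.symm)

theorem BasedPath.comp_extend {k n : ℕ} (m : Fin k → ℕ) (h : ∑ i, m i = n)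
    (P : BasedPath (basepoint C k)) (Q : ∀ i, BasedPath (basepoint C (m i))) {x : C.space k}
    {y : ∀ i, C.space (m i)} (p : PHQ P.1 x) (q : ∀ i, PHQ (Q i).1 (y i)) :
    BasedPath.comp m h (P.extend p) (fun i => (Q i).extend (q i)) =
      (BasedPath.comp m h P Q).extend (compClass m h p q) := by
  simp only [BasedPath.comp, BasedPath.extend]
  rw [compClass_trans, Path.Homotopic.Quotient.trans_assoc]

/-! ### The action of the fundamental groups -/

instance (k : ℕ) : MulAction (Fundamental C k) (BasedPath (basepoint C k)) where
  smul f P := ⟨f.proj • P.1, f.cls.trans (translate f.proj P.2)⟩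
  one_smul P := by
    refine BasedPath.ext_arrow (Q := P) ?_
    change arrow ((Fundamental.one C k).cls.trans (translate (Fundamental.one C k).proj P.2)) = _
    refine (arrow_trans_congr (p' := .refl (basepoint C k)) (q' := P.2) ?_ ?_).trans
      (congrArg arrow (Path.Homotopic.Quotient.refl_trans _))
    · exact arrow_cast (.refl (basepoint C k)) rfl (one_smul _ _)
    · exact arrow_translate_one _
  mul_smul f g P := by
    refine BasedPath.ext_arrow ?_
    change arrow ((f.cls.trans ((translate f.proj g.cls).cast rfl _)).trans
      (translate (f.proj * g.proj) P.2)) =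
        arrow (f.cls.trans (translate f.proj (g.cls.trans (translate g.proj P.2))))
    rw [translate_trans, ← Path.Homotopic.Quotient.trans_assoc]
    exact arrow_trans_congr (arrow_trans_congr rfl (arrow_cast _ _ _)) (arrow_translate_mul _ _ _)

theorem smul_basedPath {k : ℕ} (f : Fundamental C k) (P : BasedPath (basepoint C k)) :
    f • P = ⟨f.proj • P.1, f.cls.trans (translate f.proj P.2)⟩ := rfl

theorem smul_extend {k : ℕ} (f : Fundamental C k) (P : BasedPath (basepoint C k))
    {x : C.space k} (p : PHQ P.1 x) :
    f • P.extend p = (f • P).extend (translate f.proj p) := by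
  simp only [smul_basedPath, BasedPath.extend, translate_trans,
    Path.Homotopic.Quotient.trans_assoc]

/-- The last segment in the definition of `Fundamental.comp` is the translated reverse of the
connecting path with which the translated composite begins; the two cancel. What remains is the
interchange law and equivariance of `γ`. -/
theorem BasedPath.comp_smul {k n : ℕ} (m : Fin k → ℕ) (h : ∑ i, m i = n) (f : Fundamental C k)
    (g : ∀ i, Fundamental C (m i)) (P : BasedPath (basepoint C k))
    (Q : ∀ i, BasedPath (basepoint C (m i))) :
    BasedPath.comp m h (f • P) (fun i => g i • Q i) =
      Fundamental.comp m h f g • BasedPath.comp (fun i => m ((𝒢.perm f.proj).symm i))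
        (sum_reindex (𝒢.perm f.proj).symm m h) P (fun i => Q ((𝒢.perm f.proj).symm i)) := by
  refine BasedPath.ext_arrow ?_
  simp only [BasedPath.comp, smul_basedPath, Fundamental.comp]
  rw [compClass_trans, translate_trans, Path.Homotopic.Quotient.mk_symm, translate_symm,
    Path.Homotopic.Quotient.trans_assoc _ (translate _ _).symm,
    quotient_symm_trans_cancel_left, ← Path.Homotopic.Quotient.trans_assoc]
  exact arrow_trans_congr (arrow_trans_congr rfl (arrow_cast _ _ _).symm)
    (arrow_compClass_translate m h _ _ _ _)

/-- The element of the fundamental groups operad given by a loop. -/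
def Fundamental.ofLoop {k : ℕ} (a : PHQ (basepoint C k) (basepoint C k)) : Fundamental C k :=
  ⟨1, a.cast rfl (one_smul _ _)⟩

theorem Fundamental.ext_arrow {k : ℕ} {f g : Fundamental C k} (h : f.proj = g.proj)
    (h' : arrow f.cls = arrow g.cls) : f = g := by
  refine Fundamental.ext' h (arrow_inj.1 ?_)
  rw [arrow_cast, h']

theorem Fundamental.ofLoop_injective {k : ℕ} {a b : PHQ (basepoint C k) (basepoint C k)}
    (h : Fundamental.ofLoop a = Fundamental.ofLoop b) : a = b := by
  have h' : ∀ f g : Fundamental C k, f = g → arrow f.cls = arrow g.cls := by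
    rintro f g rfl
    rfl
  have := h' _ _ h
  simp only [Fundamental.ofLoop, arrow_cast] at this
  exact arrow_inj.1 this

/-- So `π₁(C(k))` is the kernel of the projection to `G_k`. An isomorphism over `𝒢` preserves it. -/
theorem Fundamental.exists_ofLoop {k : ℕ} {f : Fundamental C k} (h : f.proj = 1) :
    ∃ a, f = Fundamental.ofLoop a :=
  ⟨f.cls.cast rfl (by rw [h, one_smul]), Fundamental.ext_arrow h (by
    simp only [Fundamental.ofLoop, arrow_cast])⟩

theorem Fundamental.ofLoop_refl (k : ℕ) :
    Fundamental.ofLoop (.refl (basepoint C k)) = 1 := rfl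

theorem Fundamental.mul_proj {k : ℕ} (f g : Fundamental C k) :
    (f * g).proj = f.proj * g.proj := rfl

theorem Fundamental.inv_proj {k : ℕ} (f : Fundamental C k) : f⁻¹.proj = f.proj⁻¹ := rfl

theorem Fundamental.comp_proj {k n : ℕ} (m : Fin k → ℕ) (h : ∑ i, m i = n) (f : Fundamental C k)
    (g : ∀ i, Fundamental C (m i)) : (Fundamental.comp m h f g).proj =
      𝒢.op.comp m h f.proj (fun i => (g i).proj) := rfl

theorem Fundamental.ofLoop_trans {k : ℕ} (a b : PHQ (basepoint C k) (basepoint C k)) :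
    Fundamental.ofLoop (a.trans b) = Fundamental.ofLoop a * Fundamental.ofLoop b := by
  refine Fundamental.ext_arrow (one_mul _).symm ?_
  have ha : arrow a = arrow (Fundamental.ofLoop a).cls := (arrow_cast a rfl (one_smul _ _)).symm
  have hb : arrow b = arrow (Fundamental.ofLoop b).cls := (arrow_cast b rfl (one_smul _ _)).symm
  refine (arrow_cast (a.trans b) rfl (one_smul _ _)).trans (arrow_trans_congr ha ?_)
  exact hb.trans ((arrow_translate_one _).symm.trans (arrow_cast _ _ _).symm)

theorem ofLoop_smul {k : ℕ} (a : PHQ (basepoint C k) (basepoint C k))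
    (P : BasedPath (basepoint C k)) : Fundamental.ofLoop a • P = ⟨P.1, a.trans P.2⟩ := by
  refine BasedPath.ext_arrow ?_
  change arrow ((a.cast rfl (one_smul (𝒢.G k) (basepoint C k))).trans
    (translate (1 : 𝒢.G k) P.2)) = _
  exact arrow_trans_congr (arrow_cast _ _ _) (arrow_translate_one _)

theorem Fundamental.exists_proj_eq {k : ℕ} [PathConnectedSpace (C.space k)] (g : 𝒢.G k) :
    ∃ f : Fundamental C k, f.proj = g :=
  ⟨⟨g, .mk (PathConnectedSpace.somePath _ _)⟩, rfl⟩

end Operad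

/-! ## The operad connecting two operads with isomorphic fundamental groups operads -/

/-- The crossed homomorphism identity at trivial elements makes this composite idempotent, and an
idempotent of a group is trivial. -/
theorem GroupOperad.comp_one_one (𝒢 : GroupOperad.{v}) {k n : ℕ} (m : Fin k → ℕ)
    (h : ∑ i, m i = n) : 𝒢.op.comp m h 1 (fun _ => 1) = 1 := by
  have key : ∀ (s : Equiv.Perm (Fin k)) (_ : s = 1),
      𝒢.op.comp (fun i => m (s.symm i)) (sum_reindex s.symm m h) 1 (fun _ => 1) =
        𝒢.op.comp m h 1 (fun _ => 1) := by
    rintro s rfl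
    rfl
  have h1 := 𝒢.crossed m h 1 1 (fun _ => 1) (fun _ => 1)
  rw [key _ (by simp)] at h1
  simpa using h1

section Operad

variable {𝒢 : GroupOperad.{v}} {C C' : WellPointedGOperad.{u, v} 𝒢}

/-- The permuted block sizes occur in types, so the projection is replaced by a variable `s`. This
lets `C` and `C'` use literally the same permutation for `f` and `φ f`. -/
theorem BasedPath.comp_smul_of_proj_eq {k n : ℕ} (m : Fin k → ℕ) (h : ∑ i, m i = n)
    (f : Fundamental C k) (g : ∀ i, Fundamental C (m i)) (P : BasedPath (basepoint C k))
    (Q : ∀ i, BasedPath (basepoint C (m i))) (s : 𝒢.G k) (hs : f.proj = s) :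
    BasedPath.comp m h (f • P) (fun i => g i • Q i) =
      Fundamental.comp m h f g • BasedPath.comp (fun i => m ((𝒢.perm s).symm i))
        (sum_reindex (𝒢.perm s).symm m h) P (fun i => Q ((𝒢.perm s).symm i)) := by
  subst hs
  exact BasedPath.comp_smul m h f g P Q

theorem BasedPath.comp_perm_one {k n : ℕ} (m : Fin k → ℕ) (h : ∑ i, m i = n)
    (P : BasedPath (basepoint C k)) (Q : ∀ i, BasedPath (basepoint C (m i))) :
    BasedPath.comp (fun i => m ((𝒢.perm (1 : 𝒢.G k)).symm i))
      (sum_reindex (𝒢.perm (1 : 𝒢.G k)).symm m h) P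
        (fun i => Q ((𝒢.perm (1 : 𝒢.G k)).symm i)) = BasedPath.comp m h P Q := by
  have key : ∀ (s : Equiv.Perm (Fin k)) (_ : s = 1),
      BasedPath.comp (fun i => m (s.symm i)) (sum_reindex s.symm m h) P
        (fun i => Q (s.symm i)) = BasedPath.comp m h P Q := by
    rintro s rfl
    rfl
  exact key _ (by simp [GroupOperad.perm])

namespace FundamentalIso

variable (φ : FundamentalIso C C')

theorem exists_ofLoop (n : ℕ) (a : PHQ (basepoint C n) (basepoint C n)) :
    ∃ a' : PHQ (basepoint C' n) (basepoint C' n),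
      φ.toEquiv n (Fundamental.ofLoop a) = Fundamental.ofLoop a' :=
  Fundamental.exists_ofLoop (φ.proj_eq _)

/-- The correspondence between the fundamental groups of `C n` and `C' n`. -/
def correspondence (n : ℕ) : LoopCorrespondence (basepoint C n) (basepoint C' n) where
  rel a a' := φ.toEquiv n (Fundamental.ofLoop a) = Fundamental.ofLoop a'
  rel_refl := by simp [Fundamental.ofLoop_refl]
  rel_trans := by
    intro a a' b b' h h'
    rw [Fundamental.ofLoop_trans, Fundamental.ofLoop_trans, map_mul, h, h']
  rel_symm := by
    intro a a' h
    have hs : ∀ {C : WellPointedGOperad.{u, v} 𝒢} (a : PHQ (basepoint C n) (basepoint C n)),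
        Fundamental.ofLoop a.symm = (Fundamental.ofLoop a)⁻¹ := by
      intro C a
      rw [eq_inv_iff_mul_eq_one, ← Fundamental.ofLoop_trans, Path.Homotopic.Quotient.symm_trans,
        Fundamental.ofLoop_refl]
    rw [hs, hs, map_inv, h]
  exists_right := φ.exists_ofLoop n
  exists_left a' := by
    obtain ⟨a, ha⟩ := Fundamental.exists_ofLoop
      (f := (φ.toEquiv n).symm (Fundamental.ofLoop a')) (by
        rw [← φ.proj_eq, MulEquiv.apply_symm_apply]
        rfl)
    exact ⟨a, by rw [← ha, MulEquiv.apply_symm_apply]⟩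
  unique_right := by
    intro a' h
    rw [Fundamental.ofLoop_refl, map_one, ← Fundamental.ofLoop_refl] at h
    exact (Fundamental.ofLoop_injective h).symm
  unique_left := by
    intro a h
    rw [Fundamental.ofLoop_refl, ← map_one (φ.toEquiv n)] at h
    exact Fundamental.ofLoop_injective ((φ.toEquiv n).injective h)

/-- The spaces of the connecting operad. -/
abbrev CoverSpace (n : ℕ) : Type u := (φ.correspondence n).Cover

/-- The point of the cover given by two based paths. -/
def toCover {n : ℕ} (P : BasedPath (basepoint C n)) (P' : BasedPath (basepoint C' n)) :
    φ.CoverSpace n :=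
  Quotient.mk _ (P, P')

theorem exists_toCover {n : ℕ} (d : φ.CoverSpace n) : ∃ P P', d = φ.toCover P P' := by
  induction d using Quotient.ind with
  | _ P => exact ⟨P.1, P.2, rfl⟩

theorem exists_toCover_family {k : ℕ} {m : Fin k → ℕ} (d : ∀ i, φ.CoverSpace (m i)) :
    ∃ (P : ∀ i, BasedPath (basepoint C (m i))) (P' : ∀ i, BasedPath (basepoint C' (m i))),
      d = fun i => φ.toCover (P i) (P' i) := by
  choose P P' h using fun i => φ.exists_toCover (d i)
  exact ⟨P, P', funext h⟩

theorem toCover_eq_toCover_iff {n : ℕ} {P Q : BasedPath (basepoint C n)}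
    {P' Q' : BasedPath (basepoint C' n)} : φ.toCover P P' = φ.toCover Q Q' ↔
      ∃ f : Fundamental C n, f.proj = 1 ∧ Q = f • P ∧ Q' = φ.toEquiv n f • P' := by
  refine Quotient.eq.trans ⟨?_, ?_⟩
  · rintro ⟨a, a', h, h1, h2⟩
    refine ⟨Fundamental.ofLoop a, rfl, ?_, ?_⟩
    · rw [ofLoop_smul]
      exact h1
    · have h' : φ.toEquiv n (Fundamental.ofLoop a) = Fundamental.ofLoop a' := h
      rw [h', ofLoop_smul]
      exact h2
  · rintro ⟨f, hf, rfl, rfl⟩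
    obtain ⟨a, rfl⟩ := Fundamental.exists_ofLoop hf
    obtain ⟨a', h⟩ := φ.exists_ofLoop n a
    rw [h]
    exact ⟨a, a', h, ofLoop_smul a P, ofLoop_smul a' P'⟩

theorem toCover_smul_of_proj_eq_one {n : ℕ} (P : BasedPath (basepoint C n))
    (P' : BasedPath (basepoint C' n)) {f : Fundamental C n} (hf : f.proj = 1) :
    φ.toCover (f • P) (φ.toEquiv n f • P') = φ.toCover P P' :=
  (φ.toCover_eq_toCover_iff.2 ⟨f, hf, rfl, rfl⟩).symm

/-! ### Composition -/

/-- This is where compatibility of `φ` with `γ` is used: the two coordinates get multiplied by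
corresponding elements. -/
theorem toCover_comp_smul {k n : ℕ} (m : Fin k → ℕ) (h : ∑ i, m i = n)
    (f : Fundamental C k) (g : ∀ i, Fundamental C (m i)) (P : BasedPath (basepoint C k))
    (P' : BasedPath (basepoint C' k)) (Q : ∀ i, BasedPath (basepoint C (m i)))
    (Q' : ∀ i, BasedPath (basepoint C' (m i))) (s : 𝒢.G k) (hs : f.proj = s) :
    φ.toCover (BasedPath.comp m h (f • P) (fun i => g i • Q i))
      (BasedPath.comp m h (φ.toEquiv k f • P') (fun i => φ.toEquiv (m i) (g i) • Q' i)) =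
    φ.toCover (Fundamental.comp m h f g • BasedPath.comp (fun i => m ((𝒢.perm s).symm i))
        (sum_reindex (𝒢.perm s).symm m h) P (fun i => Q ((𝒢.perm s).symm i)))
      (φ.toEquiv n (Fundamental.comp m h f g) •
        BasedPath.comp (fun i => m ((𝒢.perm s).symm i))
          (sum_reindex (𝒢.perm s).symm m h) P' (fun i => Q' ((𝒢.perm s).symm i))) := by
  rw [BasedPath.comp_smul_of_proj_eq m h f g P Q s hs,
    BasedPath.comp_smul_of_proj_eq m h _ _ P' Q' s ((φ.proj_eq f).trans hs), φ.map_comp]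

/-- The composition of the connecting operad. -/
def coverComp {k n : ℕ} (m : Fin k → ℕ) (h : ∑ i, m i = n) (d : φ.CoverSpace k)
    (b : ∀ i, φ.CoverSpace (m i)) : φ.CoverSpace n :=
  φ.toCover (BasedPath.comp m h (Quotient.out d).1 (fun i => (Quotient.out (b i)).1))
    (BasedPath.comp m h (Quotient.out d).2 (fun i => (Quotient.out (b i)).2))

theorem exists_out_toCover {n : ℕ} (P : BasedPath (basepoint C n))
    (P' : BasedPath (basepoint C' n)) : ∃ f : Fundamental C n, f.proj = 1 ∧
      (Quotient.out (φ.toCover P P')).1 = f • P ∧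
        (Quotient.out (φ.toCover P P')).2 = φ.toEquiv n f • P' :=
  φ.toCover_eq_toCover_iff.1 (Quotient.out_eq (φ.toCover P P')).symm

/-- Independence of representatives: these change by elements over `1`, no permutation occurs, and
the composite of elements over `1` again lies over `1`. -/
theorem coverComp_toCover {k n : ℕ} (m : Fin k → ℕ) (h : ∑ i, m i = n)
    (P : BasedPath (basepoint C k))
    (P' : BasedPath (basepoint C' k)) (Q : ∀ i, BasedPath (basepoint C (m i)))
    (Q' : ∀ i, BasedPath (basepoint C' (m i))) :
    φ.coverComp m h (φ.toCover P P') (fun i => φ.toCover (Q i) (Q' i)) =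
      φ.toCover (BasedPath.comp m h P Q) (BasedPath.comp m h P' Q') := by
  obtain ⟨f, hf, h1, h2⟩ := φ.exists_out_toCover P P'
  choose g hg h3 h4 using fun i => φ.exists_out_toCover (Q i) (Q' i)
  rw [coverComp, h1, h2]
  simp only [h3, h4]
  rw [φ.toCover_comp_smul m h f g P P' Q Q' 1 hf, toCover_smul_of_proj_eq_one,
    BasedPath.comp_perm_one, BasedPath.comp_perm_one]
  rw [Fundamental.comp_proj, hf]
  simp only [hg]
  exact 𝒢.comp_one_one m h

/-! ### The action -/

section Action

variable (hC : ∀ k, PathConnectedSpace (C.space k))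

/-- The action of `G n` on the cover. -/
def coverSMul {n : ℕ} (g : 𝒢.G n) (d : φ.CoverSpace n) : φ.CoverSpace n :=
  let f := (have := hC n; Fundamental.exists_proj_eq (C := C) g).choose
  φ.toCover (f • (Quotient.out d).1) (φ.toEquiv n f • (Quotient.out d).2)

theorem coverSMul_toCover {n : ℕ} (f : Fundamental C n) {g : 𝒢.G n} (hg : f.proj = g)
    (P : BasedPath (basepoint C n)) (P' : BasedPath (basepoint C' n)) :
    φ.coverSMul hC g (φ.toCover P P') = φ.toCover (f • P) (φ.toEquiv n f • P') := by
  obtain ⟨k, hk, h1, h2⟩ := φ.exists_out_toCover P P'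
  have := hC n
  have hf := (Fundamental.exists_proj_eq (C := C) g).choose_spec
  simp only [coverSMul, h1, h2]
  generalize (Fundamental.exists_proj_eq (C := C) g).choose = f' at hf
  -- Here `f'` is the chosen lift of `g` and `k` is the change of representative. The two results
  -- differ by `f' k f⁻¹`, which lies over `g · 1 · g⁻¹ = 1`.
  rw [← φ.toCover_smul_of_proj_eq_one (f • P) (φ.toEquiv n f • P') (f := f' * k * f⁻¹)]
  · simp [smul_smul]
  · simp [Fundamental.mul_proj, Fundamental.inv_proj, hf, hk, hg]

/-- The action of `G n` on the cover. -/
abbrev coverAction (n : ℕ) : MulAction (𝒢.G n) (φ.CoverSpace n) where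
  smul := φ.coverSMul hC
  one_smul d := by
    obtain ⟨P, P', rfl⟩ := φ.exists_toCover d
    exact (φ.coverSMul_toCover hC 1 rfl P P').trans (by simp)
  mul_smul g g' d := by
    obtain ⟨P, P', rfl⟩ := φ.exists_toCover d
    have := hC n
    obtain ⟨f, rfl⟩ := Fundamental.exists_proj_eq (C := C) g
    obtain ⟨f', rfl⟩ := Fundamental.exists_proj_eq (C := C) g'
    refine (φ.coverSMul_toCover hC (f * f') rfl P P').trans ?_
    change _ = φ.coverSMul hC _ (φ.coverSMul hC _ _)
    rw [φ.coverSMul_toCover hC f' rfl, φ.coverSMul_toCover hC f rfl, map_mul, mul_smul, mul_smul]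

theorem fst_coverSMul {n : ℕ} (g : 𝒢.G n) (d : φ.CoverSpace n) :
    (φ.coverSMul hC g d).fst = g • d.fst := by
  obtain ⟨P, P', rfl⟩ := φ.exists_toCover d
  have := hC n
  obtain ⟨f, rfl⟩ := Fundamental.exists_proj_eq (C := C) g
  rw [φ.coverSMul_toCover hC f rfl]
  rfl

theorem snd_coverSMul {n : ℕ} (g : 𝒢.G n) (d : φ.CoverSpace n) :
    (φ.coverSMul hC g d).snd = g • d.snd := by
  obtain ⟨P, P', rfl⟩ := φ.exists_toCover d
  have := hC n
  obtain ⟨f, rfl⟩ := Fundamental.exists_proj_eq (C := C) g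
  rw [φ.coverSMul_toCover hC f rfl, ← φ.proj_eq f]
  rfl

end Action

theorem fst_coverComp {k n : ℕ} (m : Fin k → ℕ) (h : ∑ i, m i = n) (d : φ.CoverSpace k)
    (b : ∀ i, φ.CoverSpace (m i)) :
    (φ.coverComp m h d b).fst = C.op.comp m h d.fst (fun i => (b i).fst) := by
  obtain ⟨P, P', rfl⟩ := φ.exists_toCover d
  obtain ⟨Q, Q', rfl⟩ := φ.exists_toCover_family b
  rw [φ.coverComp_toCover]
  rfl

theorem snd_coverComp {k n : ℕ} (m : Fin k → ℕ) (h : ∑ i, m i = n) (d : φ.CoverSpace k)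
    (b : ∀ i, φ.CoverSpace (m i)) :
    (φ.coverComp m h d b).snd = C'.op.comp m h d.snd (fun i => (b i).snd) := by
  obtain ⟨P, P', rfl⟩ := φ.exists_toCover d
  obtain ⟨Q, Q', rfl⟩ := φ.exists_toCover_family b
  rw [φ.coverComp_toCover]
  rfl

/-- The points of the cover given by tuples of intervals. -/
def coverEta {n : ℕ} (c : Intervals n) : φ.CoverSpace n :=
  φ.toCover (etaPath C c) (etaPath C' c)

theorem coverEta_comp {k n : ℕ} (m : Fin k → ℕ) (h : ∑ i, m i = n) (a : Intervals k)
    (b : ∀ i, Intervals (m i)) : φ.coverEta (Intervals.comp m h a b) =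
      φ.coverComp m h (φ.coverEta a) (fun i => φ.coverEta (b i)) := by
  simp only [coverEta, coverComp_toCover, etaPath_comp]

/-- The operad structure on the covers. -/
def coverOperadStr : OperadStr φ.CoverSpace where
  subsingleton_zero := by
    refine ⟨fun d d' => ?_⟩
    obtain ⟨P, P', rfl⟩ := φ.exists_toCover d
    obtain ⟨Q, Q', rfl⟩ := φ.exists_toCover d'
    have key : ∀ {C : WellPointedGOperad.{u, v} 𝒢} (P Q : BasedPath (basepoint C 0)), P = Q := by
      intro C P Q
      have := C.op.subsingleton_zero
      obtain ⟨x, p⟩ := P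
      obtain ⟨y, q⟩ := Q
      obtain rfl : x = y := Subsingleton.elim _ _
      induction p with | mk p =>
      induction q with | mk q =>
      rw [Path.ext (funext fun t => Subsingleton.elim (p t) (q t))]
    rw [key P Q, key P' Q']
  nonempty_zero := ⟨φ.coverEta (Intervals.base 0)⟩
  one := φ.coverEta (Intervals.base 1)
  comp := φ.coverComp
  one_comp h d := by
    obtain ⟨P, P', rfl⟩ := φ.exists_toCover d
    exact (φ.coverComp_toCover _ h _ _ _ _).trans
      (by rw [BasedPath.one_comp, BasedPath.one_comp])
  comp_one h d := by
    obtain ⟨P, P', rfl⟩ := φ.exists_toCover d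
    exact (φ.coverComp_toCover _ h _ _ _ _).trans
      (by rw [BasedPath.comp_one, BasedPath.comp_one])
  assoc m h q hq d b c := by
    obtain ⟨P, P', rfl⟩ := φ.exists_toCover d
    obtain ⟨Q, Q', rfl⟩ := φ.exists_toCover_family b
    obtain ⟨S, S', rfl⟩ := φ.exists_toCover_family c
    simp only [coverComp_toCover]
    rw [BasedPath.comp_assoc, BasedPath.comp_assoc]

theorem coverComp_equivariance (hC : ∀ k, PathConnectedSpace (C.space k)) {k n : ℕ}
    (m : Fin k → ℕ) (h : ∑ i, m i = n) (s : 𝒢.G k)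
    (τ : ∀ i, 𝒢.G (m i)) (d : φ.CoverSpace k) (b : ∀ i, φ.CoverSpace (m i)) :
    φ.coverComp m h (φ.coverSMul hC s d) (fun i => φ.coverSMul hC (τ i) (b i)) =
      φ.coverSMul hC (𝒢.op.comp m h s τ)
        (φ.coverComp (fun i => m ((𝒢.perm s).symm i)) (sum_reindex (𝒢.perm s).symm m h) d
          (fun i => b ((𝒢.perm s).symm i))) := by
  obtain ⟨P, P', rfl⟩ := φ.exists_toCover d
  obtain ⟨Q, Q', rfl⟩ := φ.exists_toCover_family b
  have := hC k
  obtain ⟨f, hf⟩ := Fundamental.exists_proj_eq (C := C) s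
  choose g hg using fun i => (have := hC (m i); Fundamental.exists_proj_eq (C := C) (τ i))
  rw [φ.coverSMul_toCover hC f hf]
  have h1 : ∀ i, φ.coverSMul hC (τ i) (φ.toCover (Q i) (Q' i)) =
      φ.toCover (g i • Q i) (φ.toEquiv _ (g i) • Q' i) := fun i =>
    φ.coverSMul_toCover hC (g i) (hg i) _ _
  simp only [h1]
  rw [φ.coverComp_toCover, φ.toCover_comp_smul m h f g P P' Q Q' s hf,
    φ.coverComp_toCover _ _ P P' (fun i => Q ((𝒢.perm s).symm i))
      (fun i => Q' ((𝒢.perm s).symm i)),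
    φ.coverSMul_toCover hC (Fundamental.comp m h f g)]
  rw [Fundamental.comp_proj, hf]
  simp only [hg]

end FundamentalIso

end Operad

theorem _root_.IsCoveringMap.surjective_of_pathConnectedSpace {E X : Type*} [TopologicalSpace E]
    [TopologicalSpace X] [Nonempty E] [PathConnectedSpace X] {p : E → X} (hp : IsCoveringMap p) :
    Function.Surjective p := by
  intro x
  obtain ⟨ε⟩ := ‹Nonempty E›
  exact ⟨_, (hp.monodromy (.mk (PathConnectedSpace.somePath (p ε) x)) ⟨ε, rfl⟩).2⟩

/-! ### Exchange of the two factors, and the second projection -/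

namespace LoopCorrespondence

variable {X X' : Type u} [TopologicalSpace X] [TopologicalSpace X'] {e : X} {e' : X'}
  (R : LoopCorrespondence e e')

namespace Cover

variable {R}

/-- Exchange of the two factors. -/
def toSwap (d : R.Cover) : R.swap.Cover :=
  Quotient.map' (s₂ := R.swap.setoid) Prod.swap (by
    rintro P Q ⟨a, a', h, h1, h2⟩
    exact ⟨a', a, h, h2, h1⟩) d

theorem fst_toSwap (d : R.Cover) : fst (toSwap d) = snd d := by
  obtain ⟨x, x', p, p', rfl⟩ := exists_mk d
  rfl

theorem snd_toSwap (d : R.Cover) : snd (toSwap d) = fst d := by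
  obtain ⟨x, x', p, p', rfl⟩ := exists_mk d
  rfl

theorem toSwap_toSwap (d : R.Cover) : toSwap (toSwap d) = d := by
  obtain ⟨x, x', p, p', rfl⟩ := exists_mk d
  rfl

theorem IsTransport.toSwap {d d₁ : R.Cover} {γ : I → X} {γ' : I → X'}
    (h : IsTransport d d₁ γ γ') : IsTransport (toSwap d) (toSwap d₁) γ' γ := by
  obtain ⟨x, y, x', y', p, p', g, g', rfl, rfl, rfl, rfl⟩ := h
  exact isTransport_mk p' p g' g

variable [T2Space X] [T2Space X'] [LocallyPathConnectedSpace (𝐤 (X × X'))]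
  (hX : SemilocallySimplyConnected X) (hX' : SemilocallySimplyConnected X')

include hX hX'

theorem continuous_toSwap : Continuous (toSwap (R := R)) := by
  have hlh := isLocalHomeomorph_proj (R := R) hX hX'
  have : LocallyPathConnectedSpace R.Cover := hlh.locallyPathConnectedSpace
  refine continuous_of_isTransport ?_ fun d d₁ ω => ?_
  · have h := (kHomeomorph (Homeomorph.prodComm X X')).continuous.comp (continuous_proj (R := R))
    refine h.congr fun d => ?_
    change CompactCoherentification.mk _ (snd d, fst d) = CompactCoherentification.mk _ (_, _)
    rw [fst_toSwap, snd_toSwap]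
  · have h := (isTransport_path hX hX' ω.toContinuousMap).toSwap
    have e0 : ω.toContinuousMap 0 = d := ω.source
    have e1 : ω.toContinuousMap 1 = d₁ := ω.target
    rw [e0, e1] at h
    convert h using 2
    · exact fst_toSwap _
    · exact snd_toSwap _

variable [PathConnectedSpace X'] [CompactlyCoherentSpace X] [LocallyPathConnectedSpace X]
  {E : Type u} [TopologicalSpace E] [ContractibleSpace E]
  {ϖ : E → X} (hϖ : IsCoveringMap ϖ) (ε₀ : E) (hε₀ : ϖ ε₀ = e)

include hϖ hε₀

/-- The projection to a space of the homotopy type of a CW complex is a homotopy equivalence if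
the other space has a contractible covering space. -/
theorem isHomotopyEquiv_snd [CompactlyCoherentSpace X'] (hcw : HasCWHomotopyType X') :
    IsHomotopyEquiv (⟨snd, continuous_snd⟩ : C(R.Cover, X')) := by
  have : LocallyPathConnectedSpace (𝐤 (X' × X)) :=
    locallyPathConnectedSpace_kmk_of_homeomorph (Homeomorph.prodComm X X')
  obtain ⟨g, ⟨G₁⟩, ⟨G₂⟩⟩ := isHomotopyEquiv_fst (R := R.swap) hX' hX hϖ ε₀ hε₀ hcw
  let s : C(R.Cover, R.swap.Cover) := ⟨toSwap, continuous_toSwap hX hX'⟩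
  let s' : C(R.swap.Cover, R.Cover) := ⟨toSwap, continuous_toSwap (R := R.swap) hX' hX⟩
  have hs : (⟨snd, continuous_snd⟩ : C(R.Cover, X')) =
      (⟨fst, continuous_fst⟩ : C(R.swap.Cover, X')).comp s := by
    ext d
    exact (fst_toSwap d).symm
  have hss : s'.comp s = ContinuousMap.id _ := by
    ext d
    exact toSwap_toSwap d
  have hss' : s.comp s' = ContinuousMap.id _ := by
    ext d
    exact toSwap_toSwap (R := R.swap) d
  refine ⟨s'.comp g, ?_, ?_⟩
  · rw [hs]
    have h₁ : (g.comp ⟨fst, continuous_fst⟩).Homotopic (ContinuousMap.id R.swap.Cover) := ⟨G₁⟩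
    have := (ContinuousMap.Homotopic.refl s').comp (h₁.comp (ContinuousMap.Homotopic.refl s))
    rw [ContinuousMap.id_comp, hss] at this
    exact this
  · rw [hs, ContinuousMap.comp_assoc, ← ContinuousMap.comp_assoc s, hss', ContinuousMap.id_comp]
    exact ⟨G₂⟩

end Cover

end LoopCorrespondence

/-! ### Topology of the connecting operad and its two projections -/

section Operad

variable {𝒢 : GroupOperad.{v}} {C C' : WellPointedGOperad.{u, v} 𝒢}

open LoopCorrespondence

theorem GOperad.IsNiceKPiOne.locallyPathConnectedSpace_kmk_prod
    {C C' : GOperad.{u, v} 𝒢} (hC : C.IsNiceKPiOne) (hC' : C'.IsNiceKPiOne) (n : ℕ) :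
    LocallyPathConnectedSpace (𝐤 (C.space n × C'.space n)) := by
  have := hC.locPathConnected n
  have := hC'.locPathConnected n
  infer_instance

namespace FundamentalIso

variable (φ : FundamentalIso C C') (hC : C.toGOperad.IsNiceKPiOne)
  (hC' : C'.toGOperad.IsNiceKPiOne)

theorem isTransport_toCover {n : ℕ} (P : BasedPath (basepoint C n))
    (P' : BasedPath (basepoint C' n)) {x : C.space n} {x' : C'.space n} (p : Path P.1 x)
    (p' : Path P'.1 x') {d d₁ : φ.CoverSpace n} {γ : I → C.space n} {γ' : I → C'.space n}
    (h₀ : d = φ.toCover P P') (h₁ : d₁ = φ.toCover (P.extend (.mk p)) (P'.extend (.mk p')))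
    (h : ∀ t, γ t = p t) (h' : ∀ t, γ' t = p' t) : Cover.IsTransport d d₁ γ γ' := by
  obtain rfl := funext h
  obtain rfl := funext h'
  subst h₀ h₁
  exact Cover.isTransport_mk P.2 P'.2 p p'

include hC hC'

theorem isLocalHomeomorph_proj (n : ℕ) :
    IsLocalHomeomorph (Cover.proj (φ.correspondence n)) := by
  have := hC.locallyPathConnectedSpace_kmk_prod hC' n
  exact Cover.isLocalHomeomorph_proj (hC.semilocallySimplyConnected n)
    (hC'.semilocallySimplyConnected n)

theorem locallyPathConnectedSpace_coverSpace (n : ℕ) :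
    LocallyPathConnectedSpace (φ.CoverSpace n) := by
  have := hC.locallyPathConnectedSpace_kmk_prod hC' n
  exact (φ.isLocalHomeomorph_proj hC hC' n).locallyPathConnectedSpace

theorem compactlyCoherentSpace_coverSpace (n : ℕ) :
    CompactlyCoherentSpace (φ.CoverSpace n) :=
  (φ.isLocalHomeomorph_proj hC hC' n).compactlyCoherentSpace

theorem t2Space_coverSpace (n : ℕ) : T2Space (φ.CoverSpace n) :=
  Cover.t2Space_cover (hC.semilocallySimplyConnected n) (hC'.semilocallySimplyConnected n)

theorem exists_toCover_path {n : ℕ} {d d₁ : φ.CoverSpace n} (ω : Path d d₁) :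
    ∃ (P : BasedPath (basepoint C n)) (P' : BasedPath (basepoint C' n)) (x : C.space n)
      (x' : C'.space n) (p : Path P.1 x) (p' : Path P'.1 x'), d = φ.toCover P P' ∧
      d₁ = φ.toCover (P.extend (.mk p)) (P'.extend (.mk p')) ∧
      (∀ t, p t = (ω t).fst) ∧ ∀ t, p' t = (ω t).snd := by
  have := hC.locallyPathConnectedSpace_kmk_prod hC' n
  obtain ⟨x, y, x', y', p, p', g, g', h1, h2, h3, h4⟩ :=
    Cover.isTransport_path (hC.semilocallySimplyConnected n)
      (hC'.semilocallySimplyConnected n) ω.toContinuousMap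
  refine ⟨⟨x, p⟩, ⟨x', p'⟩, y, y', g, g', ?_, ?_, congrFun h3, congrFun h4⟩
  · exact ω.source.symm.trans h1
  · exact ω.target.symm.trans h2

theorem continuous_coverSMul {n : ℕ} (g : 𝒢.G n) :
    Continuous (φ.coverSMul hC.pathConnected g) := by
  have := φ.locallyPathConnectedSpace_coverSpace hC hC' n
  have := φ.compactlyCoherentSpace_coverSpace hC hC' n
  have := hC.pathConnected n
  obtain ⟨f, rfl⟩ := Fundamental.exists_proj_eq (C := C) g
  refine Cover.continuous_of_isTransport ?_ fun d d₁ ω => ?_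
  · refine continuous_mk_comp (f := fun d => (Cover.fst _, Cover.snd _)) ?_
    simp only [fst_coverSMul, snd_coverSMul]
    exact (Cover.continuous_fst.const_smul _).prodMk (Cover.continuous_snd.const_smul _)
  · obtain ⟨P, P', x, x', p, p', rfl, rfl, hp, hp'⟩ := φ.exists_toCover_path hC hC' ω
    refine φ.isTransport_toCover (f • P) (φ.toEquiv n f • P')
      (p.map (continuous_const_smul f.proj))
      (p'.map (continuous_const_smul (φ.toEquiv n f).proj))
      (φ.coverSMul_toCover _ f rfl P P') ?_ (fun t => ?_) (fun t => ?_)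
    · rw [φ.coverSMul_toCover _ f rfl, smul_extend, smul_extend]
      rfl
    · exact (φ.fst_coverSMul _ _ _).trans (congrArg (f.proj • ·) (hp t).symm)
    · refine (φ.snd_coverSMul _ _ _).trans ?_
      rw [← hp', ← φ.proj_eq]
      rfl

theorem continuousOn_coverComp {k n : ℕ} (m : Fin k → ℕ) (h : ∑ i, m i = n)
    (K : Set (φ.CoverSpace k × (∀ i, φ.CoverSpace (m i)))) (hK : IsCompact K) :
    ContinuousOn (fun p : φ.CoverSpace k × (∀ i, φ.CoverSpace (m i)) =>
      φ.coverComp m h p.1 p.2) K := by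
  have := φ.locallyPathConnectedSpace_coverSpace hC hC'
  have := φ.compactlyCoherentSpace_coverSpace hC hC'
  have := φ.t2Space_coverSpace hC hC'
  let W := φ.CoverSpace k × (∀ i, φ.CoverSpace (m i))
  let u : 𝐤 W → W := (CompactCoherentification.mk W).symm
  have hu : Continuous u := CompactCoherentification.continuous_mk_symm
  -- Continuity on compact sets follows from continuity on the compactly generated product `𝐤 W`,
  -- which is locally path-connected, so that the transport criterion applies.
  suffices hF : Continuous fun w : 𝐤 W => φ.coverComp m h (u w).1 (u w).2 from
    hF.comp_continuousOn (CompactCoherentification.continuousOn_isCompact_mk hK)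
  refine Cover.continuous_of_isTransport ?_ fun w w₁ ω => ?_
  · refine continuous_mk_comp (f := fun w => (Cover.fst _, Cover.snd _)) ?_
    simp only [fst_coverComp, snd_coverComp]
    have h1 : Continuous fun w : W => (w.1.fst, fun i => (w.2 i).fst) :=
      (Cover.continuous_fst.comp continuous_fst).prodMk
        (continuous_pi fun i => Cover.continuous_fst.comp
          (f := fun w : φ.CoverSpace k × (∀ i, φ.CoverSpace (m i)) => w.2 i) (by fun_prop))
    have h2 : Continuous fun w : W => (w.1.snd, fun i => (w.2 i).snd) :=
      (Cover.continuous_snd.comp continuous_fst).prodMk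
        (continuous_pi fun i => Cover.continuous_snd.comp
          (f := fun w : φ.CoverSpace k × (∀ i, φ.CoverSpace (m i)) => w.2 i) (by fun_prop))
    refine Continuous.prodMk ?_ ?_
    · refine continuous_of_continuousOn_isCompact fun L hL => ?_
      exact (C.continuousOn_comp m h _ (hL.image (h1.comp hu))).comp (h1.comp hu).continuousOn
        (mapsTo_image _ _)
    · refine continuous_of_continuousOn_isCompact fun L hL => ?_
      exact (C'.continuousOn_comp m h _ (hL.image (h2.comp hu))).comp (h2.comp hu).continuousOn
        (mapsTo_image _ _)
  · let ω' := ω.map hu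
    obtain ⟨P, P', x, x', p, p', h0, h1, hp, hp'⟩ :=
      φ.exists_toCover_path hC hC' (ω'.map continuous_fst)
    choose Q Q' y y' q q' h2 h3 hq hq' using fun i =>
      φ.exists_toCover_path hC hC' (ω'.map
        (f := fun w : φ.CoverSpace k × (∀ i, φ.CoverSpace (m i)) => w.2 i) (by fun_prop))
    have e1 : (u w).2 = fun i => φ.toCover (Q i) (Q' i) := funext h2
    have e2 : (u w₁).2 = fun i => φ.toCover ((Q i).extend (.mk (q i)))
      ((Q' i).extend (.mk (q' i))) := funext h3
    refine φ.isTransport_toCover (BasedPath.comp m h P Q) (BasedPath.comp m h P' Q')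
      (compPath m h p q) (compPath m h p' q') ?_ ?_ (fun t => ?_) (fun t => ?_)
    · rw [h0, e1, φ.coverComp_toCover]
    · rw [h1, e2, φ.coverComp_toCover, BasedPath.comp_extend, BasedPath.comp_extend, compClass_mk,
        compClass_mk]
      rfl
    · refine (φ.fst_coverComp m h _ _).trans ?_
      change _ = C.op.comp m h (p t) (fun i => q i t)
      simp only [hp, hq]
      rfl
    · refine (φ.snd_coverComp m h _ _).trans ?_
      change _ = C'.op.comp m h (p' t) (fun i => q' i t)
      simp only [hp', hq']
      rfl

omit hC hC' in
theorem continuous_coverEta (n : ℕ) : Continuous (φ.coverEta (n := n)) := by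
  refine Cover.continuous_of_isTransport ?_ fun c c₁ ω => ?_
  · exact continuous_mk_comp (f := fun c => (C.η n c, C'.η n c)) (by fun_prop)
  -- Prolonging the standard path to `c` along `ω` gives the standard path to `c₁`, since the
  -- intervals form a simply connected space.
  · have key : ∀ {C : WellPointedGOperad.{u, v} 𝒢},
        etaPath C c₁ = (etaPath C c).extend (.mk (ω.map (C.η n).continuous)) := by
      intro C
      refine BasedPath.ext_arrow ((arrow_etaPath
        (.trans (.mk (Intervals.linearPath _ _)) (.mk ω))).trans ?_)
      rw [quotient_map_trans]
      rfl
    exact φ.isTransport_toCover (etaPath C c) (etaPath C' c) (ω.map (C.η n).continuous)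
      (ω.map (C'.η n).continuous) rfl (congrArg₂ φ.toCover key key) (fun _ => rfl) fun _ => rfl

/-- The operad connecting `C` and `C'`. -/
def coverGOperad : GOperad.{u, v} 𝒢 :=
  letI act := fun n : ℕ => φ.coverAction hC.pathConnected n
  { space := φ.CoverSpace
    t2 := φ.t2Space_coverSpace hC hC'
    compactlyGenerated := φ.compactlyCoherentSpace_coverSpace hC hC'
    op := φ.coverOperadStr
    continuousOn_comp := φ.continuousOn_coverComp hC hC'
    action := act
    continuous_smul := fun _ => ⟨φ.continuous_coverSMul hC hC'⟩
    equivariance := φ.coverComp_equivariance hC.pathConnected }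

/-- The well-pointed operad connecting `C` and `C'`. -/
def coverOperad : WellPointedGOperad.{u, v} 𝒢 where
  toGOperad := φ.coverGOperad hC hC'
  η _ := ⟨φ.coverEta, φ.continuous_coverEta _⟩
  η_one := rfl
  η_comp := φ.coverEta_comp

/-- The property pulls back along the equivariant projection to `C`. -/
theorem isCovering_coverGOperad : (φ.coverGOperad hC hC').IsCovering := by
  intro n d
  let d : φ.CoverSpace n := d
  obtain ⟨U, hU, hd, H⟩ := hC.covering n d.fst
  refine ⟨Cover.fst ⁻¹' U, hU.preimage Cover.continuous_fst, hd, fun g hg y hy hgy => ?_⟩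
  refine H g hg _ hy ?_
  have := φ.fst_coverSMul hC.pathConnected g y
  rw [← this]
  exact hgy

/-- The projection to the first operad. -/
def fstHom : (φ.coverGOperad hC hC').Hom C.toGOperad where
  toFun _ := ⟨Cover.fst, Cover.continuous_fst⟩
  map_smul := φ.fst_coverSMul hC.pathConnected
  map_one := C.η_one
  map_comp := φ.fst_coverComp

/-- The projection to the second operad. -/
def sndHom : (φ.coverGOperad hC hC').Hom C'.toGOperad where
  toFun _ := ⟨Cover.snd, Cover.continuous_snd⟩
  map_smul := φ.snd_coverSMul hC.pathConnected
  map_one := C'.η_one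
  map_comp := φ.snd_coverComp

theorem equivStep_fst : (φ.coverOperad hC hC').EquivStep C := by
  refine ⟨φ.fstHom hC hC', Or.inr ⟨fun n => ?_, φ.isCovering_coverGOperad hC hC', hC.covering⟩,
    fun k c => rfl⟩
  have := hC.locallyPathConnectedSpace_kmk_prod hC' n
  have := hC.pathConnected n
  have := hC'.pathConnected n
  have := hC'.locPathConnected n
  obtain ⟨E, _, p, _, hp⟩ := (hC'.kPiOne n).contractible_cover
  obtain ⟨ε₀, hε₀⟩ := hp.surjective_of_pathConnectedSpace (basepoint C' n)
  exact Cover.isHomotopyEquiv_fst (hC.semilocallySimplyConnected n)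
    (hC'.semilocallySimplyConnected n) hp ε₀ hε₀ (hC.kPiOne n).cw

theorem equivStep_snd : (φ.coverOperad hC hC').EquivStep C' := by
  refine ⟨φ.sndHom hC hC', Or.inr ⟨fun n => ?_, φ.isCovering_coverGOperad hC hC', hC'.covering⟩,
    fun k c => rfl⟩
  have := hC.locallyPathConnectedSpace_kmk_prod hC' n
  have := hC.pathConnected n
  have := hC'.pathConnected n
  have := hC.locPathConnected n
  obtain ⟨E, _, p, _, hp⟩ := (hC.kPiOne n).contractible_cover
  obtain ⟨ε₀, hε₀⟩ := hp.surjective_of_pathConnectedSpace (basepoint C n)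
  exact Cover.isHomotopyEquiv_snd (hC.semilocallySimplyConnected n)
    (hC'.semilocallySimplyConnected n) hp ε₀ hε₀ (hC'.kPiOne n).cw

include φ in
theorem equivalent : C.Equivalent C' :=
  .trans _ _ _ (.symm _ _ (.rel _ _ (φ.equivStep_fst hC hC'))) (.rel _ _ (φ.equivStep_snd hC hC'))

end FundamentalIso

end Operad

/-! ## Equivalences induce isomorphisms of fundamental groups operads -/

/-- A homotopy equivalence induces an equivalence of fundamental groupoids, which is fully faithful.
-/
theorem IsHomotopyEquiv.bijective_map {X Y : Type u} [TopologicalSpace X] [TopologicalSpace Y]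
    {f : C(X, Y)} (hf : IsHomotopyEquiv f) (x y : X) :
    Function.Bijective fun p : PHQ x y => p.map f := by
  obtain ⟨g, h₁, h₂⟩ := hf
  exact (FundamentalGroupoidFunctor.equivOfHomotopyEquiv
    ⟨f, g, h₁, h₂⟩).fullyFaithfulFunctor.map_bijective ⟨x⟩ ⟨y⟩

theorem IsEquivariantHomotopyEquiv.isHomotopyEquiv {G : Type v} [Group G] {X Y : Type u}
    [TopologicalSpace X] [TopologicalSpace Y] [MulAction G X] [MulAction G Y] {f : C(X, Y)}
    (hf : IsEquivariantHomotopyEquiv G f) : IsHomotopyEquiv f := by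
  obtain ⟨g, -, ⟨H₁, -⟩, ⟨H₂, -⟩⟩ := hf
  exact ⟨g, ⟨H₁⟩, ⟨H₂⟩⟩

section Operad

variable {𝒢 : GroupOperad.{v}} {C D : WellPointedGOperad.{u, v} 𝒢}

theorem GOperad.Hom.IsEquivalence.isHomotopyEquiv {C D : GOperad.{u, v} 𝒢} {ψ : C.Hom D}
    (hψ : ψ.IsEquivalence) (n : ℕ) : IsHomotopyEquiv (ψ.toFun n) := by
  rcases hψ with h | h
  · exact (h n).isHomotopyEquiv
  · exact h.1 n

theorem arrow_map_translate (ψ : C.toGOperad.Hom D.toGOperad) {n : ℕ} (g : 𝒢.G n)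
    {x y : C.space n} (p : PHQ x y) :
    arrow ((translate g p).map (ψ.toFun n)) = arrow (translate g (p.map (ψ.toFun n))) := by
  induction p with | mk p =>
  exact arrow_mk_congr fun t => ψ.map_smul g (p t)

theorem arrow_map_compClass (ψ : C.toGOperad.Hom D.toGOperad) {k n : ℕ} (m : Fin k → ℕ)
    (h : ∑ i, m i = n) {a a' : C.space k} {b b' : ∀ i, C.space (m i)} (f : PHQ a a')
    (g : ∀ i, PHQ (b i) (b' i)) :
    arrow ((compClass m h f g).map (ψ.toFun n)) =
      arrow (compClass m h (f.map (ψ.toFun k)) (fun i => (g i).map (ψ.toFun (m i)))) := by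
  induction f with | mk f =>
  obtain ⟨g, rfl⟩ := exists_mk_family m g
  simp only [compClass_mk, ← Path.Homotopic.Quotient.mk_map]
  exact arrow_mk_congr fun t => ψ.map_comp m h _ _

variable {ψ : C.toGOperad.Hom D.toGOperad}
  (hη : ∀ (k : ℕ) (c : Intervals k), D.η k c = ψ.toFun k (C.η k c))

/-- The map of fundamental groups operads induced by a morphism of well-pointed operads. -/
def Fundamental.map {k : ℕ} (f : Fundamental C k) : Fundamental D k where
  proj := f.proj
  cls := (f.cls.map (ψ.toFun k)).cast (hη k _) (by
    rw [ψ.map_smul]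
    exact congrArg _ (hη k _))

namespace Fundamental

theorem arrow_map_cls {k : ℕ} (f : Fundamental C k) :
    arrow (f.map hη).cls = arrow (f.cls.map (ψ.toFun k)) :=
  arrow_cast _ _ _

include hη in
theorem arrow_map_basePath {k n : ℕ} (m : Fin k → ℕ) (h : ∑ i, m i = n) :
    arrow ((Path.Homotopic.Quotient.mk (basePath C m h)).map (ψ.toFun n)) =
      arrow (.mk (basePath D m h)) :=
  arrow_mk_congr fun _ => (hη n _).symm

include hη in
theorem arrow_map_basePath_symm {k n : ℕ} (m : Fin k → ℕ) (h : ∑ i, m i = n) :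
    arrow ((Path.Homotopic.Quotient.mk (basePath C m h).symm).map (ψ.toFun n)) =
      arrow (.mk (basePath D m h).symm) :=
  arrow_mk_congr fun _ => (hη n _).symm

theorem map_mul {k : ℕ} (f g : Fundamental C k) : (f * g).map hη = f.map hη * g.map hη := by
  refine Fundamental.ext_arrow rfl ((arrow_map_cls hη _).trans ?_)
  change arrow ((f.cls.trans ((translate f.proj g.cls).cast rfl _)).map _) = _
  rw [quotient_map_trans]
  refine arrow_trans_congr (arrow_map_cls hη f).symm ?_
  refine (arrow_map_congr _ (arrow_cast _ _ _)).trans ((arrow_map_translate ψ _ _).trans ?_)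
  exact (arrow_translate_congr f.proj (arrow_map_cls hη g).symm).trans (arrow_cast _ _ _).symm

theorem map_comp {k n : ℕ} (m : Fin k → ℕ) (h : ∑ i, m i = n) (f : Fundamental C k)
    (g : ∀ i, Fundamental C (m i)) : (Fundamental.comp m h f g).map hη =
      Fundamental.comp m h (f.map hη) (fun i => (g i).map hη) := by
  refine Fundamental.ext_arrow rfl ((arrow_map_cls hη _).trans ?_)
  simp only [Fundamental.comp]
  rw [quotient_map_trans, quotient_map_trans]
  refine arrow_trans_congr (arrow_trans_congr (arrow_map_basePath hη m h) ?_) ?_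
  · refine (arrow_map_congr _ (arrow_cast _ _ _)).trans ((arrow_map_compClass ψ m h _ _).trans ?_)
    exact (arrow_compClass_congr m h (arrow_map_cls hη f).symm
      fun i => (arrow_map_cls hη (g i)).symm).trans (arrow_cast _ _ _).symm
  · exact (arrow_map_translate ψ _ _).trans
      (arrow_translate_congr _ (arrow_map_basePath_symm hη _ _))

/-- The projection is preserved, so `g` can be fixed; then the claim concerns classes of paths from
`e_k` to `g e_k` only. -/
theorem map_bijective (hψ : ψ.IsEquivalence) (k : ℕ) :
    Function.Bijective fun f : Fundamental C k => f.map hη := by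
  have hb := (hψ.isHomotopyEquiv k).bijective_map
  constructor
  · rintro ⟨s, p⟩ ⟨s', q⟩ h
    obtain rfl : s = s' := congrArg Fundamental.proj h
    have h1 : arrow ((⟨s, p⟩ : Fundamental C k).map hη).cls =
        arrow ((⟨s, q⟩ : Fundamental C k).map hη).cls :=
      congrArg (fun f : Fundamental D k => arrow f.cls) h
    rw [arrow_map_cls, arrow_map_cls, arrow_inj] at h1
    obtain rfl := (hb _ _).1 h1
    rfl
  · rintro ⟨s, q⟩
    obtain ⟨p, hp⟩ := (hb (basepoint C k) (s • basepoint C k)).2 (q.cast (hη k _).symm (by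
      rw [ψ.map_smul]
      exact congrArg _ (hη k _).symm))
    refine ⟨⟨s, p⟩, Fundamental.ext_arrow rfl ((arrow_map_cls hη _).trans ?_)⟩
    exact (congrArg arrow hp).trans (arrow_cast _ _ _)

end Fundamental

/-- The isomorphism induced by an equivalence. -/
def FundamentalIso.ofIsEquivalence (hψ : ψ.IsEquivalence) : FundamentalIso C D where
  toEquiv k := MulEquiv.ofBijective (MonoidHom.mk' (fun f => f.map hη) (Fundamental.map_mul hη))
    (Fundamental.map_bijective hη hψ k)
  proj_eq _ := rfl
  map_comp := Fundamental.map_comp hη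

namespace FundamentalIso

variable (C) in
/-- The identity isomorphism. -/
def refl : FundamentalIso C C where
  toEquiv _ := MulEquiv.refl _
  proj_eq _ := rfl
  map_comp _ _ _ _ := rfl

/-- The inverse isomorphism. -/
def symm (φ : FundamentalIso C D) : FundamentalIso D C where
  toEquiv k := (φ.toEquiv k).symm
  proj_eq x := by rw [← φ.proj_eq, MulEquiv.apply_symm_apply]
  map_comp m h x y := by
    rw [MulEquiv.symm_apply_eq, φ.map_comp]
    simp

/-- The composite of two isomorphisms. -/
def trans {D' : WellPointedGOperad.{u, v} 𝒢} (φ : FundamentalIso C D)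
    (χ : FundamentalIso D D') : FundamentalIso C D' where
  toEquiv k := (φ.toEquiv k).trans (χ.toEquiv k)
  proj_eq x := (χ.proj_eq _).trans (φ.proj_eq x)
  map_comp m h x y := by simp [φ.map_comp, χ.map_comp]

end FundamentalIso

/-- The intermediate operads of a chain need be neither path-connected nor covering. This causes no
difficulty, because `Fundamental` keeps `g` as part of the data instead of recovering it from the
end point. -/
theorem WellPointedGOperad.Equivalent.nonempty_fundamentalIso (h : C.Equivalent D) :
    Nonempty (FundamentalIso C D) := by
  induction h with
  | rel _ _ h =>
    obtain ⟨ψ, hψ, hη⟩ := h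
    exact ⟨.ofIsEquivalence hη hψ⟩
  | refl _ => exact ⟨.refl _⟩
  | symm _ _ _ ih => exact ih.map .symm
  | trans _ _ _ _ _ ih₁ ih₂ => exact ih₁.elim fun φ => ih₂.map φ.trans

end Operad

end KPiOneOperads

end

open KPiOneOperads
theorem mainTheorem2 (𝒢 : GroupOperad.{v}) (C C' : WellPointedGOperad.{u, v} 𝒢)
    (hC : C.toGOperad.IsNiceKPiOne) (hC' : C'.toGOperad.IsNiceKPiOne) :
    C.Equivalent C' ↔ Nonempty (FundamentalIso C C') :=
  ⟨fun h => h.nonempty_fundamentalIso, fun ⟨φ⟩ => φ.equivalent hC hC'⟩
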